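/- Let $G$ be a finite group. **Marked unitary 2-representations.** An $H^*$-category is a category enriched in finite-dimensional complex Hilbert spaces, with antilinear maps $*\colon \mathrm{Hom}(x,y)\to\mathrm{Hom}(y,x)$ such that $f^{**}=f$, $(fg)^*=g^*f^*$, $(fg,h)=(g,f^*h)$ and $(fg,h)=(f,hg^*)$ (inner products are conjugate-linear in the first variable). A 2-Hilbert space is a Cauchy complete $H^*$-category, i.e. one with finite direct sums (including a zero object) in which all idempotents split. An object $e$ is simple if $\mathrm{End}(e)$ is one-dimensional. A 2-Hilbert space is finite-dimensional if it has finitely many isomorphism classes of simple objects, and marked if a representative $e_i$ of each of these classes is chosen; put $k_i=(\mathrm{id}_{e_i},\mathrm{id}_{e_i})>0$. A marked unitary 2-representation $\alpha$ of $G$ consists of a marked finite-dimensional 2-Hilbert space $H_\alpha$, linear $*$-functors $\alpha_g\colon H_\alpha\to H_\alpha$ ($g\in G$) which are unitary on hom-spaces, and unitary natural isomorphisms $a(e)\colon \mathrm{id}\Rightarrow\alpha_e$ and $a(g_2,g_1)\colon\alpha_{g_2}\alpha_{g_1}\Rightarrow\alpha_{g_2g_1}$ satisfying the usual unit and associativity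 conditions. An intertwiner $\sigma\colon\alpha\to\beta$ is a linear $*$-functor $\sigma\colon H_\alpha\to H_\beta$ with unitary natural isomorphisms $\sigma(g)\colon\beta_g\sigma\Rightarrow\sigma\alpha_g$ compatible with the coherence isomorphisms. A 2-morphism (modification) $\theta\colon\sigma\Rightarrow\rho$ is a natural transformation with $\theta_{\alpha_g(x)}\circ\sigma(g)_x=\rho(g)_x\circ\beta_g(\theta_x)$ for all $g,x$; these form a vector space with inner product $\langle\theta,\theta'\rangle=\sum_i k_i(\theta_{e_i},\theta'_{e_i})$. With the evident compositions this is a 2-category $2\mathrm{Rep}_m(G)$. **Gerbes.** A finite $G$-equivariant gerbe with metric is a finite $G$-set $X$ with a groupoid $\mathcal X$ with object set $X$ that is a central extension, by the trivial bundle of groups $U(1)$, of the action groupoid of $X$, together with a $G$-invariant function $k\colon X\to(0,\infty)$. A morphism $\mathcal X\to\mathcal Y$ is a unitary equivariant vector bundle $E$ over $\mathcal Y\otimes\overline{\mathcal X}$: finite-dimensional Hilbert spaces $\langle y|E|x\rangle$ and unitary maps $\langle y|E|x\rangle\to\langle y'|E|x'\rangle$ for pairs of arrows $v\colon y\to y'$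 of $\mathcal Y$, $u\colon x\to x'$ of $\mathcal X$ over the same element of $G$, functorial, with $U(1)$ acting linearly through $v$ and conjugate-linearly through $u$. A 2-morphism is an equivariant family of linear maps; these form a vector space with inner product $\langle f,g\rangle=\sum_{x,y}k_xk_y\,\mathrm{Tr}(f_{y,x}^*\,g_{y,x})$. Composition is the convolution $\langle z|F\circ E|x\rangle=\bigoplus_y\frac1{k_y}\langle z|F|y\rangle\otimes\langle y|E|x\rangle$, and the identity of $\mathcal X$ has fibers $\langle y|\mathrm{id}|x\rangle=\delta_{y,x}k_x\mathbb C$ (here $cV$ is $V$ with its inner product multiplied by $c$). With the evident associators and unitors this is a 2-category $\mathrm{Gerbes}(G)$. **The construction.** For $\alpha\in 2\mathrm{Rep}_m(G)$ let $\mathcal X_\alpha$ be the gerbe whose points are the indices $i$ of the marked simple objects, with $g\cdot i$ determined by $e_{g\cdot i}\cong\alpha_g(e_i)$; whose arrows $i\to g\cdot i$ over $g$ are the unitaries $u\colon e_{g\cdot i}\to\alpha_g(e_i)$, with composition $v\diamond u=a(h,g)_{e_i}\circ\alpha_h(u)\circ v$ for $u$ over $g$ and $v$ over $h$, identities $a(e)_{e_i}$,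 and $U(1)$ acting by scalar multiplication; and whose metric is $i\mapsto k_i$. For an intertwiner $\sigma\colon\alpha\to\beta$ let $\langle\sigma\rangle\colon\mathcal X_\alpha\to\mathcal X_\beta$ have fibers $\langle\mu|\sigma|i\rangle=\mathrm{Hom}(e_\mu,\sigma(e_i))$, on which a pair of arrows $v\colon e_{g\cdot\mu}\to\beta_g(e_\mu)$, $u\colon e_{g\cdot i}\to\alpha_g(e_i)$ acts by $\lambda\mapsto\sigma(u)^*\circ\sigma(g)_{e_i}\circ\beta_g(\lambda)\circ v$. For $\theta\colon\sigma\Rightarrow\rho$ let $\langle\theta\rangle_{\mu,i}\colon f\mapsto\theta_{e_i}\circ f$. **Theorem.** The assignment $\alpha\mapsto\mathcal X_\alpha$, $\sigma\mapsto\langle\sigma\rangle$, $\theta\mapsto\langle\theta\rangle$ is a weak 2-functor $2\mathrm{Rep}_m(G)\to\mathrm{Gerbes}(G)$, with compositors $\langle\rho\rangle\circ\langle\sigma\rangle\to\langle\rho\circ\sigma\rangle$, $f\otimes g\mapsto\rho(g)\circ f$ for $f\in\mathrm{Hom}(e_\kappa,\rho(e_\mu))$ and $g\in\mathrm{Hom}(e_\mu,\sigma(e_i))$,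 and unit isomorphisms $\mathrm{id}_{\mathcal X_\alpha}\to\langle\mathrm{id}_\alpha\rangle$, $1\mapsto\mathrm{id}_{e_i}$. This 2-functor is an equivalence of 2-categories: every finite $G$-equivariant gerbe with metric is equivalent in $\mathrm{Gerbes}(G)$ to some $\mathcal X_\alpha$, and for all $\alpha,\beta$ the functor $\mathrm{Hom}(\alpha,\beta)\to\mathrm{Hom}(\mathcal X_\alpha,\mathcal X_\beta)$ is an equivalence of categories. Moreover, for all intertwiners $\sigma,\rho\colon\alpha\to\beta$ the map $\theta\mapsto\langle\theta\rangle$ is a unitary linear isomorphism from the space of 2-morphisms $\sigma\Rightarrow\rho$ onto the space of 2-morphisms $\langle\sigma\rangle\Rightarrow\langle\rho\rangle$. -/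

import Mathlib

open CategoryTheory Bicategory
open scoped TensorProduct ComplexConjugate

universe w v u u₁ u₂

namespace TwoRepGerbe

set_option linter.unusedVariables false
set_option linter.unusedSectionVars false
set_option linter.checkUnivs false

noncomputable section

/-! ## Finite-dimensional Hilbert spaces -/

/-- A finite-dimensional complex Hilbert space. The inner product is conjugate-linear in the first
variable. -/
structure Hilb : Type (u + 1) where
  carrier : Type u
  [addCommGroup : AddCommGroup carrier]
  [module : Module ℂ carrier]
  [finite : Module.Finite ℂ carrier]
  core : InnerProductSpace.Core ℂ carrier

instance : CoeSort Hilb.{u} (Type u) := ⟨Hilb.carrier⟩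

attribute [instance] Hilb.addCommGroup Hilb.module Hilb.finite

/-- The inner product of a Hilbert space. -/
def Hilb.ip {V : Hilb.{u}} (x y : V) : ℂ := V.core.inner x y

namespace Hilb

variable {V W : Hilb.{u}}

lemma ip_conj (x y : V) : conj (ip y x) = ip x y := V.core.conj_inner_symm x y

lemma ip_add_left (x y z : V) : ip (x + y) z = ip x z + ip y z := V.core.add_left x y z

lemma ip_smul_left (r : ℂ) (x y : V) : ip (r • x) y = conj r * ip x y := V.core.smul_left x y r

lemma ip_add_right (x y z : V) : ip x (y + z) = ip x y + ip x z := by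
  rw [← ip_conj, ip_add_left, map_add, ip_conj, ip_conj]

lemma ip_smul_right (r : ℂ) (x y : V) : ip x (r • y) = r * ip x y := by
  rw [← ip_conj, ip_smul_left, map_mul, ip_conj, Complex.conj_conj]

lemma ip_zero_left (x : V) : ip 0 x = 0 := by
  have := ip_smul_left 0 (0 : V) x
  simpa using this

lemma ip_zero_right (x : V) : ip x 0 = 0 := by
  rw [← ip_conj, ip_zero_left, map_zero]

/-- The trace `Tr (f^* g)` for linear maps `f, g` between Hilbert spaces, where `f^*` is the
adjoint of `f`. -/
def traceAdjMul (f g : V →ₗ[ℂ] W) : ℂ :=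
  letI : NormedAddCommGroup V := V.core.toNormedAddCommGroup
  letI : InnerProductSpace ℂ V := InnerProductSpace.ofCore V.core.toCore
  letI : NormedAddCommGroup W := W.core.toNormedAddCommGroup
  letI : InnerProductSpace ℂ W := InnerProductSpace.ofCore W.core.toCore
  LinearMap.trace ℂ V (LinearMap.adjoint f ∘ₗ g)

/-- The inner product on `V ⊗ W`, with `(v ⊗ w, v' ⊗ w') = (v, v') (w, w')`. -/
@[reducible] def tensorCore (V W : Hilb.{u}) : InnerProductSpace.Core ℂ (V ⊗[ℂ] W) :=
  letI : NormedAddCommGroup V := V.core.toNormedAddCommGroup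
  letI : InnerProductSpace ℂ V := InnerProductSpace.ofCore V.core.toCore
  letI : NormedAddCommGroup W := W.core.toNormedAddCommGroup
  letI : InnerProductSpace ℂ W := InnerProductSpace.ofCore W.core.toCore
  InnerProductSpace.toCore (𝕜 := ℂ) (E := V ⊗[ℂ] W)

lemma tensorCore_tmul (v v' : V) (w w' : W) :
    (tensorCore V W).inner (v ⊗ₜ w) (v' ⊗ₜ w') = ip v v' * ip w w' := rfl

/-- The tensor product of two Hilbert spaces. -/
def tensor (V W : Hilb.{u}) : Hilb.{u} where
  carrier := V ⊗[ℂ] W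
  core := tensorCore V W

/-- The weighted direct sum `⊕_y (1 / k y) V y`, realized as the space of sections of `V`; its
inner product is `(s, t) = ∑ y, (1 / k y) (s y, t y)`. -/
def weightedSum {Y : Type u} [Fintype Y] (k : Y → ℝ) (hk : ∀ y, 0 < k y) (V : Y → Hilb.{u}) :
    Hilb.{u} where
  carrier := (y : Y) → V y
  core :=
    { inner := fun s t => ∑ y, ((1 / k y : ℝ) : ℂ) * ip (s y) (t y)
      conj_inner_symm := fun s t => by
        simp only [map_sum, map_mul, Complex.conj_ofReal, ip_conj]
      re_inner_nonneg := fun s => by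
        simp only [map_sum]
        refine Finset.sum_nonneg fun y _ => ?_
        have h := (V y).core.re_inner_nonneg (s y)
        simp only [RCLike.re_to_complex, Complex.re_ofReal_mul] at h ⊢
        exact mul_nonneg (one_div_pos.2 (hk y)).le h
      add_left := fun s t r => by
        simp only [Pi.add_apply, ip_add_left, mul_add, Finset.sum_add_distrib]
      smul_left := fun s t r => by
        simp only [Pi.smul_apply, ip_smul_left, Finset.mul_sum]
        exact Finset.sum_congr rfl fun y _ => by ring
      definite := fun s hs => by
        have hnn : ∀ y, 0 ≤ (1 / k y) * (ip (s y) (s y)).re := fun y =>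
          mul_nonneg (one_div_pos.2 (hk y)).le ((V y).core.re_inner_nonneg (s y))
        have h0 : ∑ y, (1 / k y) * (ip (s y) (s y)).re = 0 := by
          have := congrArg Complex.re hs
          simpa only [Complex.re_sum, Complex.re_ofReal_mul, Complex.zero_re] using this
        funext y
        have h1 := (Finset.sum_eq_zero_iff_of_nonneg fun y _ => hnn y).1 h0 y (Finset.mem_univ y)
        have h2 : (ip (s y) (s y)).re = 0 := by
          rcases mul_eq_zero.1 h1 with h | h
          · exact absurd h (one_div_pos.2 (hk y)).ne'
          · exact h
        have h3 : (ip (s y) (s y)).im = 0 := by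
          have := congrArg Complex.im (ip_conj (s y) (s y))
          simp only [Complex.conj_im] at this
          linarith
        exact (V y).core.definite (s y) (Complex.ext h2 h3) }

end Hilb

/-! ## Convolution of families of Hilbert spaces -/

section Conv

variable {Y : Type u} [Fintype Y] (k : Y → ℝ) (hk : ∀ y, 0 < k y)

/-- The weighted direct sum `⊕_y (1 / k y) V y ⊗ W y`. -/
def conv (V W : Y → Hilb.{u}) : Hilb.{u} :=
  Hilb.weightedSum k hk fun y => (V y).tensor (W y)

variable {k hk} {V W V' W' : Y → Hilb.{u}}

open Classical in
/-- The section of `V ⊗ W` which is `a ⊗ b` at `y` and zero elsewhere. -/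
def conv.mk (y : Y) : V y →ₗ[ℂ] W y →ₗ[ℂ] conv k hk V W :=
  (TensorProduct.mk ℂ (V y) (W y)).compr₂
    (LinearMap.single ℂ (fun y => V y ⊗[ℂ] W y) y : V y ⊗[ℂ] W y →ₗ[ℂ] (y : Y) → V y ⊗[ℂ] W y)

/-- Linear maps out of a convolution are families of bilinear maps. -/
def conv.lift {M : Type u₁} [AddCommGroup M] [Module ℂ M]
    (B : ∀ y, V y →ₗ[ℂ] W y →ₗ[ℂ] M) : conv k hk V W →ₗ[ℂ] M :=
  ∑ y, TensorProduct.lift (B y) ∘ₗ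
    (LinearMap.proj y : ((y : Y) → V y ⊗[ℂ] W y) →ₗ[ℂ] V y ⊗[ℂ] W y)

@[simp] lemma conv.lift_mk {M : Type u₁} [AddCommGroup M] [Module ℂ M]
    (B : ∀ y, V y →ₗ[ℂ] W y →ₗ[ℂ] M) (y : Y) (a : V y) (b : W y) :
    conv.lift (k := k) (hk := hk) B (conv.mk y a b) = B y a b := by
  classical
  have : conv.lift (k := k) (hk := hk) B (conv.mk y a b) =
      ∑ y', TensorProduct.lift (B y') ((Pi.single y (a ⊗ₜ[ℂ] b) :
        (y : Y) → V y ⊗[ℂ] W y) y') := by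
    simp only [conv.lift, LinearMap.sum_apply]
    refine Finset.sum_congr rfl fun y' _ => ?_
    simp only [conv.mk]
    congr!
  rw [this, Finset.sum_eq_single y]
  · simp
  · intro y' _ h
    rw [Pi.single_eq_of_ne h, map_zero]
  · simp

lemma conv.induction {p : conv k hk V W → Prop} (s : conv k hk V W) (h0 : p 0)
    (hadd : ∀ s t, p s → p t → p (s + t)) (hmk : ∀ y a b, p (conv.mk y a b)) : p s := by
  classical
  have hs : s = ∑ y, (LinearMap.single ℂ (fun y => V y ⊗[ℂ] W y) y (s y) :
      (y : Y) → V y ⊗[ℂ] W y) := by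
    funext y
    exact (congrFun (Finset.univ_sum_single (show (y : Y) → V y ⊗[ℂ] W y from s)) y).symm
  have key : ∀ y (t : V y ⊗[ℂ] W y), p (LinearMap.single ℂ (fun y => V y ⊗[ℂ] W y) y t) := by
    intro y t
    induction t with
    | zero => rw [map_zero]; exact h0
    | tmul a b => exact hmk y a b
    | add a b ha hb => rw [map_add]; exact hadd _ _ ha hb
  rw [hs]
  exact Finset.sum_induction (M := conv k hk V W) _ p hadd h0 fun y _ => key y (s y)

lemma conv.hom_ext {M : Type u₁} [AddCommGroup M] [Module ℂ M] {f g : conv k hk V W →ₗ[ℂ] M}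
    (h : ∀ y a b, f (conv.mk y a b) = g (conv.mk y a b)) : f = g := by
  ext s
  induction s using conv.induction with
  | h0 => simp
  | hadd s t hs ht => simp [hs, ht]
  | hmk y a b => exact h y a b

lemma conv.ip_mk (y : Y) (a a' : V y) (b b' : W y) :
    Hilb.ip (conv.mk y a b : conv k hk V W) (conv.mk y a' b') =
      ((1 / k y : ℝ) : ℂ) * (Hilb.ip a a' * Hilb.ip b b') := by
  classical
  have : Hilb.ip (conv.mk y a b : conv k hk V W) (conv.mk y a' b') =
      ∑ y', ((1 / k y' : ℝ) : ℂ) * Hilb.ip (V := (V y').tensor (W y'))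
        ((Pi.single y (a ⊗ₜ[ℂ] b) : (y : Y) → V y ⊗[ℂ] W y) y')
        ((Pi.single y (a' ⊗ₜ[ℂ] b') : (y : Y) → V y ⊗[ℂ] W y) y') := by
    simp only [conv.mk]
    refine Finset.sum_congr rfl fun y' _ => ?_
    congr!
  rw [this, Finset.sum_eq_single y]
  · simp only [Pi.single_eq_same]
    rfl
  · intro y' _ h
    rw [Pi.single_eq_of_ne h]
    erw [Hilb.ip_zero_left]
    simp
  · simp

lemma conv.ip_mk_ne {y y' : Y} (h : y ≠ y') (a : V y) (a' : V y') (b : W y) (b' : W y') :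
    Hilb.ip (conv.mk y a b : conv k hk V W) (conv.mk y' a' b') = 0 := by
  classical
  have : Hilb.ip (conv.mk y a b : conv k hk V W) (conv.mk y' a' b') =
      ∑ x, ((1 / k x : ℝ) : ℂ) * Hilb.ip (V := (V x).tensor (W x))
        ((Pi.single y (a ⊗ₜ[ℂ] b) : (y : Y) → V y ⊗[ℂ] W y) x)
        ((Pi.single y' (a' ⊗ₜ[ℂ] b') : (y : Y) → V y ⊗[ℂ] W y) x) := by
    simp only [conv.mk]
    refine Finset.sum_congr rfl fun y' _ => ?_
    congr!
  rw [this]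
  refine Finset.sum_eq_zero fun x _ => ?_
  by_cases hx : x = y
  · subst hx
    rw [Pi.single_eq_of_ne h]
    erw [Hilb.ip_zero_right]
    simp
  · rw [Pi.single_eq_of_ne hx]
    erw [Hilb.ip_zero_left]
    simp

end Conv

/-! ## Finite equivariant gerbes with metrics -/

/-- A finite `G`-equivariant gerbe equipped with a metric: a central extension of the action
groupoid of a finite `G`-set `pt` by the trivial bundle of groups `U(1)`. The extension is a
groupoid with object set `pt`; `deg` is the projection to the action groupoid (whose arrows `x ⟶ y`
are the `g` with `g • x = y`), and `phase` is the inclusion of `U(1)`. The positive numbers `k x`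
are the metric. -/
structure Gerbe (G : Type w) [Group G] : Type (max (u + 1) (w + 1)) where
  pt : Type u
  [fintype : Fintype pt]
  [action : MulAction G pt]
  [groupoid : Groupoid.{max u w} pt]
  deg : ∀ {x y : pt}, (x ⟶ y) → G
  deg_smul : ∀ {x y : pt} (a : x ⟶ y), deg a • x = y
  deg_comp : ∀ {x y z : pt} (a : x ⟶ y) (b : y ⟶ z), deg (a ≫ b) = deg b * deg a
  deg_full : ∀ (g : G) (x : pt), ∃ a : x ⟶ g • x, deg a = g
  phase : Circle → ∀ x : pt, x ⟶ x
  phase_mul : ∀ (ζ ξ : Circle) (x : pt), phase (ζ * ξ) x = phase ζ x ≫ phase ξ x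
  phase_injective : ∀ x : pt, Function.Injective fun ζ => phase ζ x
  deg_phase : ∀ (ζ : Circle) (x : pt), deg (phase ζ x) = 1
  exists_phase : ∀ {x : pt} (a : x ⟶ x), deg a = 1 → ∃ ζ, a = phase ζ x
  phase_comm : ∀ (ζ : Circle) {x y : pt} (a : x ⟶ y), phase ζ x ≫ a = a ≫ phase ζ y
  k : pt → ℝ
  k_pos : ∀ x, 0 < k x
  k_smul : ∀ (g : G) (x : pt), k (g • x) = k x

attribute [instance] Gerbe.fintype Gerbe.action Gerbe.groupoid

namespace Gerbe

variable {G : Type w} [Group G] (X Y Z : Gerbe.{w, u} G)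

lemma phase_one (x : X.pt) : X.phase 1 x = 𝟙 x := by
  have h : X.phase 1 x ≫ X.phase 1 x = X.phase 1 x ≫ 𝟙 x := by
    rw [← X.phase_mul, mul_one, Category.comp_id]
  exact (cancel_epi _).1 h

lemma deg_id (x : X.pt) : X.deg (𝟙 x) = 1 := by
  rw [← X.phase_one, X.deg_phase]

variable {X Y Z}

lemma exists_eq_comp_phase {x y : X.pt} (a b : x ⟶ y) (h : X.deg a = X.deg b) :
    ∃ ζ, b = a ≫ X.phase ζ y := by
  have h1 : X.deg (inv a ≫ b) = 1 := by
    rw [X.deg_comp, ← h, ← X.deg_comp, IsIso.inv_hom_id, X.deg_id]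
  obtain ⟨ζ, hζ⟩ := X.exists_phase _ h1
  exact ⟨ζ, by rw [← hζ, IsIso.hom_inv_id_assoc]⟩

lemma comp_phase_comp {x y z : X.pt} (a : x ⟶ y) (ζ : Circle) (b : y ⟶ z) :
    (a ≫ X.phase ζ y) ≫ b = (a ≫ b) ≫ X.phase ζ z := by
  rw [Category.assoc, X.phase_comm, Category.assoc]

lemma comp_comp_phase {x y z : X.pt} (a : x ⟶ y) (ζ : Circle) (b : y ⟶ z) :
    a ≫ (b ≫ X.phase ζ z) = (a ≫ b) ≫ X.phase ζ z := by
  rw [Category.assoc]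

lemma comp_phase_phase {x y : X.pt} (a : x ⟶ y) (ζ ξ : Circle) :
    (a ≫ X.phase ζ y) ≫ X.phase ξ y = a ≫ X.phase (ζ * ξ) y := by
  rw [X.phase_mul, Category.assoc]

lemma comp_phase_injective {x y : X.pt} (a : x ⟶ y) {ζ ξ : Circle}
    (h : a ≫ X.phase ζ y = a ≫ X.phase ξ y) : ζ = ξ :=
  X.phase_injective y ((cancel_epi a).1 h)

/-- An arrow out of `y` in the direction of `g`. -/
def arrow (X : Gerbe.{w, u} G) (g : G) (x : X.pt) : x ⟶ g • x := (X.deg_full g x).choose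

@[simp] lemma deg_arrow (g : G) (x : X.pt) : X.deg (X.arrow g x) = g :=
  (X.deg_full g x).choose_spec

variable (X) in
/-- The conjugate gerbe: the same groupoid, with the conjugate action of `U(1)`. -/
def bar : Gerbe.{w, u} G where
  pt := X.pt
  deg a := X.deg a
  deg_smul := X.deg_smul
  deg_comp := X.deg_comp
  deg_full := X.deg_full
  phase ζ x := X.phase ζ⁻¹ x
  phase_mul ζ ξ x := by rw [mul_inv, X.phase_mul]
  phase_injective x ζ ξ h := inv_injective (X.phase_injective x h)
  deg_phase ζ x := X.deg_phase _ x
  exists_phase a h := by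
    obtain ⟨ζ, hζ⟩ := X.exists_phase a h
    exact ⟨ζ⁻¹, by rw [inv_inv, hζ]⟩
  phase_comm ζ _ _ a := X.phase_comm _ a
  k := X.k
  k_pos := X.k_pos
  k_smul := X.k_smul

/-! ### Tensor product of gerbes -/

/-- Two pairs of arrows of the same degree are identified when they are of the form
`(a, ζ b)` and `(ζ a, b)` for some `ζ` in `U(1)`. -/
def tensorSetoid (Y X : Gerbe.{w, u} G) (p q : Y.pt × X.pt) :
    Setoid {c : (p.1 ⟶ q.1) × (p.2 ⟶ q.2) // Y.deg c.1 = X.deg c.2} where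
  r c d := ∃ ζ, d.1.1 = c.1.1 ≫ Y.phase ζ _ ∧ c.1.2 = d.1.2 ≫ X.phase ζ _
  iseqv :=
    { refl := fun c => ⟨1, by rw [phase_one, Category.comp_id], by
        rw [phase_one, Category.comp_id]⟩
      symm := by
        rintro c d ⟨ζ, h1, h2⟩
        exact ⟨ζ⁻¹, by rw [h1, comp_phase_phase, mul_inv_cancel, phase_one, Category.comp_id], by
          rw [h2, comp_phase_phase, mul_inv_cancel, phase_one, Category.comp_id]⟩
      trans := by
        rintro c d e ⟨ζ, h1, h2⟩ ⟨ξ, h3, h4⟩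
        exact ⟨ζ * ξ, by rw [h3, h1, comp_phase_phase], by
          rw [h2, h4, comp_phase_phase, mul_comm]⟩ }

/-- The arrows of the tensor product of two gerbes: the tensor product of the `U(1)`-torsors of
arrows of `Y` and of `X` of the same degree. -/
def TensorHom (Y X : Gerbe.{w, u} G) (p q : Y.pt × X.pt) : Type (max u w) :=
  Quotient (tensorSetoid Y X p q)

/-- The arrow `a ⊗ b`. -/
def TensorHom.mk {p q : Y.pt × X.pt} (a : p.1 ⟶ q.1) (b : p.2 ⟶ q.2) (h : Y.deg a = X.deg b) :
    TensorHom Y X p q :=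
  Quotient.mk (tensorSetoid Y X p q) ⟨(a, b), h⟩

lemma TensorHom.ind {p q : Y.pt × X.pt} {C : TensorHom Y X p q → Prop}
    (h : ∀ a b h, C (TensorHom.mk a b h)) (t : TensorHom Y X p q) : C t :=
  Quotient.ind (fun c => h c.1.1 c.1.2 c.2) t

lemma TensorHom.mk_eq_mk {p q : Y.pt × X.pt} {a a' : p.1 ⟶ q.1} {b b' : p.2 ⟶ q.2}
    {h : Y.deg a = X.deg b} {h' : Y.deg a' = X.deg b'} :
    TensorHom.mk a b h = TensorHom.mk a' b' h' ↔
      ∃ ζ, a' = a ≫ Y.phase ζ _ ∧ b = b' ≫ X.phase ζ _ :=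
  Quotient.eq (r := tensorSetoid Y X p q)

/-- Composition of arrows in the tensor product, `(a ⊗ b) ≫ (a' ⊗ b') = (a ≫ a') ⊗ (b ≫ b')`. -/
def TensorHom.comp {p q r : Y.pt × X.pt} (s : TensorHom Y X p q) (t : TensorHom Y X q r) :
    TensorHom Y X p r :=
  Quotient.liftOn₂ s t
    (fun c d => TensorHom.mk (c.1.1 ≫ d.1.1) (c.1.2 ≫ d.1.2) (by
      rw [Y.deg_comp, X.deg_comp, c.2, d.2]))
    (by
      rintro c d c' d' ⟨ζ, h1, h2⟩ ⟨ξ, h3, h4⟩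
      refine TensorHom.mk_eq_mk.2 ⟨ζ * ξ, ?_, ?_⟩
      · rw [h1, h3, comp_phase_comp, comp_comp_phase, comp_phase_phase, mul_comm]
      · rw [h2, h4, comp_phase_comp, comp_comp_phase, comp_phase_phase, mul_comm])

@[simp] lemma TensorHom.mk_comp_mk {p q r : Y.pt × X.pt} (a : p.1 ⟶ q.1) (b : p.2 ⟶ q.2) (h)
    (a' : q.1 ⟶ r.1) (b' : q.2 ⟶ r.2) (h') :
    (TensorHom.mk a b h : TensorHom Y X p q).comp (TensorHom.mk a' b' h' : TensorHom Y X q r) =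
      TensorHom.mk (a ≫ a') (b ≫ b') (by rw [Y.deg_comp, X.deg_comp, h, h']) := rfl

lemma deg_inv {x y : X.pt} (a : x ⟶ y) : X.deg (Groupoid.inv a) = (X.deg a)⁻¹ := by
  rw [eq_inv_iff_mul_eq_one, ← X.deg_comp, Groupoid.comp_inv, X.deg_id]

/-- Inverses in the tensor product. -/
def TensorHom.inv {p q : Y.pt × X.pt} (s : TensorHom Y X p q) : TensorHom Y X q p :=
  Quotient.lift
    (fun c => TensorHom.mk (Groupoid.inv c.1.1) (Groupoid.inv c.1.2) (by
      rw [deg_inv, deg_inv, c.2]))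
    (by
      rintro ⟨⟨a, b⟩, h⟩ ⟨⟨a', b'⟩, h'⟩ ⟨ζ, h1, h2⟩
      dsimp only at h1 h2
      refine TensorHom.mk_eq_mk.2 ⟨ζ⁻¹, ?_, ?_⟩
      · dsimp only
        rw [← cancel_epi a', Groupoid.comp_inv, h1, comp_phase_comp, comp_comp_phase,
          comp_phase_phase, Groupoid.comp_inv, inv_mul_cancel, phase_one, Category.comp_id]
      · dsimp only
        rw [← cancel_epi b, Groupoid.comp_inv, h2, comp_phase_comp, comp_comp_phase,
          comp_phase_phase, Groupoid.comp_inv, inv_mul_cancel, phase_one, Category.comp_id]) s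

/-- The underlying groupoid of the tensor product of two gerbes. -/
@[reducible] def tensorGroupoid (Y X : Gerbe.{w, u} G) : Groupoid.{max u w} (Y.pt × X.pt) where
  Hom := TensorHom Y X
  id p := TensorHom.mk (𝟙 p.1) (𝟙 p.2) (by rw [deg_id, deg_id])
  comp s t := s.comp t
  inv s := s.inv
  id_comp := by
    rintro p q ⟨⟨⟨a, b⟩, h⟩⟩
    exact TensorHom.mk_eq_mk.2 ⟨1, by simp [phase_one], by simp [phase_one]⟩
  comp_id := by
    rintro p q ⟨⟨⟨a, b⟩, h⟩⟩
    exact TensorHom.mk_eq_mk.2 ⟨1, by simp [phase_one], by simp [phase_one]⟩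
  assoc := by
    rintro p q r s ⟨⟨⟨a, b⟩, h⟩⟩ ⟨⟨⟨a', b'⟩, h'⟩⟩ ⟨⟨⟨a'', b''⟩, h''⟩⟩
    exact TensorHom.mk_eq_mk.2 ⟨1, by simp [phase_one], by simp [phase_one]⟩
  inv_comp := by
    rintro p q ⟨⟨⟨a, b⟩, h⟩⟩
    exact TensorHom.mk_eq_mk.2 ⟨1, by simp [phase_one], by simp [phase_one]⟩
  comp_inv := by
    rintro p q ⟨⟨⟨a, b⟩, h⟩⟩
    exact TensorHom.mk_eq_mk.2 ⟨1, by simp [phase_one], by simp [phase_one]⟩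

/-- The tensor product `Y ⊗ X` of two gerbes: `G` acts diagonally on the product of the underlying
`G`-sets, the torsors of arrows are the tensor products of those of `Y` and `X`, and the metric is
the product metric. -/
def tensor (Y X : Gerbe.{w, u} G) : Gerbe.{w, u} G where
  pt := Y.pt × X.pt
  groupoid := tensorGroupoid Y X
  deg {p q} s := Quotient.lift (fun c => Y.deg c.1.1) (by
    rintro ⟨⟨a, b⟩, h⟩ ⟨⟨a', b'⟩, h'⟩ ⟨ζ, h1, h2⟩
    dsimp only at h1 h2 ⊢
    rw [h1, Y.deg_comp, Y.deg_phase, one_mul]) s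
  deg_smul := by
    rintro p q ⟨⟨⟨a, b⟩, h⟩⟩
    exact Prod.ext (Y.deg_smul a) ((congrArg (· • p.2) h).trans (X.deg_smul b))
  deg_comp := by
    rintro p q r ⟨⟨⟨a, b⟩, h⟩⟩ ⟨⟨⟨a', b'⟩, h'⟩⟩
    exact Y.deg_comp a a'
  deg_full g p := ⟨TensorHom.mk (q := g • p) (Y.arrow g p.1) (X.arrow g p.2) (by simp),
    Y.deg_arrow g p.1⟩
  phase ζ p := TensorHom.mk (Y.phase ζ p.1) (𝟙 p.2) (by rw [Y.deg_phase, X.deg_id])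
  phase_mul ζ ξ p := TensorHom.mk_eq_mk.2 ⟨1, by simp [phase_one, Y.phase_mul], by
    simp [phase_one]⟩
  phase_injective p ζ ξ h := by
    obtain ⟨η, h1, h2⟩ := TensorHom.mk_eq_mk.1 h
    have h3 : η = 1 := by
      apply X.phase_injective p.2
      dsimp only
      rw [Category.id_comp] at h2
      rw [← h2, phase_one]
    rw [h3, phase_one, Category.comp_id] at h1
    exact (Y.phase_injective p.1 h1).symm
  deg_phase ζ p := Y.deg_phase ζ p.1
  exists_phase := by
    rintro p ⟨⟨⟨a, b⟩, h⟩⟩ h1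
    obtain ⟨ζ, rfl⟩ := Y.exists_phase a h1
    obtain ⟨ξ, rfl⟩ := X.exists_phase b (h.symm.trans h1)
    exact ⟨ζ * ξ, TensorHom.mk_eq_mk.2 ⟨ξ, Y.phase_mul _ _ _, by rw [Category.id_comp]⟩⟩
  phase_comm := by
    rintro ζ p q ⟨⟨⟨a, b⟩, h⟩⟩
    exact TensorHom.mk_eq_mk.2 ⟨1, by simp [phase_one, Y.phase_comm], by simp [phase_one]⟩
  k p := Y.k p.1 * X.k p.2
  k_pos p := mul_pos (Y.k_pos _) (X.k_pos _)
  k_smul g p := by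
    change Y.k (g • p.1) * X.k (g • p.2) = _
    rw [Y.k_smul, X.k_smul]

/-- The arrow `a ⊗ b` of `Y ⊗ X`, where `a` and `b` are arrows of the same degree. -/
def tmul {y y' : Y.pt} {x x' : X.pt} (a : y ⟶ y') (b : x ⟶ x') (h : Y.deg a = X.deg b) :
    (show (Y.tensor X).pt from (y, x)) ⟶ (show (Y.tensor X).pt from (y', x')) :=
  TensorHom.mk (p := (y, x)) (q := (y', x')) a b h

end Gerbe

/-! ## Unitary equivariant vector bundles -/

/-- A unitary equivariant vector bundle over a gerbe `Z`: a functor from `Z` to Hilbert spaces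
which maps arrows to unitary maps and preserves the `U(1)`-action on the arrows. (The maps
`map a` are invertible since `Z` is a groupoid.) -/
structure VectorBundle {G : Type w} [Group G] (Z : Gerbe.{w, u} G) : Type (max (u + 1) w) where
  fib : Z.pt → Hilb.{u}
  map : ∀ {p q : Z.pt}, (p ⟶ q) → (fib p →ₗ[ℂ] fib q)
  map_id : ∀ p : Z.pt, map (𝟙 p) = LinearMap.id
  map_comp : ∀ {p q r : Z.pt} (a : p ⟶ q) (b : q ⟶ r), map (a ≫ b) = map b ∘ₗ map a
  ip_map : ∀ {p q : Z.pt} (a : p ⟶ q) (s t : fib p), Hilb.ip (map a s) (map a t) = Hilb.ip s t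
  map_phase : ∀ (ζ : Circle) {p q : Z.pt} (a : p ⟶ q), map (a ≫ Z.phase ζ q) = (ζ : ℂ) • map a

namespace VectorBundle

variable {G : Type w} [Group G] {Z : Gerbe.{w, u} G}

/-- The space of morphisms of equivariant vector bundles: natural families of linear maps. -/
def homSubmodule (E F : VectorBundle Z) : Submodule ℂ ((p : Z.pt) → E.fib p →ₗ[ℂ] F.fib p) where
  carrier := {f | ∀ {p q : Z.pt} (a : p ⟶ q), f q ∘ₗ E.map a = F.map a ∘ₗ f p}
  add_mem' {f g} hf hg := fun {p q} a => by
    simp only [Pi.add_apply, LinearMap.add_comp, LinearMap.comp_add, hf a, hg a]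
  zero_mem' := fun {p q} a => by simp
  smul_mem' c f hf := fun {p q} a => by
    simp only [Pi.smul_apply, LinearMap.smul_comp, LinearMap.comp_smul, hf a]

/-- A morphism of equivariant vector bundles. -/
def Hom (E F : VectorBundle Z) : Type u := homSubmodule E F

instance (E F : VectorBundle Z) : AddCommGroup (Hom E F) :=
  inferInstanceAs (AddCommGroup (homSubmodule E F))

instance (E F : VectorBundle Z) : Module ℂ (Hom E F) :=
  inferInstanceAs (Module ℂ (homSubmodule E F))

/-- The component of a morphism of vector bundles at a point. -/
def Hom.app {E F : VectorBundle Z} (f : Hom E F) (p : Z.pt) : E.fib p →ₗ[ℂ] F.fib p := f.1 p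

lemma Hom.naturality {E F : VectorBundle Z} (f : Hom E F) {p q : Z.pt} (a : p ⟶ q) :
    f.app q ∘ₗ E.map a = F.map a ∘ₗ f.app p := f.2 a

@[ext] lemma Hom.ext {E F : VectorBundle Z} {f g : Hom E F} (h : ∀ p, f.app p = g.app p) :
    f = g := Subtype.ext (funext h)

instance : Category.{u} (VectorBundle Z) where
  Hom := Hom
  id E := ⟨fun _ => LinearMap.id, fun a => by simp⟩
  comp f g := ⟨fun p => g.app p ∘ₗ f.app p, fun a => by
    rw [LinearMap.comp_assoc, f.naturality, ← LinearMap.comp_assoc, g.naturality,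
      LinearMap.comp_assoc]⟩

instance (E F : VectorBundle Z) : AddCommGroup (E ⟶ F) :=
  inferInstanceAs (AddCommGroup (Hom E F))

instance (E F : VectorBundle Z) : Module ℂ (E ⟶ F) :=
  inferInstanceAs (Module ℂ (Hom E F))

lemma hom_ext {E F : VectorBundle Z} {f g : E ⟶ F} (h : ∀ p, Hom.app f p = Hom.app g p) :
    f = g := Hom.ext h

@[simp] lemma id_app (E : VectorBundle Z) (p : Z.pt) : Hom.app (𝟙 E) p = LinearMap.id := rfl

@[simp] lemma comp_app {E F K : VectorBundle Z} (f : E ⟶ F) (g : F ⟶ K) (p : Z.pt) :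
    Hom.app (f ≫ g) p = Hom.app g p ∘ₗ Hom.app f p := rfl

end VectorBundle

/-! ## The 2-category of finite equivariant gerbes -/

/-- A morphism of gerbes `X ⟶ Y`: a unitary equivariant vector bundle over the tensor product of
`Y` with the conjugate of `X`. -/
abbrev Kernel {G : Type w} [Group G] (X Y : Gerbe.{w, u} G) : Type (max (u + 1) w) :=
  VectorBundle (Y.tensor X.bar)

namespace Kernel

variable {G : Type w} [Group G] {X Y Z W : Gerbe.{w, u} G}

/-- The amplitude space `⟨y | E | x⟩`. -/
abbrev fiber (E : Kernel X Y) (y : Y.pt) (x : X.pt) : Hilb.{u} := E.fib (y, x)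

/-- The unitary map `⟨y | E | x⟩ → ⟨y' | E | x'⟩` attached to an arrow `a` of `Y` and an arrow `b`
of `X` of the same degree. -/
def act (E : Kernel X Y) {y y' : Y.pt} {x x' : X.pt} (a : y ⟶ y') (b : x ⟶ x')
    (h : Y.deg a = X.deg b) : E.fiber y x →ₗ[ℂ] E.fiber y' x' :=
  VectorBundle.map E (Gerbe.tmul (Y := Y) (X := X.bar) a b h)

section act

variable (E : Kernel X Y)

lemma act_id (y : Y.pt) (x : X.pt) (h : Y.deg (𝟙 y) = X.deg (𝟙 x)) :
    E.act (𝟙 y) (𝟙 x) h = LinearMap.id := VectorBundle.map_id E (y, x)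

lemma act_comp {y y' y'' : Y.pt} {x x' x'' : X.pt} (a : y ⟶ y') (b : x ⟶ x')
    (h : Y.deg a = X.deg b) (a' : y' ⟶ y'') (b' : x' ⟶ x'') (h' : Y.deg a' = X.deg b')
    (h'' : Y.deg (a ≫ a') = X.deg (b ≫ b')) :
    E.act (a ≫ a') (b ≫ b') h'' = E.act a' b' h' ∘ₗ E.act a b h :=
  VectorBundle.map_comp E (Gerbe.tmul (Y := Y) (X := X.bar) a b h)
    (Gerbe.tmul (Y := Y) (X := X.bar) a' b' h')

lemma ip_act {y y' : Y.pt} {x x' : X.pt} (a : y ⟶ y') (b : x ⟶ x') (h : Y.deg a = X.deg b)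
    (s t : E.fiber y x) : Hilb.ip (E.act a b h s) (E.act a b h t) = Hilb.ip s t :=
  VectorBundle.ip_map E _ s t

lemma act_comp_phase_left {y y' : Y.pt} {x x' : X.pt} (a : y ⟶ y') (b : x ⟶ x')
    (h : Y.deg a = X.deg b) (ζ : Circle) (h' : Y.deg (a ≫ Y.phase ζ y') = X.deg b) :
    E.act (a ≫ Y.phase ζ y') b h' = (ζ : ℂ) • E.act a b h := by
  have := VectorBundle.map_phase E ζ (Gerbe.tmul (Y := Y) (X := X.bar) a b h)
  rw [act, act, ← this]
  congr 1
  exact Gerbe.TensorHom.mk_eq_mk.2 ⟨1, by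
    rw [Gerbe.phase_one, Category.comp_id], by
    rw [Gerbe.phase_one, Category.comp_id]
    exact (Category.comp_id (obj := X.bar.pt) b).symm⟩

lemma act_comp_phase_right {y y' : Y.pt} {x x' : X.pt} (a : y ⟶ y') (b : x ⟶ x')
    (h : Y.deg a = X.deg b) (ζ : Circle) (h' : Y.deg a = X.deg (b ≫ X.phase ζ x')) :
    E.act a (b ≫ X.phase ζ x') h' = ((ζ⁻¹ : Circle) : ℂ) • E.act a b h := by
  rw [← act_comp_phase_left E a b h ζ⁻¹ (by rw [Y.deg_comp, Y.deg_phase, one_mul, h])]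
  rw [act, act]
  congr 1
  refine Gerbe.TensorHom.mk_eq_mk.2 ⟨ζ⁻¹, rfl, ?_⟩
  change b ≫ X.phase ζ x' = b ≫ X.phase (ζ⁻¹)⁻¹ x'
  rw [inv_inv]

lemma tmul_ind {Y X : Gerbe.{w, u} G} {p q : (Y.tensor X).pt} {C : (p ⟶ q) → Prop}
    (h : ∀ (a : p.1 ⟶ q.1) (b : p.2 ⟶ q.2) (h : Y.deg a = X.deg b), C (Gerbe.tmul a b h))
    (t : p ⟶ q) : C t :=
  Gerbe.TensorHom.ind (p := p) (q := q) h t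

end act

/-- Build a morphism of gerbes from its fibers and the action of pairs of arrows of the same
degree. -/
def ofAct (fiber : Y.pt → X.pt → Hilb.{u})
    (act : ∀ {y y' : Y.pt} {x x' : X.pt} (a : y ⟶ y') (b : x ⟶ x'), Y.deg a = X.deg b →
      (fiber y x →ₗ[ℂ] fiber y' x'))
    (act_id : ∀ (y : Y.pt) (x : X.pt) (h : Y.deg (𝟙 y) = X.deg (𝟙 x)),
      act (𝟙 y) (𝟙 x) h = LinearMap.id)
    (act_comp : ∀ {y y' y'' : Y.pt} {x x' x'' : X.pt} (a : y ⟶ y') (b : x ⟶ x')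
      (h : Y.deg a = X.deg b) (a' : y' ⟶ y'') (b' : x' ⟶ x'') (h' : Y.deg a' = X.deg b')
      (h'' : Y.deg (a ≫ a') = X.deg (b ≫ b')),
      act (a ≫ a') (b ≫ b') h'' = act a' b' h' ∘ₗ act a b h)
    (ip_act : ∀ {y y' : Y.pt} {x x' : X.pt} (a : y ⟶ y') (b : x ⟶ x') (h : Y.deg a = X.deg b)
      (s t : fiber y x), Hilb.ip (act a b h s) (act a b h t) = Hilb.ip s t)
    (act_left : ∀ {y y' : Y.pt} {x x' : X.pt} (a : y ⟶ y') (b : x ⟶ x')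
      (h : Y.deg a = X.deg b) (ζ : Circle) (h' : Y.deg (a ≫ Y.phase ζ y') = X.deg b),
      act (a ≫ Y.phase ζ y') b h' = (ζ : ℂ) • act a b h)
    (act_right : ∀ {y y' : Y.pt} {x x' : X.pt} (a : y ⟶ y') (b : x ⟶ x')
      (h : Y.deg a = X.deg b) (ζ : Circle) (h' : Y.deg a = X.deg (b ≫ X.phase ζ x')),
      act a (b ≫ X.phase ζ x') h' = ((ζ⁻¹ : Circle) : ℂ) • act a b h) : Kernel X Y where
  fib p := fiber p.1 p.2
  map {p q} t := Quotient.lift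
    (fun c : {c : (p.1 ⟶ q.1) × (p.2 ⟶ q.2) // Y.deg c.1 = X.bar.deg c.2} =>
      act (y := p.1) (y' := q.1) (x := p.2) (x' := q.2) c.1.1 c.1.2 c.2)
    (by
      rintro ⟨⟨a, b⟩, h⟩ ⟨⟨a', b'⟩, h'⟩ ⟨ζ, h1, h2⟩
      dsimp only at h1 h2 ⊢
      subst h1
      have h3 : b = b' ≫ X.phase ζ⁻¹ q.2 := h2
      subst h3
      have h4 : Y.deg a = X.deg b' := by
        rw [Y.deg_comp, Y.deg_phase, one_mul] at h'
        exact h'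
      exact ((act_right a b' h4 ζ⁻¹ h).trans (by rw [inv_inv])).trans
        (act_left a b' h4 ζ h').symm) t
  map_id p := act_id p.1 p.2 _
  map_comp {p q r} s t := by
    induction s using tmul_ind with
    | h a b h =>
    induction t using tmul_ind with
    | h a' b' h' => exact act_comp a b h a' b' h' _
  ip_map {p q} s := by
    induction s using tmul_ind with
    | h a b h => exact ip_act a b h
  map_phase ζ {p q} s := by
    induction s using tmul_ind with
    | h a b h =>
    have h' : Y.deg (a ≫ Y.phase ζ q.1) = X.deg b := by
      rw [Y.deg_comp, Y.deg_phase, one_mul]; exact h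
    refine Eq.trans ?_ (act_left a b h ζ h')
    have : ∀ (b'' : p.2 ⟶ q.2) (h'' : Y.deg (a ≫ Y.phase ζ q.1) = X.deg b''), b'' = b →
        act (a ≫ Y.phase ζ q.1) b'' h'' = act (a ≫ Y.phase ζ q.1) b h' := by
      rintro _ _ rfl; rfl
    exact this (b ≫ 𝟙 q.2) _ (Category.comp_id (obj := X.pt) b)

/-- Build a 2-morphism from its components. -/
def homOfAct {E F : Kernel X Y} (f : ∀ y x, E.fiber y x →ₗ[ℂ] F.fiber y x)
    (hf : ∀ {y y' : Y.pt} {x x' : X.pt} (a : y ⟶ y') (b : x ⟶ x') (h : Y.deg a = X.deg b)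
      (s : E.fiber y x), f y' x' (E.act a b h s) = F.act a b h (f y x s)) : E ⟶ F :=
  ⟨fun p => f p.1 p.2, fun {p q} t => by
    induction t using tmul_ind with
    | h a b h => exact LinearMap.ext fun s => hf a b h s⟩

/-- The component `⟨y | E | x⟩ → ⟨y | F | x⟩` of a 2-morphism. -/
def app {E F : Kernel X Y} (f : E ⟶ F) (y : Y.pt) (x : X.pt) : E.fiber y x →ₗ[ℂ] F.fiber y x :=
  VectorBundle.Hom.app f (y, x)

@[simp] lemma homOfAct_app {E F : Kernel X Y} (f : ∀ y x, E.fiber y x →ₗ[ℂ] F.fiber y x) (hf)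
    (y : Y.pt) (x : X.pt) : app (homOfAct (E := E) (F := F) f hf) y x = f y x := rfl

lemma app_act {E F : Kernel X Y} (f : E ⟶ F) {y y' : Y.pt} {x x' : X.pt} (a : y ⟶ y')
    (b : x ⟶ x') (h : Y.deg a = X.deg b) (s : E.fiber y x) :
    app f y' x' (E.act a b h s) = F.act a b h (app f y x s) :=
  LinearMap.congr_fun (VectorBundle.Hom.naturality f (Gerbe.tmul (Y := Y) (X := X.bar) a b h)) s

lemma hom_ext {E F : Kernel X Y} {f g : E ⟶ F} (h : ∀ y x, app f y x = app g y x) : f = g :=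
  VectorBundle.hom_ext fun p => h p.1 p.2

@[simp] lemma id_app (E : Kernel X Y) (y : Y.pt) (x : X.pt) : app (𝟙 E) y x = LinearMap.id := rfl

@[simp] lemma comp_app {E F K : Kernel X Y} (f : E ⟶ F) (g : F ⟶ K) (y : Y.pt) (x : X.pt) :
    app (f ≫ g) y x = app g y x ∘ₗ app f y x := rfl

@[simp] lemma comp_app_apply {E F K : Kernel X Y} (f : E ⟶ F) (g : F ⟶ K) (y : Y.pt) (x : X.pt)
    (s : E.fiber y x) : app (f ≫ g) y x s = app g y x (app f y x s) := rfl

/-! ### Composition -/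

/-- The fiber `⊕_y (1 / k y) ⟨z | F | y⟩ ⊗ ⟨y | E | x⟩` of the composite of `E` and `F`. -/
abbrev compFiber (E : Kernel X Y) (F : Kernel Y Z) (z : Z.pt) (x : X.pt) : Hilb.{u} :=
  conv Y.k Y.k_pos (fun y => F.fiber z y) (fun y => E.fiber y x)

/-- The equivariant structure of the composite. On the summand at `y` it is
`F (c ⊗ b) ⊗ E (b ⊗ a)`, where `b` is any arrow out of `y` of the same degree as `a` and `c`. -/
def compAct (E : Kernel X Y) (F : Kernel Y Z) {z z' : Z.pt} {x x' : X.pt} (c : z ⟶ z')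
    (a : x ⟶ x') (h : Z.deg c = X.deg a) : compFiber E F z x →ₗ[ℂ] compFiber E F z' x' :=
  conv.lift fun y =>
    (conv.mk (X.deg a • y)).compl₁₂
      (F.act c (Y.arrow (X.deg a) y) (by rw [Gerbe.deg_arrow, h]))
      (E.act (Y.arrow (X.deg a) y) a (by rw [Gerbe.deg_arrow]))

lemma compAct_mk (E : Kernel X Y) (F : Kernel Y Z) {z z' : Z.pt} {x x' : X.pt} (c : z ⟶ z')
    (a : x ⟶ x') (h : Z.deg c = X.deg a) {y y' : Y.pt} (b : y ⟶ y') (h1 : Z.deg c = Y.deg b)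
    (h2 : Y.deg b = X.deg a) (f : F.fiber z y) (e : E.fiber y x) :
    compAct E F c a h (conv.mk y f e) = conv.mk y' (F.act c b h1 f) (E.act b a h2 e) := by
  obtain rfl : X.deg a • y = y' := by rw [← h2, Y.deg_smul]
  obtain ⟨ζ, rfl⟩ := Gerbe.exists_eq_comp_phase (Y.arrow (X.deg a) y) b (by simp [h2])
  rw [compAct, conv.lift_mk, LinearMap.compl₁₂_apply]
  rw [act_comp_phase_right F c (Y.arrow (X.deg a) y) (by simp [h]),
    act_comp_phase_left E (Y.arrow (X.deg a) y) a (by simp)]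
  simp only [LinearMap.smul_apply, map_smul, smul_smul]
  rw [← Circle.coe_mul, mul_inv_cancel, Circle.coe_one, one_smul]

/-- The composite of `E : X ⟶ Y` and `F : Y ⟶ Z`. -/
def comp (E : Kernel X Y) (F : Kernel Y Z) : Kernel X Z :=
  ofAct (compFiber E F) (compAct E F)
    (fun z x h => by
      refine conv.hom_ext fun y f e => ?_
      rw [compAct_mk E F _ _ h (𝟙 y) (by simp [Gerbe.deg_id]) (by simp [Gerbe.deg_id]), act_id,
        act_id]
      rfl)
    (fun c a h c' a' h' h'' => by
      refine conv.hom_ext fun y f e => ?_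
      have hy := Y.deg_arrow (X.deg a) y
      have hy' := Y.deg_arrow (X.deg a') (X.deg a • y)
      rw [compAct_mk E F _ _ h'' (Y.arrow (X.deg a) y ≫ Y.arrow (X.deg a') (X.deg a • y))
        (by rw [h'', Y.deg_comp, X.deg_comp, hy, hy'])
        (by rw [Y.deg_comp, X.deg_comp, hy, hy']),
        LinearMap.comp_apply,
        compAct_mk E F _ _ h (Y.arrow (X.deg a) y) (by rw [h, hy]) hy,
        compAct_mk E F _ _ h' (Y.arrow (X.deg a') (X.deg a • y)) (by rw [h', hy']) hy',
        act_comp F c _ (by rw [h, hy]) c' _ (by rw [h', hy']),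
        act_comp E _ a hy _ a' hy']
      rfl)
    (fun {z z' x x'} c a h s t => by
      induction s using conv.induction with
      | h0 => simp only [map_zero, Hilb.ip_zero_left]
      | hadd s s' hs hs' => simp only [map_add, Hilb.ip_add_left, hs, hs']
      | hmk y f e =>
      induction t using conv.induction with
      | h0 => simp only [map_zero, Hilb.ip_zero_right]
      | hadd s s' hs hs' => simp only [map_add, Hilb.ip_add_right, hs, hs']
      | hmk y' f' e' =>
      have hy := Y.deg_arrow (X.deg a) y
      have hy' := Y.deg_arrow (X.deg a) y'
      rw [compAct_mk E F _ _ h (Y.arrow (X.deg a) y) (by rw [h, hy]) hy,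
        compAct_mk E F _ _ h (Y.arrow (X.deg a) y') (by rw [h, hy']) hy']
      by_cases hyy : y = y'
      · subst hyy
        rw [conv.ip_mk, conv.ip_mk, ip_act, ip_act, Y.k_smul]
      · rw [conv.ip_mk_ne hyy, conv.ip_mk_ne (by simpa using hyy)])
    (fun {z z' x x'} c a h ζ h' => by
      refine conv.hom_ext fun y f e => ?_
      have hy := Y.deg_arrow (X.deg a) y
      rw [compAct_mk E F _ _ h' (Y.arrow (X.deg a) y) (by rw [h', hy]) hy, LinearMap.smul_apply,
        compAct_mk E F _ _ h (Y.arrow (X.deg a) y) (by rw [h, hy]) hy,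
        act_comp_phase_left F c _ (by rw [h, hy]), LinearMap.smul_apply, map_smul,
        LinearMap.smul_apply])
    (fun {z z' x x'} c a h ζ h' => by
      refine conv.hom_ext fun y f e => ?_
      have hy := Y.deg_arrow (X.deg a) y
      rw [compAct_mk E F _ _ h' (Y.arrow (X.deg a) y) (by rw [h, hy])
          (by rw [X.deg_comp, X.deg_phase, one_mul, hy]), LinearMap.smul_apply,
        compAct_mk E F _ _ h (Y.arrow (X.deg a) y) (by rw [h, hy]) hy,
        act_comp_phase_right E _ a hy, LinearMap.smul_apply, map_smul])

/-- The element `f ⊗ e` of the summand at `y` of a fiber of the composite. -/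
def cmk {E : Kernel X Y} {F : Kernel Y Z} {z : Z.pt} {x : X.pt} (y : Y.pt) :
    F.fiber z y →ₗ[ℂ] E.fiber y x →ₗ[ℂ] (comp E F).fiber z x :=
  conv.mk (k := Y.k) (hk := Y.k_pos) (V := fun y => F.fiber z y) (W := fun y => E.fiber y x) y

/-- Linear maps out of a fiber of the composite are families of bilinear maps. -/
def compLift {E : Kernel X Y} {F : Kernel Y Z} {z : Z.pt} {x : X.pt} {M : Type u₁}
    [AddCommGroup M] [Module ℂ M] (B : ∀ y, F.fiber z y →ₗ[ℂ] E.fiber y x →ₗ[ℂ] M) :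
    (comp E F).fiber z x →ₗ[ℂ] M :=
  conv.lift (k := Y.k) (hk := Y.k_pos) (V := fun y => F.fiber z y) (W := fun y => E.fiber y x) B

@[simp] lemma compLift_cmk {E : Kernel X Y} {F : Kernel Y Z} {z : Z.pt} {x : X.pt} {M : Type u₁}
    [AddCommGroup M] [Module ℂ M] (B : ∀ y, F.fiber z y →ₗ[ℂ] E.fiber y x →ₗ[ℂ] M) (y : Y.pt)
    (f : F.fiber z y) (e : E.fiber y x) : compLift B (cmk y f e) = B y f e :=
  conv.lift_mk B y f e

lemma act_cmk (E : Kernel X Y) (F : Kernel Y Z) {z z' : Z.pt} {x x' : X.pt} (c : z ⟶ z')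
    (a : x ⟶ x') (h : Z.deg c = X.deg a) {y y' : Y.pt} (b : y ⟶ y') (h1 : Z.deg c = Y.deg b)
    (h2 : Y.deg b = X.deg a) (f : F.fiber z y) (e : E.fiber y x) :
    (comp E F).act c a h (cmk y f e) = cmk y' (F.act c b h1 f) (E.act b a h2 e) :=
  compAct_mk E F c a h b h1 h2 f e

/-- Maps out of the fibers of a composite are determined by their values on the elements
`f ⊗ e`. -/
lemma comp_hom_ext {E : Kernel X Y} {F : Kernel Y Z} {z : Z.pt} {x : X.pt} {M : Type u₁}
    [AddCommGroup M] [Module ℂ M] {φ ψ : (comp E F).fiber z x →ₗ[ℂ] M}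
    (h : ∀ y f e, φ (cmk y f e) = ψ (cmk y f e)) : φ = ψ := conv.hom_ext h

/-! ### Whiskering -/

/-- The horizontal composite of the identity of `E` with a 2-morphism. -/
def whiskerLeft (E : Kernel X Y) {F F' : Kernel Y Z} (η : F ⟶ F') : comp E F ⟶ comp E F' :=
  homOfAct (fun z x => compLift fun y => (cmk y).compl₁₂ (app η z y) LinearMap.id)
    (fun {z z' x x'} c a h s => by
      revert s
      refine LinearMap.congr_fun (f := _ ∘ₗ _) (g := _ ∘ₗ _) (comp_hom_ext fun y f e => ?_)
      have hy := Y.deg_arrow (X.deg a) y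
      simp only [LinearMap.comp_apply]
      rw [act_cmk E F c a h (Y.arrow (X.deg a) y) (by rw [h, hy]) hy]
      simp only [compLift_cmk, LinearMap.compl₁₂_apply, LinearMap.id_apply]
      rw [act_cmk E F' c a h (Y.arrow (X.deg a) y) (by rw [h, hy]) hy, app_act])

@[simp] lemma whiskerLeft_app_cmk (E : Kernel X Y) {F F' : Kernel Y Z} (η : F ⟶ F') {z : Z.pt}
    {x : X.pt} (y : Y.pt) (f : F.fiber z y) (e : E.fiber y x) :
    app (whiskerLeft E η) z x (cmk y f e) = cmk y (app η z y f) e := by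
  simp only [whiskerLeft, homOfAct_app, compLift_cmk, LinearMap.compl₁₂_apply,
    LinearMap.id_apply]

/-- The horizontal composite of a 2-morphism with the identity of `F`. -/
def whiskerRight {E E' : Kernel X Y} (η : E ⟶ E') (F : Kernel Y Z) : comp E F ⟶ comp E' F :=
  homOfAct (fun z x => compLift fun y => (cmk y).compl₁₂ LinearMap.id (app η y x))
    (fun {z z' x x'} c a h s => by
      revert s
      refine LinearMap.congr_fun (f := _ ∘ₗ _) (g := _ ∘ₗ _) (comp_hom_ext fun y f e => ?_)
      have hy := Y.deg_arrow (X.deg a) y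
      simp only [LinearMap.comp_apply]
      rw [act_cmk E F c a h (Y.arrow (X.deg a) y) (by rw [h, hy]) hy]
      simp only [compLift_cmk, LinearMap.compl₁₂_apply, LinearMap.id_apply]
      rw [act_cmk E' F c a h (Y.arrow (X.deg a) y) (by rw [h, hy]) hy, app_act])

@[simp] lemma whiskerRight_app_cmk {E E' : Kernel X Y} (η : E ⟶ E') (F : Kernel Y Z) {z : Z.pt}
    {x : X.pt} (y : Y.pt) (f : F.fiber z y) (e : E.fiber y x) :
    app (whiskerRight η F) z x (cmk y f e) = cmk y f (app η y x e) := by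
  simp only [whiskerRight, homOfAct_app, compLift_cmk, LinearMap.compl₁₂_apply,
    LinearMap.id_apply]

/-! ### Associators -/

section assoc

variable (E : Kernel X Y) (F : Kernel Y Z) (K : Kernel Z W)

/-- The canonical map `⟨w | K | z⟩ ⊗ (⟨z | F | y⟩ ⊗ ⟨y | E | x⟩) →
(⟨w | K | z⟩ ⊗ ⟨z | F | y⟩) ⊗ ⟨y | E | x⟩`. -/
def assocApp (w : W.pt) (x : X.pt) :
    (comp (comp E F) K).fiber w x →ₗ[ℂ] (comp E (comp F K)).fiber w x :=
  compLift fun z =>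
    { toFun := fun κ => compLift fun y => (cmk y) ∘ₗ (cmk z κ)
      map_add' := fun κ κ' => comp_hom_ext fun y f e => by
        simp only [compLift_cmk, LinearMap.add_apply, LinearMap.comp_apply, map_add]
      map_smul' := fun c κ => comp_hom_ext fun y f e => by
        simp only [compLift_cmk, LinearMap.smul_apply, LinearMap.comp_apply, map_smul,
          RingHom.id_apply] }

@[simp] lemma assocApp_cmk {w : W.pt} {x : X.pt} (z : Z.pt) (y : Y.pt) (κ : K.fiber w z)
    (f : F.fiber z y) (e : E.fiber y x) :
    assocApp E F K w x (cmk z κ (cmk y f e)) = cmk y (cmk z κ f) e := by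
  simp only [assocApp, compLift_cmk, LinearMap.coe_mk, AddHom.coe_mk, LinearMap.comp_apply]

/-- The inverse of `assocApp`. -/
def assocInvApp (w : W.pt) (x : X.pt) :
    (comp E (comp F K)).fiber w x →ₗ[ℂ] (comp (comp E F) K).fiber w x :=
  compLift fun y => compLift fun z =>
    LinearMap.mk₂ ℂ (fun κ f => (cmk z κ) ∘ₗ (cmk y f))
      (fun _ _ _ => LinearMap.ext fun _ => by
        simp only [map_add, LinearMap.comp_apply, LinearMap.add_apply])
      (fun _ _ _ => LinearMap.ext fun _ => by
        simp only [map_smul, LinearMap.comp_apply, LinearMap.smul_apply])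
      (fun _ _ _ => LinearMap.ext fun _ => by
        simp only [map_add, LinearMap.comp_apply, LinearMap.add_apply])
      (fun _ _ _ => LinearMap.ext fun _ => by
        simp only [map_smul, LinearMap.comp_apply, LinearMap.smul_apply])

@[simp] lemma assocInvApp_cmk {w : W.pt} {x : X.pt} (z : Z.pt) (y : Y.pt) (κ : K.fiber w z)
    (f : F.fiber z y) (e : E.fiber y x) :
    assocInvApp E F K w x (cmk y (cmk z κ f) e) = cmk z κ (cmk y f e) := by
  simp only [assocInvApp, compLift_cmk, LinearMap.mk₂_apply, LinearMap.comp_apply]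

variable {E F K}

lemma assoc_hom_ext {w : W.pt} {x : X.pt} {M : Type u₁} [AddCommGroup M] [Module ℂ M]
    {φ ψ : (comp (comp E F) K).fiber w x →ₗ[ℂ] M}
    (h : ∀ z y κ f e, φ (cmk z κ (cmk y f e)) = ψ (cmk z κ (cmk y f e))) : φ = ψ := by
  refine comp_hom_ext fun z κ => ?_
  exact LinearMap.congr_fun (f := φ ∘ₗ cmk z κ) (g := ψ ∘ₗ cmk z κ)
    (comp_hom_ext fun y f e => h z y κ f e)

lemma assoc_hom_ext' {w : W.pt} {x : X.pt} {M : Type u₁} [AddCommGroup M] [Module ℂ M]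
    {φ ψ : (comp E (comp F K)).fiber w x →ₗ[ℂ] M}
    (h : ∀ z y κ f e, φ (cmk y (cmk z κ f) e) = ψ (cmk y (cmk z κ f) e)) : φ = ψ := by
  refine comp_hom_ext fun y s e => ?_
  exact LinearMap.congr_fun (f := φ ∘ₗ (cmk y).flip e) (g := ψ ∘ₗ (cmk y).flip e)
    (comp_hom_ext fun z κ f => h z y κ f e) s

variable (E F K)

/-- The associator, given fiberwise by the associator of the tensor product of vector spaces. -/
def associator : comp (comp E F) K ≅ comp E (comp F K) where
  hom := homOfAct (assocApp E F K) (fun {w w' x x'} d a h s => by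
    revert s
    refine LinearMap.congr_fun (f := _ ∘ₗ _) (g := _ ∘ₗ _)
      (assoc_hom_ext fun z y κ f e => ?_)
    have hy := Y.deg_arrow (X.deg a) y
    have hz := Z.deg_arrow (X.deg a) z
    simp only [LinearMap.comp_apply, assocApp_cmk]
    rw [act_cmk (comp E F) K d a h (Z.arrow (X.deg a) z) (by rw [h, hz]) hz,
      act_cmk E F (Z.arrow (X.deg a) z) a hz (Y.arrow (X.deg a) y) (by rw [hy, hz]) hy,
      assocApp_cmk,
      act_cmk E (comp F K) d a h (Y.arrow (X.deg a) y) (by rw [h, hy]) hy,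
      act_cmk F K d (Y.arrow (X.deg a) y) (by rw [h, hy]) (Z.arrow (X.deg a) z) (by rw [h, hz])
        (by rw [hy, hz])])
  inv := homOfAct (assocInvApp E F K) (fun {w w' x x'} d a h s => by
    revert s
    refine LinearMap.congr_fun (f := _ ∘ₗ _) (g := _ ∘ₗ _)
      (assoc_hom_ext' fun z y κ f e => ?_)
    have hy := Y.deg_arrow (X.deg a) y
    have hz := Z.deg_arrow (X.deg a) z
    simp only [LinearMap.comp_apply, assocInvApp_cmk]
    rw [act_cmk (comp E F) K d a h (Z.arrow (X.deg a) z) (by rw [h, hz]) hz,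
      act_cmk E F (Z.arrow (X.deg a) z) a hz (Y.arrow (X.deg a) y) (by rw [hy, hz]) hy,
      act_cmk E (comp F K) d a h (Y.arrow (X.deg a) y) (by rw [h, hy]) hy,
      act_cmk F K d (Y.arrow (X.deg a) y) (by rw [h, hy]) (Z.arrow (X.deg a) z) (by rw [h, hz])
        (by rw [hy, hz]),
      assocInvApp_cmk])
  hom_inv_id := hom_ext fun w x => assoc_hom_ext fun z y κ f e => by
    simp only [comp_app_apply, homOfAct_app, assocApp_cmk, assocInvApp_cmk, id_app,
      LinearMap.id_apply]
  inv_hom_id := hom_ext fun w x => assoc_hom_ext' fun z y κ f e => by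
    simp only [comp_app_apply, homOfAct_app, assocApp_cmk, assocInvApp_cmk, id_app,
      LinearMap.id_apply]

@[simp] lemma associator_hom_app_cmk {w : W.pt} {x : X.pt} (z : Z.pt) (y : Y.pt) (κ : K.fiber w z)
    (f : F.fiber z y) (e : E.fiber y x) :
    app (associator E F K).hom w x (cmk z κ (cmk y f e)) = cmk y (cmk z κ f) e :=
  assocApp_cmk E F K z y κ f e

@[simp] lemma associator_inv_app_cmk {w : W.pt} {x : X.pt} (z : Z.pt) (y : Y.pt) (κ : K.fiber w z)
    (f : F.fiber z y) (e : E.fiber y x) :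
    app (associator E F K).inv w x (cmk y (cmk z κ f) e) = cmk z κ (cmk y f e) :=
  assocInvApp_cmk E F K z y κ f e

end assoc

/-! ### Identities and unitors -/

section unit

variable (X)

/-- The fiber `⟨y | id | x⟩ = δ_{y,x} k_x ℂ` of the identity: the line `ℂ` with inner product
`(c, d) = k_x conj(c) d` if `y = x`, and zero otherwise. -/
def idFiber (y x : X.pt) : Hilb.{u} where
  carrier := ({ carrier := {c | y ≠ x → c = 0}
                add_mem' := fun {c d} hc hd h => by rw [hc h, hd h, add_zero]
                zero_mem' := fun _ => rfl
                smul_mem' := fun r c hc h => by rw [hc h, smul_zero] } :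
    Submodule ℂ (ULift.{u} ℂ))
  core :=
    { inner := fun c d => (X.k x : ℂ) * (conj c.1.down * d.1.down)
      conj_inner_symm := fun c d => by
        simp only [map_mul, Complex.conj_ofReal, Complex.conj_conj]
        ring
      re_inner_nonneg := fun c => by
        rw [mul_comm (conj _), Complex.mul_conj, ← Complex.ofReal_mul]
        exact mul_nonneg (X.k_pos x).le (Complex.normSq_nonneg _)
      add_left := fun c d e => by
        change _ * (conj (c.1.down + d.1.down) * _) = _
        rw [map_add]
        ring
      smul_left := fun c d r => by
        change _ * (conj (r * c.1.down) * _) = _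
        rw [map_mul]
        ring
      definite := fun c hc => by
        rw [mul_comm (conj _), Complex.mul_conj, ← Complex.ofReal_mul, Complex.ofReal_eq_zero,
          mul_eq_zero] at hc
        have h := Complex.normSq_eq_zero.1 (hc.resolve_left (X.k_pos x).ne')
        exact Subtype.ext (ULift.ext _ _ h) }

/-- The scalar underlying an element of a fiber of the identity. -/
def idFiber.val {y x : X.pt} : idFiber X y x →ₗ[ℂ] ℂ :=
  (ULift.moduleEquiv (R := ℂ) (M := ℂ)).toLinearMap ∘ₗ (Submodule.subtype _)

/-- The basis vector of `⟨x | id | x⟩`. -/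
def idFiber.one (x : X.pt) : idFiber X x x := ⟨⟨1⟩, fun h => absurd rfl h⟩

@[simp] lemma idFiber.val_one (x : X.pt) : idFiber.val X (idFiber.one X x) = 1 := rfl

variable {X}

lemma idFiber.ext {y x : X.pt} {s t : idFiber X y x}
    (h : idFiber.val X s = idFiber.val X t) : s = t := Subtype.ext (ULift.ext _ _ h)

lemma idFiber.eq_zero {y x : X.pt} (h : y ≠ x) (s : idFiber X y x) : s = 0 :=
  Subtype.ext (s.2 h)

lemma idFiber.eq_smul_one {x : X.pt} (s : idFiber X x x) :
    s = idFiber.val X s • idFiber.one X x := by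
  apply idFiber.ext
  rw [map_smul, idFiber.val_one, smul_eq_mul, mul_one]

open Classical in
/-- If `b` and `a` are parallel arrows with `b = ζ a`, this is `ζ`. -/
def relPhase {y y' x x' : X.pt} (b : y ⟶ y') (a : x ⟶ x') : ℂ :=
  if h : ∃ ζ : Circle, ∃ (h : x = y) (h' : x' = y'),
      b = eqToHom h.symm ≫ (a ≫ X.phase ζ x') ≫ eqToHom h' then ((h.choose : Circle) : ℂ) else 0

@[simp] lemma relPhase_phase {x x' : X.pt} (a : x ⟶ x') (ζ : Circle) :
    relPhase (a ≫ X.phase ζ x') a = ζ := by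
  have h : ∃ ζ' : Circle, ∃ (h : x = x) (h' : x' = x'),
      (a ≫ X.phase ζ x') = eqToHom h.symm ≫ (a ≫ X.phase ζ' x') ≫ eqToHom h' :=
    ⟨ζ, rfl, rfl, by simp⟩
  rw [relPhase, dif_pos h]
  have key : ∀ ξ : Circle, (∃ (h : x = x) (h' : x' = x'),
      (a ≫ X.phase ζ x') = eqToHom h.symm ≫ (a ≫ X.phase ξ x') ≫ eqToHom h') → ξ = ζ := by
    rintro ξ ⟨h1, h2, h3⟩
    simp only [eqToHom_refl, Category.id_comp, Category.comp_id] at h3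
    exact (Gerbe.comp_phase_injective a h3).symm
  rw [key h.choose h.choose_spec]

@[simp] lemma relPhase_self {x x' : X.pt} (a : x ⟶ x') : relPhase a a = 1 := by
  have := relPhase_phase a 1
  rwa [Gerbe.phase_one, Category.comp_id, Circle.coe_one] at this

/-- The equivariant structure of the identity: `(ζ a) ⊗ a` acts as multiplication by `ζ`. -/
def idAct {y y' x x' : X.pt} (b : y ⟶ y') (a : x ⟶ x') (h : X.deg b = X.deg a) :
    idFiber X y x →ₗ[ℂ] idFiber X y' x' where
  toFun s := ⟨relPhase b a • s.1, fun hne => by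
    have : y ≠ x := by
      rintro rfl
      exact hne ((X.deg_smul b).symm.trans ((congrArg (· • y) h).trans (X.deg_smul a)))
    rw [s.2 this, smul_zero]⟩
  map_add' s t := Subtype.ext (smul_add _ _ _)
  map_smul' c s := Subtype.ext (smul_comm _ _ _)

lemma val_idAct {y y' x x' : X.pt} (b : y ⟶ y') (a : x ⟶ x') (h : X.deg b = X.deg a)
    (s : idFiber X y x) : idFiber.val X (idAct b a h s) = relPhase b a * idFiber.val X s := rfl

/-- To check an identity of maps out of a fiber of the identity, it suffices to check it on the
basis vectors. -/
lemma idFiber_hom_ext {y x : X.pt} {M : Type u₁} [AddCommGroup M] [Module ℂ M]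
    {φ ψ : idFiber X y x →ₗ[ℂ] M}
    (h : ∀ h : y = x, φ (h ▸ idFiber.one X y) = ψ (h ▸ idFiber.one X y)) : φ = ψ := by
  ext s
  by_cases hyx : y = x
  · subst hyx
    rw [idFiber.eq_smul_one s, map_smul, map_smul, h rfl]
  · rw [idFiber.eq_zero hyx s, map_zero, map_zero]

lemma eq_of_deg_eq {y y' x' : X.pt} (b : y ⟶ y') (a : y ⟶ x') (h : X.deg b = X.deg a) :
    y' = x' := by
  rw [← X.deg_smul b, h, X.deg_smul]

variable (X) in
/-- The identity morphism of a gerbe. -/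
def idKernel : Kernel X X :=
  ofAct (idFiber X) idAct
    (fun y x h => by
      ext s
      apply idFiber.ext
      rw [val_idAct]
      by_cases hyx : y = x
      · subst hyx
        rw [relPhase_self, one_mul, LinearMap.id_apply]
      · rw [idFiber.eq_zero hyx s, map_zero, mul_zero, map_zero, map_zero])
    (fun {y y' y'' x x' x''} b a h b' a' h' h'' => by
      refine LinearMap.ext fun s => idFiber.ext ?_
      rw [LinearMap.comp_apply, val_idAct, val_idAct, val_idAct]
      by_cases hyx : y = x
      · subst hyx
        obtain rfl := eq_of_deg_eq b a h
        obtain rfl := eq_of_deg_eq b' a' h'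
        obtain ⟨ζ, rfl⟩ := Gerbe.exists_eq_comp_phase a b h.symm
        obtain ⟨ξ, rfl⟩ := Gerbe.exists_eq_comp_phase a' b' h'.symm
        rw [Gerbe.comp_phase_comp, Gerbe.comp_comp_phase, Gerbe.comp_phase_phase, relPhase_phase,
          relPhase_phase, relPhase_phase, Circle.coe_mul]
        ring
      · rw [idFiber.eq_zero hyx s, map_zero, mul_zero, mul_zero, mul_zero])
    (fun {y y' x x'} b a h s t => by
      by_cases hyx : y = x
      · subst hyx
        obtain rfl := eq_of_deg_eq b a h
        obtain ⟨ζ, rfl⟩ := Gerbe.exists_eq_comp_phase a b h.symm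
        change (X.k _ : ℂ) * (conj (idFiber.val X (idAct _ a h s)) *
          idFiber.val X (idAct _ a h t)) =
          (X.k _ : ℂ) * (conj (idFiber.val X s) * idFiber.val X t)
        rw [val_idAct, val_idAct, relPhase_phase, map_mul, ← X.deg_smul a, X.k_smul]
        have : conj (ζ : ℂ) * (ζ : ℂ) = 1 := by
          rw [mul_comm, Complex.mul_conj, Circle.normSq_coe, Complex.ofReal_one]
        linear_combination ((X.k y : ℂ) * conj (idFiber.val X s) * idFiber.val X t) * this
      · rw [idFiber.eq_zero hyx s, map_zero, Hilb.ip_zero_left, Hilb.ip_zero_left])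
    (fun {y y' x x'} b a h ζ h' => by
      refine LinearMap.ext fun s => idFiber.ext ?_
      rw [LinearMap.smul_apply, map_smul, val_idAct, val_idAct]
      by_cases hyx : y = x
      · subst hyx
        obtain rfl := eq_of_deg_eq b a h
        obtain ⟨ξ, rfl⟩ := Gerbe.exists_eq_comp_phase a b h.symm
        rw [Gerbe.comp_phase_phase, relPhase_phase, relPhase_phase, Circle.coe_mul, smul_eq_mul]
        ring
      · rw [idFiber.eq_zero hyx s, map_zero, mul_zero, mul_zero, smul_zero])
    (fun {y y' x x'} b a h ζ h' => by
      refine LinearMap.ext fun s => idFiber.ext ?_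
      rw [LinearMap.smul_apply, map_smul, val_idAct, val_idAct]
      by_cases hyx : y = x
      · subst hyx
        obtain rfl := eq_of_deg_eq b a h
        obtain ⟨ξ, rfl⟩ := Gerbe.exists_eq_comp_phase a b h.symm
        have h1 : a ≫ X.phase ξ y' = (a ≫ X.phase ζ y') ≫ X.phase (ζ⁻¹ * ξ) y' := by
          rw [Gerbe.comp_phase_phase, mul_inv_cancel_left]
        rw [relPhase_phase]
        rw [h1, relPhase_phase, Circle.coe_mul, smul_eq_mul]
        ring
      · rw [idFiber.eq_zero hyx s, map_zero, mul_zero, mul_zero, smul_zero])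

/-- The basis vector of `⟨x | id | x⟩`. -/
def idOne (x : X.pt) : (idKernel X).fiber x x := idFiber.one X x

@[simp] lemma act_idOne {x x' : X.pt} (a : x ⟶ x') (h : X.deg a = X.deg a) :
    (idKernel X).act a a h (idOne x) = idOne x' := by
  apply idFiber.ext
  refine (val_idAct a a h _).trans ?_
  rw [relPhase_self, one_mul]
  rfl

lemma left_hom_ext {E : Kernel X Y} {y : Y.pt} {x : X.pt} {M : Type u₁} [AddCommGroup M]
    [Module ℂ M] {φ ψ : (comp (idKernel X) E).fiber y x →ₗ[ℂ] M}
    (h : ∀ e : E.fiber y x, φ (cmk x e (idOne x)) = ψ (cmk x e (idOne x))) : φ = ψ := by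
  refine comp_hom_ext fun x' e s => ?_
  by_cases hx : x' = x
  · subst hx
    have hs : s = idFiber.val X s • idOne x' := idFiber.eq_smul_one s
    rw [hs, map_smul, map_smul, map_smul, h]
  · have hs : s = 0 := idFiber.eq_zero hx s
    rw [hs, map_zero, map_zero, map_zero]

lemma right_hom_ext {E : Kernel X Y} {y : Y.pt} {x : X.pt} {M : Type u₁} [AddCommGroup M]
    [Module ℂ M] {φ ψ : (comp E (idKernel Y)).fiber y x →ₗ[ℂ] M}
    (h : ∀ e : E.fiber y x, φ (cmk y (idOne y) e) = ψ (cmk y (idOne y) e)) : φ = ψ := by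
  refine comp_hom_ext fun y' s e => ?_
  by_cases hy : y = y'
  · subst hy
    have hs : s = idFiber.val Y s • idOne y := idFiber.eq_smul_one s
    rw [hs, map_smul, LinearMap.smul_apply, map_smul, map_smul, h]
  · have hs : s = 0 := idFiber.eq_zero hy s
    rw [hs, map_zero, LinearMap.zero_apply, map_zero, map_zero]

/-- The map `⟨y | E | x⟩ ⊗ ⟨x | id | x⟩ → ⟨y | E | x⟩`, `v ⊗ 1 ↦ v`. -/
def leftApp (E : Kernel X Y) (y : Y.pt) (x : X.pt) :
    (comp (idKernel X) E).fiber y x →ₗ[ℂ] E.fiber y x :=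
  TensorProduct.lift (LinearMap.mk₂ ℂ (fun (e : E.fiber y x) (s : idFiber X x x) =>
      idFiber.val X s • e) (fun _ _ _ => smul_add _ _ _) (fun _ _ _ => smul_comm _ _ _)
      (fun _ _ _ => by rw [map_add, add_smul])
      (fun _ _ _ => by rw [map_smul, smul_eq_mul, mul_smul])) ∘ₗ
    (LinearMap.proj x : ((x' : X.pt) → E.fiber y x' ⊗[ℂ] idFiber X x' x) →ₗ[ℂ]
      E.fiber y x ⊗[ℂ] idFiber X x x)

@[simp] lemma leftApp_cmk (E : Kernel X Y) (y : Y.pt) (x : X.pt) (e : E.fiber y x) :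
    leftApp E y x (cmk x e (idOne x)) = e := by
  classical
  have : leftApp E y x (cmk x e (idOne x)) = TensorProduct.lift (LinearMap.mk₂ ℂ
      (fun (e : E.fiber y x) (s : idFiber X x x) =>
      idFiber.val X s • e) (fun _ _ _ => smul_add _ _ _) (fun _ _ _ => smul_comm _ _ _)
      (fun _ _ _ => by rw [map_add, add_smul])
      (fun _ _ _ => by rw [map_smul, smul_eq_mul, mul_smul]))
      ((Pi.single x (e ⊗ₜ[ℂ] idFiber.one X x) :
        (x' : X.pt) → E.fiber y x' ⊗[ℂ] idFiber X x' x) x) := by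
    rfl
  rw [this, Pi.single_eq_same, TensorProduct.lift.tmul, LinearMap.mk₂_apply, idFiber.val_one,
    one_smul]

/-- The map `⟨y | id | y⟩ ⊗ ⟨y | E | x⟩ → ⟨y | E | x⟩`, `1 ⊗ v ↦ v`. -/
def rightApp (E : Kernel X Y) (y : Y.pt) (x : X.pt) :
    (comp E (idKernel Y)).fiber y x →ₗ[ℂ] E.fiber y x :=
  TensorProduct.lift (LinearMap.mk₂ ℂ (fun (s : idFiber Y y y) (e : E.fiber y x) =>
      idFiber.val Y s • e) (fun _ _ _ => by rw [map_add, add_smul])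
      (fun _ _ _ => by rw [map_smul, smul_eq_mul, mul_smul])
      (fun _ _ _ => smul_add _ _ _) (fun _ _ _ => smul_comm _ _ _)) ∘ₗ
    (LinearMap.proj y : ((y' : Y.pt) → idFiber Y y y' ⊗[ℂ] E.fiber y' x) →ₗ[ℂ]
      idFiber Y y y ⊗[ℂ] E.fiber y x)

@[simp] lemma rightApp_cmk (E : Kernel X Y) (y : Y.pt) (x : X.pt) (e : E.fiber y x) :
    rightApp E y x (cmk y (idOne y) e) = e := by
  classical
  have : rightApp E y x (cmk y (idOne y) e) = TensorProduct.lift (LinearMap.mk₂ ℂ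
      (fun (s : idFiber Y y y) (e : E.fiber y x) =>
      idFiber.val Y s • e) (fun _ _ _ => by rw [map_add, add_smul])
      (fun _ _ _ => by rw [map_smul, smul_eq_mul, mul_smul])
      (fun _ _ _ => smul_add _ _ _) (fun _ _ _ => smul_comm _ _ _))
      ((Pi.single y (idFiber.one Y y ⊗ₜ[ℂ] e) :
        (y' : Y.pt) → idFiber Y y y' ⊗[ℂ] E.fiber y' x) y) := by
    rfl
  rw [this, Pi.single_eq_same, TensorProduct.lift.tmul, LinearMap.mk₂_apply, idFiber.val_one,
    one_smul]

/-- The unit isomorphism `E ∘ id ≅ E`. -/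
def leftUnitor (E : Kernel X Y) : comp (idKernel X) E ≅ E where
  hom := homOfAct (leftApp E) (fun {y y' x x'} b a h s => by
    revert s
    refine LinearMap.congr_fun (f := leftApp E y' x' ∘ₗ (comp (idKernel X) E).act b a h)
      (g := E.act b a h ∘ₗ leftApp E y x) (left_hom_ext fun e => ?_)
    simp only [LinearMap.comp_apply, leftApp_cmk]
    rw [act_cmk _ E b a h a h rfl, act_idOne, leftApp_cmk])
  inv := homOfAct (fun y x => (cmk x).flip (idOne x)) (fun {y y' x x'} b a h s => by
    simp only [LinearMap.flip_apply]
    rw [act_cmk _ E b a h a h rfl, act_idOne])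
  hom_inv_id := hom_ext fun y x => left_hom_ext fun e => by
    simp only [comp_app_apply, homOfAct_app, leftApp_cmk, id_app, LinearMap.id_apply,
      LinearMap.flip_apply]
  inv_hom_id := hom_ext fun y x => LinearMap.ext fun e => by
    simp only [comp_app_apply, homOfAct_app, leftApp_cmk, id_app, LinearMap.id_apply,
      LinearMap.flip_apply]

/-- The unit isomorphism `id ∘ E ≅ E`. -/
def rightUnitor (E : Kernel X Y) : comp E (idKernel Y) ≅ E where
  hom := homOfAct (rightApp E) (fun {y y' x x'} b a h s => by
    revert s
    refine LinearMap.congr_fun (f := rightApp E y' x' ∘ₗ (comp E (idKernel Y)).act b a h)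
      (g := E.act b a h ∘ₗ rightApp E y x) (right_hom_ext fun e => ?_)
    simp only [LinearMap.comp_apply, rightApp_cmk]
    rw [act_cmk E _ b a h b rfl h, act_idOne, rightApp_cmk])
  inv := homOfAct (fun y x => cmk y (idOne y)) (fun {y y' x x'} b a h s => by
    rw [act_cmk E _ b a h b rfl h, act_idOne])
  hom_inv_id := hom_ext fun y x => right_hom_ext fun e => by
    simp only [comp_app_apply, homOfAct_app, rightApp_cmk, id_app, LinearMap.id_apply]
  inv_hom_id := hom_ext fun y x => LinearMap.ext fun e => by
    simp only [comp_app_apply, homOfAct_app, rightApp_cmk, id_app, LinearMap.id_apply]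

@[simp] lemma leftUnitor_hom_app_cmk (E : Kernel X Y) (y : Y.pt) (x : X.pt) (e : E.fiber y x) :
    app (leftUnitor E).hom y x (cmk x e (idOne x)) = e := leftApp_cmk E y x e

@[simp] lemma leftUnitor_inv_app (E : Kernel X Y) (y : Y.pt) (x : X.pt) (e : E.fiber y x) :
    app (leftUnitor E).inv y x e = cmk x e (idOne x) := rfl

@[simp] lemma rightUnitor_hom_app_cmk (E : Kernel X Y) (y : Y.pt) (x : X.pt) (e : E.fiber y x) :
    app (rightUnitor E).hom y x (cmk y (idOne y) e) = e := rightApp_cmk E y x e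

@[simp] lemma rightUnitor_inv_app (E : Kernel X Y) (y : Y.pt) (x : X.pt) (e : E.fiber y x) :
    app (rightUnitor E).inv y x e = cmk y (idOne y) e := rfl

end unit

end Kernel

namespace Kernel

variable {G : Type w} [Group G] {X Y Z W V : Gerbe.{w, u} G}

lemma pentagon_hom_ext {E : Kernel X Y} {F : Kernel Y Z} {K : Kernel Z W} {L : Kernel W V}
    {v : V.pt} {x : X.pt} {M : Type u₁} [AddCommGroup M] [Module ℂ M]
    {φ ψ : (comp (comp (comp E F) K) L).fiber v x →ₗ[ℂ] M}
    (h : ∀ a b c l k f e, φ (cmk a l (cmk b k (cmk c f e))) =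
      ψ (cmk a l (cmk b k (cmk c f e)))) : φ = ψ := by
  refine comp_hom_ext fun a l => ?_
  exact LinearMap.congr_fun (f := φ ∘ₗ cmk a l) (g := ψ ∘ₗ cmk a l)
    (assoc_hom_ext fun b c k f e => h a b c l k f e)

lemma triangle_hom_ext {E : Kernel X Y} {F : Kernel Y Z} {z : Z.pt} {x : X.pt} {M : Type u₁}
    [AddCommGroup M] [Module ℂ M] {φ ψ : (comp (comp E (idKernel Y)) F).fiber z x →ₗ[ℂ] M}
    (h : ∀ y f e, φ (cmk y f (cmk y (idOne y) e)) = ψ (cmk y f (cmk y (idOne y) e))) :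
    φ = ψ := by
  refine comp_hom_ext fun y f => ?_
  exact LinearMap.congr_fun (f := φ ∘ₗ cmk y f) (g := ψ ∘ₗ cmk y f)
    (right_hom_ext fun e => h y f e)

end Kernel

open Kernel in
/-- The 2-category of finite `G`-equivariant gerbes with metrics. -/
instance gerbeBicategory {G : Type w} [Group G] : Bicategory (Gerbe.{w, u} G) where
  Hom X Y := Kernel X Y
  id X := idKernel X
  comp E F := Kernel.comp E F
  homCategory X Y := inferInstanceAs (Category (VectorBundle (Y.tensor X.bar)))
  whiskerLeft E _ _ η := Kernel.whiskerLeft E η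
  whiskerRight η F := Kernel.whiskerRight η F
  associator E F K := Kernel.associator E F K
  leftUnitor E := Kernel.leftUnitor E
  rightUnitor E := Kernel.rightUnitor E
  whiskerLeft_id E F := Kernel.hom_ext fun z x => comp_hom_ext fun y f e => by simp
  whiskerLeft_comp E _ _ _ η θ := Kernel.hom_ext fun z x => comp_hom_ext fun y f e => by simp
  id_whiskerLeft η := Kernel.hom_ext fun y x => left_hom_ext fun e => by simp
  comp_whiskerLeft E F _ _ η := Kernel.hom_ext fun z x => assoc_hom_ext fun y f e κ s => by simp
  id_whiskerRight E F := Kernel.hom_ext fun z x => comp_hom_ext fun y f e => by simp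
  comp_whiskerRight η θ F := Kernel.hom_ext fun z x => comp_hom_ext fun y f e => by simp
  whiskerRight_id η := Kernel.hom_ext fun y x => right_hom_ext fun e => by simp
  whiskerRight_comp η E F := Kernel.hom_ext fun z x => assoc_hom_ext' fun y f e κ s => by simp
  whisker_assoc E _ _ η F := Kernel.hom_ext fun z x => assoc_hom_ext fun y f e κ s => by simp
  whisker_exchange η θ := Kernel.hom_ext fun z x => comp_hom_ext fun y f e => by simp
  pentagon E F K L := Kernel.hom_ext fun w x => pentagon_hom_ext fun a b c l k f e => by simp
  triangle E F := Kernel.hom_ext fun z x => triangle_hom_ext fun y f e => by simp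

/-- The inner product of 2-morphisms of gerbes,
`⟨f, g⟩ = ∑ x, ∑ y, k_x k_y Tr (⟨y | f | x⟩^* ⟨y | g | x⟩)`. -/
def Kernel.innerProduct {G : Type w} [Group G] {X Y : Gerbe.{w, u} G} {E F : Kernel X Y}
    (f g : E ⟶ F) : ℂ :=
  ∑ x : X.pt, ∑ y : Y.pt, (X.k x : ℂ) * (Y.k y : ℂ) *
    Hilb.traceAdjMul (Kernel.app f y x) (Kernel.app g y x)

/-! ## 2-Hilbert spaces -/

/-- An H*-category: a category enriched in finite-dimensional Hilbert spaces with an antilinear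
involution `dag` reversing morphisms and compatible with the inner products. -/
class HStarCategory (H : Type v) [Category.{u} H] [Preadditive H] [Linear ℂ H] where
  finite (a b : H) : Module.Finite ℂ (a ⟶ b)
  core (a b : H) : InnerProductSpace.Core ℂ (a ⟶ b)
  dag {a b : H} (f : a ⟶ b) : b ⟶ a
  dag_dag {a b : H} (f : a ⟶ b) : dag (dag f) = f
  dag_add {a b : H} (f f' : a ⟶ b) : dag (f + f') = dag f + dag f'
  dag_smul {a b : H} (c : ℂ) (f : a ⟶ b) : dag (c • f) = conj c • dag f
  dag_comp {a b c : H} (f : a ⟶ b) (g : b ⟶ c) : dag (f ≫ g) = dag g ≫ dag f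
  inner_comp_left {a b c : H} (f : a ⟶ b) (g : b ⟶ c) (h : a ⟶ c) :
    (core a c).inner (f ≫ g) h = (core b c).inner g (dag f ≫ h)
  inner_comp_right {a b c : H} (f : a ⟶ b) (g : b ⟶ c) (h : a ⟶ c) :
    (core a c).inner (f ≫ g) h = (core a b).inner f (h ≫ dag g)

section HStar

variable {H : Type v} [Category.{u} H] [Preadditive H] [Linear ℂ H] [HStarCategory H]
variable {K : Type u₁} [Category.{u₂} K] [Preadditive K] [Linear ℂ K] [HStarCategory K]

/-- The Hilbert space of morphisms from `a` to `b`. -/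
def homHilb (a b : H) : Hilb.{u} where
  carrier := a ⟶ b
  finite := HStarCategory.finite a b
  core := HStarCategory.core a b

/-- The inner product of two morphisms. -/
def homIp {a b : H} (f g : a ⟶ b) : ℂ := (HStarCategory.core a b).inner f g

/-- The adjoint `f^*` of a morphism. -/
def dag {a b : H} (f : a ⟶ b) : b ⟶ a := HStarCategory.dag f

@[simp] lemma dag_dag {a b : H} (f : a ⟶ b) : dag (dag f) = f := HStarCategory.dag_dag f

lemma dag_add {a b : H} (f g : a ⟶ b) : dag (f + g) = dag f + dag g := HStarCategory.dag_add f g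

lemma dag_smul {a b : H} (c : ℂ) (f : a ⟶ b) : dag (c • f) = conj c • dag f :=
  HStarCategory.dag_smul c f

lemma dag_comp {a b c : H} (f : a ⟶ b) (g : b ⟶ c) : dag (f ≫ g) = dag g ≫ dag f :=
  HStarCategory.dag_comp f g

/-- A morphism `f` is unitary if `f^*` is inverse to `f`. -/
structure IsUnitary {a b : H} (f : a ⟶ b) : Prop where
  comp_dag : f ≫ dag f = 𝟙 a
  dag_comp : dag f ≫ f = 𝟙 b

variable (H) in
lemma dag_id (a : H) : dag (𝟙 a) = 𝟙 a := by
  have h : dag (𝟙 a) = dag (𝟙 a) ≫ dag (dag (𝟙 a)) := by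
    rw [TwoRepGerbe.dag_dag, Category.comp_id]
  rw [h, ← TwoRepGerbe.dag_comp, Category.comp_id, TwoRepGerbe.dag_dag]

lemma homIp_comp_left {a b c : H} (f : a ⟶ b) (g : b ⟶ c) (h : a ⟶ c) :
    homIp (f ≫ g) h = homIp g (dag f ≫ h) := HStarCategory.inner_comp_left f g h

lemma homIp_comp_right {a b c : H} (f : a ⟶ b) (g : b ⟶ c) (h : a ⟶ c) :
    homIp (f ≫ g) h = homIp f (h ≫ dag g) := HStarCategory.inner_comp_right f g h

lemma homIp_unitary_comp {a b c : H} {f : a ⟶ b} (hf : IsUnitary f) (g g' : b ⟶ c) :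
    homIp (f ≫ g) (f ≫ g') = homIp g g' := by
  rw [homIp_comp_left, ← Category.assoc, hf.dag_comp, Category.id_comp]

lemma homIp_comp_unitary {a b c : H} (g g' : a ⟶ b) {f : b ⟶ c} (hf : IsUnitary f) :
    homIp (g ≫ f) (g' ≫ f) = homIp g g' := by
  rw [homIp_comp_right, Category.assoc, hf.comp_dag, Category.comp_id]

lemma homIp_smul_left {a b : H} (r : ℂ) (f g : a ⟶ b) : homIp (r • f) g = conj r * homIp f g :=
  (HStarCategory.core a b).smul_left f g r

lemma homIp_conj {a b : H} (f g : a ⟶ b) : conj (homIp g f) = homIp f g :=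
  (HStarCategory.core a b).conj_inner_symm f g

lemma homIp_self_nonneg {a b : H} (f : a ⟶ b) : 0 ≤ (homIp f f).re :=
  (HStarCategory.core a b).re_inner_nonneg f

lemma homIp_self_eq {a b : H} (f : a ⟶ b) : homIp f f = ((homIp f f).re : ℂ) := by
  have := congrArg Complex.im (homIp_conj f f)
  simp only [Complex.conj_im] at this
  exact Complex.ext rfl (by rw [Complex.ofReal_im]; linarith)

lemma homIp_self_pos {a b : H} {f : a ⟶ b} (hf : f ≠ 0) : 0 < (homIp f f).re := by
  refine lt_of_le_of_ne (homIp_self_nonneg f) fun h => hf ?_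
  refine (HStarCategory.core a b).definite f ?_
  exact (homIp_self_eq f).trans (by rw [← h, Complex.ofReal_zero])

namespace IsUnitary

lemma id (a : H) : IsUnitary (𝟙 a) :=
  ⟨by rw [dag_id, Category.comp_id], by rw [dag_id, Category.comp_id]⟩

lemma comp {a b c : H} {f : a ⟶ b} {g : b ⟶ c} (hf : IsUnitary f) (hg : IsUnitary g) :
    IsUnitary (f ≫ g) where
  comp_dag := by
    rw [TwoRepGerbe.dag_comp, Category.assoc, ← Category.assoc g, hg.comp_dag,
      Category.id_comp, hf.comp_dag]
  dag_comp := by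
    rw [TwoRepGerbe.dag_comp, Category.assoc, ← Category.assoc _ f, hf.dag_comp,
      Category.id_comp, hg.dag_comp]

lemma dag {a b : H} {f : a ⟶ b} (hf : IsUnitary f) : IsUnitary (dag f) :=
  ⟨by rw [TwoRepGerbe.dag_dag, hf.dag_comp],
    by rw [TwoRepGerbe.dag_dag, hf.comp_dag]⟩

lemma circle_smul (ζ : Circle) {a b : H} {f : a ⟶ b} (hf : IsUnitary f) :
    IsUnitary ((ζ : ℂ) • f) := by
  have h : (ζ : ℂ) * conj (ζ : ℂ) = 1 := by
    rw [Complex.mul_conj, Circle.normSq_coe, Complex.ofReal_one]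
  constructor
  · rw [TwoRepGerbe.dag_smul, Linear.smul_comp, Linear.comp_smul, smul_smul,
      h, one_smul, hf.comp_dag]
  · rw [TwoRepGerbe.dag_smul, Linear.smul_comp, Linear.comp_smul, smul_smul,
      mul_comm, h, one_smul, hf.dag_comp]

/-- The isomorphism given by a unitary. -/
@[simps] def iso {a b : H} {f : a ⟶ b} (hf : IsUnitary f) : a ≅ b :=
  ⟨f, TwoRepGerbe.dag f, hf.comp_dag, hf.dag_comp⟩

end IsUnitary

lemma dag_eq_inv {a b : H} (f : a ≅ b) (hf : IsUnitary f.hom) : dag f.hom = f.inv := by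
  rw [← cancel_epi f.hom, hf.comp_dag, f.hom_inv_id]

lemma isUnitary_inv {a b : H} (f : a ≅ b) (hf : IsUnitary f.hom) : IsUnitary f.inv := by
  rw [← dag_eq_inv f hf]
  exact hf.dag

/-- A linear *-functor. -/
structure IsStarFunctor (F : H ⥤ K) : Prop where
  map_add : ∀ {a b : H} (f f' : a ⟶ b), F.map (f + f') = F.map f + F.map f'
  map_smul : ∀ {a b : H} (c : ℂ) (f : a ⟶ b), F.map (c • f) = c • F.map f
  map_dag : ∀ {a b : H} (f : a ⟶ b), F.map (dag f) = dag (F.map f)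

lemma IsStarFunctor.map_unitary {F : H ⥤ K} (hF : IsStarFunctor F) {a b : H} {f : a ⟶ b}
    (hf : IsUnitary f) : IsUnitary (F.map f) :=
  ⟨by rw [← hF.map_dag, ← F.map_comp, hf.comp_dag, F.map_id],
    by rw [← hF.map_dag, ← F.map_comp, hf.dag_comp, F.map_id]⟩

variable (H) in
lemma IsStarFunctor.id : IsStarFunctor (𝟭 H) := ⟨fun _ _ => rfl, fun _ _ => rfl, fun _ => rfl⟩

/-- An object is simple if its endomorphism algebra is one-dimensional. -/
def IsSimple (a : H) : Prop := Module.finrank ℂ (a ⟶ a) = 1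

lemma IsSimple.id_ne_zero {a : H} (ha : IsSimple a) : 𝟙 a ≠ 0 := by
  intro h
  have : Subsingleton (a ⟶ a) := ⟨fun f g => by
    rw [← Category.comp_id f, ← Category.comp_id g, h, Limits.comp_zero, Limits.comp_zero]⟩
  have h1 : Module.finrank ℂ (a ⟶ a) = 0 := Module.finrank_zero_of_subsingleton
  rw [IsSimple, h1] at ha
  exact absurd ha (by norm_num)

lemma IsSimple.exists_smul {a : H} (ha : IsSimple a) (f : a ⟶ a) : ∃ c : ℂ, f = c • 𝟙 a := by
  obtain ⟨c, hc⟩ := (finrank_eq_one_iff_of_nonzero' (𝟙 a) ha.id_ne_zero).1 ha f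
  exact ⟨c, hc.symm⟩

/-- Isomorphic simple objects are unitarily isomorphic. -/
lemma IsSimple.exists_unitary {a b : H} (ha : IsSimple a) (f : a ≅ b) :
    ∃ u : a ⟶ b, IsUnitary u := by
  obtain ⟨c, hc⟩ := ha.exists_smul (f.hom ≫ dag f.hom)
  have hne : f.hom ≠ 0 := fun h => ha.id_ne_zero (by
    rw [← f.hom_inv_id, h, Limits.zero_comp])
  have h1 : homIp f.hom f.hom = c * homIp (𝟙 a) (𝟙 a) := by
    have h2 : homIp f.hom f.hom = homIp (𝟙 a) (f.hom ≫ dag f.hom) := by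
      rw [← homIp_comp_right, Category.id_comp]
    rw [h2, hc, ← homIp_conj, homIp_smul_left, map_mul, homIp_conj, Complex.conj_conj]
  have hp := homIp_self_pos hne
  have hq := homIp_self_pos ha.id_ne_zero
  set p := (homIp f.hom f.hom).re
  set q := (homIp (𝟙 a) (𝟙 a)).re
  have hcr : c = ((p / q : ℝ) : ℂ) := by
    rw [homIp_self_eq f.hom, homIp_self_eq (𝟙 a)] at h1
    rw [Complex.ofReal_div, eq_div_iff (Complex.ofReal_ne_zero.2 hq.ne')]
    exact h1.symm
  have hr : 0 < p / q := div_pos hp hq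
  set r : ℝ := p / q
  set s : ℝ := (Real.sqrt r)⁻¹
  have hs : s * s * r = 1 := by
    have := Real.mul_self_sqrt hr.le
    have h3 : Real.sqrt r ≠ 0 := (Real.sqrt_pos.2 hr).ne'
    simp only [s]
    field_simp
    nlinarith
  have hs0 : (s : ℂ) ≠ 0 := by
    rw [Complex.ofReal_ne_zero]
    rintro h
    rw [h] at hs
    norm_num at hs
  have hu : ((s : ℂ) • f.hom) ≫ dag ((s : ℂ) • f.hom) = 𝟙 a := by
    rw [dag_smul, Linear.smul_comp, Linear.comp_smul, hc, hcr, smul_smul, smul_smul,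
      Complex.conj_ofReal, ← Complex.ofReal_mul, ← Complex.ofReal_mul, hs,
      Complex.ofReal_one, one_smul]
  refine ⟨(s : ℂ) • f.hom, hu, ?_⟩
  have hl : ((s : ℂ)⁻¹ • f.inv) ≫ ((s : ℂ) • f.hom) = 𝟙 b := by
    rw [Linear.smul_comp, Linear.comp_smul, smul_smul, inv_mul_cancel₀ hs0, one_smul,
      f.inv_hom_id]
  have hd : dag ((s : ℂ) • f.hom) = (s : ℂ)⁻¹ • f.inv := by
    rw [← Category.id_comp (dag _), ← hl, Category.assoc, hu, Category.comp_id]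
  rw [hd, hl]

end HStar

/-- A 2-Hilbert space: an H*-category with finite direct sums in which all idempotents split. It is
finite-dimensional and marked: `e` is a finite list of simple objects, containing exactly one
representative of every isomorphism class of simple objects. -/
structure MarkedTwoHilb : Type (max (u + 1) (v + 1)) where
  carrier : Type v
  [category : Category.{u} carrier]
  [preadditive : Preadditive carrier]
  [linear : Linear ℂ carrier]
  [hStar : HStarCategory carrier]
  hasFiniteBiproducts : Limits.HasFiniteBiproducts carrier
  isIdempotentComplete : IsIdempotentComplete carrier
  idx : Type u
  [fintype : Fintype idx]
  e : idx → carrier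
  isSimple_e : ∀ i, IsSimple (e i)
  e_injective : ∀ i j, Nonempty (e i ≅ e j) → i = j
  exists_iso_e : ∀ a : carrier, IsSimple a → ∃ i, Nonempty (a ≅ e i)

attribute [instance] MarkedTwoHilb.category MarkedTwoHilb.preadditive MarkedTwoHilb.linear
  MarkedTwoHilb.hStar MarkedTwoHilb.fintype

/-! ## Unitary 2-representations -/

/-- A marked unitary 2-representation of `G`: a weak action of `G` on a marked finite-dimensional
2-Hilbert space by linear *-functors which are unitary on hom-spaces, with unitary coherence
isomorphisms `unit : id ⇒ α_e` and `mul g₂ g₁ : α_{g₂} ∘ α_{g₁} ⇒ α_{g₂ g₁}`. (The index of the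
target of `mul` is a variable `g` with a proof of `g₂ * g₁ = g`.) -/
structure MarkedTwoRep (G : Type w) [Group G] : Type (max (u + 1) (v + 1) w) extends
    MarkedTwoHilb.{v, u} where
  act : G → carrier ⥤ carrier
  act_star : ∀ g, IsStarFunctor (act g)
  act_isometry : ∀ (g : G) {a b : carrier} (f f' : a ⟶ b),
    homIp ((act g).map f) ((act g).map f') = homIp f f'
  act_surjective : ∀ (g : G) (a b : carrier),
    Function.Surjective ((act g).map : (a ⟶ b) → ((act g).obj a ⟶ (act g).obj b))
  unit : 𝟭 carrier ≅ act 1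
  unit_unitary : ∀ a, IsUnitary (unit.hom.app a)
  mul : ∀ g₂ g₁ g : G, g₂ * g₁ = g → (act g₁ ⋙ act g₂ ≅ act g)
  mul_unitary : ∀ (g₂ g₁ g : G) (h : g₂ * g₁ = g) (a : carrier),
    IsUnitary ((mul g₂ g₁ g h).hom.app a)
  unit_mul : ∀ (g : G) (a : carrier),
    unit.hom.app ((act g).obj a) ≫ (mul 1 g g (one_mul g)).hom.app a = 𝟙 ((act g).obj a)
  mul_unit : ∀ (g : G) (a : carrier),
    (act g).map (unit.hom.app a) ≫ (mul g 1 g (mul_one g)).hom.app a = 𝟙 ((act g).obj a)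
  mul_assoc : ∀ (g₃ g₂ g₁ g₃₂ g₂₁ g : G) (h₃₂ : g₃ * g₂ = g₃₂) (h₂₁ : g₂ * g₁ = g₂₁)
    (h : g₃₂ * g₁ = g) (h' : g₃ * g₂₁ = g) (a : carrier),
    (mul g₃ g₂ g₃₂ h₃₂).hom.app ((act g₁).obj a) ≫ (mul g₃₂ g₁ g h).hom.app a =
      (act g₃).map ((mul g₂ g₁ g₂₁ h₂₁).hom.app a) ≫ (mul g₃ g₂₁ g h').hom.app a

/-- A morphism (intertwiner) of 2-representations: a linear *-functor `σ` with unitary natural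
isomorphisms `σ(g) : β_g ∘ σ ⇒ σ ∘ α_g` compatible with the coherence isomorphisms. -/
structure Intertwiner {G : Type w} [Group G] (α β : MarkedTwoRep.{w, v, u} G) :
    Type (max v u w) where
  functor : α.carrier ⥤ β.carrier
  star : IsStarFunctor functor
  comm : ∀ g : G, functor ⋙ β.act g ≅ α.act g ⋙ functor
  comm_unitary : ∀ (g : G) (a : α.carrier), IsUnitary ((comm g).hom.app a)
  comm_mul : ∀ (g₂ g₁ g : G) (h : g₂ * g₁ = g) (a : α.carrier),
    (β.mul g₂ g₁ g h).hom.app (functor.obj a) ≫ (comm g).hom.app a =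
      (β.act g₂).map ((comm g₁).hom.app a) ≫ (comm g₂).hom.app ((α.act g₁).obj a) ≫
        functor.map ((α.mul g₂ g₁ g h).hom.app a)
  comm_unit : ∀ a : α.carrier,
    β.unit.hom.app (functor.obj a) ≫ (comm 1).hom.app a = functor.map (α.unit.hom.app a)

namespace Intertwiner

variable {G : Type w} [Group G] {α β γ δ : MarkedTwoRep.{w, v, u} G}

/-- The space of 2-morphisms (modifications): natural transformations `θ : σ ⇒ ρ` with
`(θ * id) ∘ σ(g) = ρ(g) ∘ (id * θ)`. -/
def homSubmodule (σ ρ : Intertwiner α β) : Submodule ℂ (σ.functor ⟶ ρ.functor) where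
  carrier := {θ | ∀ (g : G) (a : α.carrier),
    (σ.comm g).hom.app a ≫ θ.app ((α.act g).obj a) =
      (β.act g).map (θ.app a) ≫ (ρ.comm g).hom.app a}
  add_mem' {θ θ'} h h' := fun g a => by
    rw [NatTrans.app_add, NatTrans.app_add, Preadditive.comp_add, h g a, h' g a,
      (β.act_star g).map_add, Preadditive.add_comp]
  zero_mem' := fun g a => by
    have h0 : (β.act g).map (0 : σ.functor.obj a ⟶ ρ.functor.obj a) = 0 := by
      have := (β.act_star g).map_smul (0 : ℂ) (0 : σ.functor.obj a ⟶ ρ.functor.obj a)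
      simpa only [zero_smul] using this
    rw [NatTrans.app_zero, NatTrans.app_zero, Limits.comp_zero, h0, Limits.zero_comp]
  smul_mem' c θ h := fun g a => by
    rw [NatTrans.app_smul, NatTrans.app_smul, Linear.comp_smul, h g a,
      (β.act_star g).map_smul, Linear.smul_comp]

/-- A 2-morphism of 2-representations. -/
def Hom (σ ρ : Intertwiner α β) : Type (max v u) := homSubmodule σ ρ

instance (σ ρ : Intertwiner α β) : AddCommGroup (Hom σ ρ) :=
  inferInstanceAs (AddCommGroup (homSubmodule σ ρ))

instance (σ ρ : Intertwiner α β) : Module ℂ (Hom σ ρ) :=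
  inferInstanceAs (Module ℂ (homSubmodule σ ρ))

/-- The component of a 2-morphism at an object. -/
def Hom.app {σ ρ : Intertwiner α β} (θ : Hom σ ρ) (a : α.carrier) :
    σ.functor.obj a ⟶ ρ.functor.obj a := NatTrans.app θ.1 a

lemma Hom.naturality {σ ρ : Intertwiner α β} (θ : Hom σ ρ) {a b : α.carrier} (f : a ⟶ b) :
    σ.functor.map f ≫ θ.app b = θ.app a ≫ ρ.functor.map f := NatTrans.naturality θ.1 f

lemma Hom.comm {σ ρ : Intertwiner α β} (θ : Hom σ ρ) (g : G) (a : α.carrier) :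
    (σ.comm g).hom.app a ≫ θ.app ((α.act g).obj a) =
      (β.act g).map (θ.app a) ≫ (ρ.comm g).hom.app a := θ.2 g a

/-- Build a 2-morphism from its components. -/
def Hom.mk {σ ρ : Intertwiner α β} (app : ∀ a, σ.functor.obj a ⟶ ρ.functor.obj a)
    (naturality : ∀ {a b : α.carrier} (f : a ⟶ b),
      σ.functor.map f ≫ app b = app a ≫ ρ.functor.map f)
    (comm : ∀ (g : G) (a : α.carrier), (σ.comm g).hom.app a ≫ app ((α.act g).obj a) =
      (β.act g).map (app a) ≫ (ρ.comm g).hom.app a) : Hom σ ρ :=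
  ⟨{ app := app, naturality := fun _ _ f => naturality f }, comm⟩

@[simp] lemma Hom.mk_app {σ ρ : Intertwiner α β} (app : ∀ a, σ.functor.obj a ⟶ ρ.functor.obj a)
    (h) (h') (a : α.carrier) : (Hom.mk (σ := σ) (ρ := ρ) app h h').app a = app a := rfl

@[ext] lemma Hom.ext {σ ρ : Intertwiner α β} {θ θ' : Hom σ ρ} (h : ∀ a, θ.app a = θ'.app a) :
    θ = θ' := Subtype.ext (NatTrans.ext (funext h))

instance : Category.{max v u} (Intertwiner α β) where
  Hom := Hom
  id σ := Hom.mk (fun a => 𝟙 _) (fun f => by simp) (fun g a => by simp)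
  comp θ η := Hom.mk (fun a => θ.app a ≫ η.app a)
    (fun f => by rw [← Category.assoc, θ.naturality, Category.assoc, η.naturality, Category.assoc])
    (fun g a => by
      rw [← Category.assoc, θ.comm, Category.assoc, η.comm, Functor.map_comp, Category.assoc])
  id_comp θ := Hom.ext fun a => by simp
  comp_id θ := Hom.ext fun a => by simp
  assoc θ η κ := Hom.ext fun a => by simp

instance (σ ρ : Intertwiner α β) : AddCommGroup (σ ⟶ ρ) :=
  inferInstanceAs (AddCommGroup (Hom σ ρ))

instance (σ ρ : Intertwiner α β) : Module ℂ (σ ⟶ ρ) :=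
  inferInstanceAs (Module ℂ (Hom σ ρ))

lemma hom_ext {σ ρ : Intertwiner α β} {θ θ' : σ ⟶ ρ}
    (h : ∀ a, Hom.app θ a = Hom.app θ' a) : θ = θ' := Hom.ext h

@[simp] lemma id_app (σ : Intertwiner α β) (a : α.carrier) : Hom.app (𝟙 σ) a = 𝟙 _ := rfl

@[simp] lemma comp_app {σ ρ τ : Intertwiner α β} (θ : σ ⟶ ρ) (η : ρ ⟶ τ) (a : α.carrier) :
    Hom.app (θ ≫ η) a = Hom.app θ a ≫ Hom.app η a := rfl

/-- Build an invertible 2-morphism from its components. -/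
def isoMk {σ ρ : Intertwiner α β} (app : ∀ a, σ.functor.obj a ≅ ρ.functor.obj a)
    (naturality : ∀ {a b : α.carrier} (f : a ⟶ b),
      σ.functor.map f ≫ (app b).hom = (app a).hom ≫ ρ.functor.map f)
    (comm : ∀ (g : G) (a : α.carrier), (σ.comm g).hom.app a ≫ (app ((α.act g).obj a)).hom =
      (β.act g).map (app a).hom ≫ (ρ.comm g).hom.app a) : σ ≅ ρ where
  hom := Hom.mk (fun a => (app a).hom) naturality comm
  inv := Hom.mk (fun a => (app a).inv)
    (fun {a b} f => by
      rw [← cancel_mono (app b).hom, Category.assoc, Category.assoc, naturality]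
      simp)
    (fun g a => by
      rw [← cancel_mono (app ((α.act g).obj a)).hom, Category.assoc, Category.assoc, comm]
      simp [← Functor.map_comp_assoc])
  hom_inv_id := hom_ext fun a => (app a).hom_inv_id
  inv_hom_id := hom_ext fun a => (app a).inv_hom_id

/-- The identity intertwiner. -/
def id (α : MarkedTwoRep.{w, v, u} G) : Intertwiner α α where
  functor := 𝟭 _
  star := IsStarFunctor.id _
  comm g := Iso.refl _
  comm_unitary g a := IsUnitary.id _
  comm_mul g₂ g₁ g h a := by
    change _ ≫ 𝟙 _ = (α.act g₂).map (𝟙 _) ≫ 𝟙 _ ≫ _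
    simp
  comm_unit a := Category.comp_id _

/-- The composite `τ ∘ σ` of intertwiners. -/
def comp (σ : Intertwiner α β) (τ : Intertwiner β γ) : Intertwiner α γ where
  functor := σ.functor ⋙ τ.functor
  star := ⟨fun f f' => by
      rw [Functor.comp_map, σ.star.map_add, τ.star.map_add, Functor.comp_map, Functor.comp_map],
    fun c f => by rw [Functor.comp_map, σ.star.map_smul, τ.star.map_smul, Functor.comp_map],
    fun f => by rw [Functor.comp_map, σ.star.map_dag, τ.star.map_dag, Functor.comp_map]⟩
  comm g := NatIso.ofComponents
    (fun a => (τ.comm g).app (σ.functor.obj a) ≪≫ τ.functor.mapIso ((σ.comm g).app a))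
    (fun {a b} f => by
      have h1 := (τ.comm g).hom.naturality (σ.functor.map f)
      have h2 := (σ.comm g).hom.naturality f
      simp only [Functor.comp_map] at h1 h2
      simp only [Functor.comp_map, Iso.trans_hom, Iso.app_hom, Functor.mapIso_hom,
        Category.assoc, ← Functor.map_comp, ← h2]
      rw [← Category.assoc, h1, Category.assoc, Functor.map_comp])
  comm_unitary g a := (τ.comm_unitary g _).comp (τ.star.map_unitary (σ.comm_unitary g a))
  comm_mul g₂ g₁ g h a := by
    have h1 := τ.comm_mul g₂ g₁ g h (σ.functor.obj a)
    have h2 := congrArg τ.functor.map (σ.comm_mul g₂ g₁ g h a)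
    have h3 := (τ.comm g₂).hom.naturality ((σ.comm g₁).hom.app a)
    simp only [Functor.map_comp, Functor.comp_map] at h1 h2 h3
    simp only [NatIso.ofComponents_hom_app, Iso.trans_hom, Iso.app_hom, Functor.mapIso_hom,
      Functor.comp_obj, Functor.comp_map, Functor.map_comp, Category.assoc] at h1 h2 h3 ⊢
    rw [reassoc_of% h1, h2, reassoc_of% h3]
  comm_unit a := by
    have h1 := τ.comm_unit (σ.functor.obj a)
    have h2 := congrArg τ.functor.map (σ.comm_unit a)
    simp only [Functor.map_comp] at h2
    simp only [NatIso.ofComponents_hom_app, Iso.trans_hom, Iso.app_hom, Functor.mapIso_hom,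
      Functor.comp_obj, Functor.comp_map] at h1 h2 ⊢
    rw [reassoc_of% h1, h2]

lemma comp_comm_app (σ : Intertwiner α β) (τ : Intertwiner β γ) (g : G) (a : α.carrier) :
    ((comp σ τ).comm g).hom.app a =
      (τ.comm g).hom.app (σ.functor.obj a) ≫ τ.functor.map ((σ.comm g).hom.app a) := rfl

/-- The horizontal composite of the identity of `σ` with a 2-morphism. -/
def whiskerLeft (σ : Intertwiner α β) {τ τ' : Intertwiner β γ} (θ : τ ⟶ τ') :
    comp σ τ ⟶ comp σ τ' :=
  Hom.mk (fun a => Hom.app θ (σ.functor.obj a)) (fun f => Hom.naturality θ (σ.functor.map f))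
    (fun g a => by
      have h1 := Hom.comm θ g (σ.functor.obj a)
      have h2 := Hom.naturality θ ((σ.comm g).hom.app a)
      simp only [Functor.comp_obj] at h1 h2
      refine (Category.assoc _ _ _).trans ?_
      refine (congrArg (_ ≫ ·) h2).trans ?_
      refine (Category.assoc _ _ _).symm.trans ?_
      exact (congrArg (· ≫ _) h1).trans (Category.assoc _ _ _))

/-- The horizontal composite of a 2-morphism with the identity of `τ`. -/
def whiskerRight {σ σ' : Intertwiner α β} (θ : σ ⟶ σ') (τ : Intertwiner β γ) :
    comp σ τ ⟶ comp σ' τ :=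
  Hom.mk (fun a => τ.functor.map (Hom.app θ a))
    (fun f => by
      have h := congrArg τ.functor.map (Hom.naturality θ f)
      rw [Functor.map_comp, Functor.map_comp] at h
      exact h)
    (fun g a => by
      have h1 := congrArg τ.functor.map (Hom.comm θ g a)
      have h2 := (τ.comm g).hom.naturality (Hom.app θ a)
      rw [Functor.map_comp, Functor.map_comp] at h1
      refine (Category.assoc _ _ _).trans ?_
      refine (congrArg (_ ≫ ·) h1).trans ?_
      refine (Category.assoc _ _ _).symm.trans ?_
      exact (congrArg (· ≫ _) h2.symm).trans (Category.assoc _ _ _))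

@[simp] lemma whiskerLeft_app (σ : Intertwiner α β) {τ τ' : Intertwiner β γ} (θ : τ ⟶ τ')
    (a : α.carrier) : Hom.app (whiskerLeft σ θ) a = Hom.app θ (σ.functor.obj a) := rfl

@[simp] lemma whiskerRight_app {σ σ' : Intertwiner α β} (θ : σ ⟶ σ') (τ : Intertwiner β γ)
    (a : α.carrier) : Hom.app (whiskerRight θ τ) a = τ.functor.map (Hom.app θ a) := rfl

/-- The associator, with identity components. -/
def associator (σ : Intertwiner α β) (τ : Intertwiner β γ) (ρ : Intertwiner γ δ) :
    comp (comp σ τ) ρ ≅ comp σ (comp τ ρ) :=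
  isoMk (fun _ => Iso.refl _) (fun f => (Category.comp_id _).trans (Category.id_comp _).symm)
    (fun g a => by
      refine (Category.comp_id _).trans ?_
      refine Eq.trans ?_ ((Category.id_comp _).symm.trans
        (congrArg (· ≫ _) ((δ.act g).map_id _).symm))
      exact (congrArg (_ ≫ ·) (ρ.functor.map_comp _ _)).trans (Category.assoc _ _ _).symm)

/-- The left unitor, with identity components. -/
def leftUnitor (σ : Intertwiner α β) : comp (id α) σ ≅ σ :=
  isoMk (fun _ => Iso.refl _) (fun f => (Category.comp_id _).trans (Category.id_comp _).symm)
    (fun g a => by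
      refine (Category.comp_id _).trans ?_
      refine Eq.trans ?_ ((Category.id_comp _).symm.trans
        (congrArg (· ≫ _) ((β.act g).map_id _).symm))
      exact (congrArg (_ ≫ ·) (σ.functor.map_id _)).trans (Category.comp_id _))

/-- The right unitor, with identity components. -/
def rightUnitor (σ : Intertwiner α β) : comp σ (id β) ≅ σ :=
  isoMk (fun _ => Iso.refl _) (fun f => (Category.comp_id _).trans (Category.id_comp _).symm)
    (fun g a => by
      refine (Category.comp_id _).trans ?_
      refine Eq.trans ?_ ((Category.id_comp _).symm.trans
        (congrArg (· ≫ _) ((β.act g).map_id _).symm))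
      exact Category.id_comp _)

@[simp] lemma associator_hom_app (σ : Intertwiner α β) (τ : Intertwiner β γ)
    (ρ : Intertwiner γ δ) (a : α.carrier) : Hom.app (associator σ τ ρ).hom a =
      𝟙 (ρ.functor.obj (τ.functor.obj (σ.functor.obj a))) := rfl

@[simp] lemma associator_inv_app (σ : Intertwiner α β) (τ : Intertwiner β γ)
    (ρ : Intertwiner γ δ) (a : α.carrier) : Hom.app (associator σ τ ρ).inv a =
      𝟙 (ρ.functor.obj (τ.functor.obj (σ.functor.obj a))) := rfl

@[simp] lemma leftUnitor_hom_app (σ : Intertwiner α β) (a : α.carrier) :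
    Hom.app (leftUnitor σ).hom a = 𝟙 (σ.functor.obj a) := rfl

@[simp] lemma leftUnitor_inv_app (σ : Intertwiner α β) (a : α.carrier) :
    Hom.app (leftUnitor σ).inv a = 𝟙 (σ.functor.obj a) := rfl

@[simp] lemma rightUnitor_hom_app (σ : Intertwiner α β) (a : α.carrier) :
    Hom.app (rightUnitor σ).hom a = 𝟙 (σ.functor.obj a) := rfl

@[simp] lemma rightUnitor_inv_app (σ : Intertwiner α β) (a : α.carrier) :
    Hom.app (rightUnitor σ).inv a = 𝟙 (σ.functor.obj a) := rfl

/-- The inner product of 2-morphisms, `⟨θ, θ'⟩ = ∑ i, k_i (θ_{e_i}, θ'_{e_i})`, where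
`k_i = (id_{e_i}, id_{e_i})`. -/
def innerProduct {σ ρ : Intertwiner α β} (θ θ' : σ ⟶ ρ) : ℂ :=
  ∑ i : α.idx, homIp (𝟙 (α.e i)) (𝟙 (α.e i)) *
    homIp (Hom.app θ (α.e i)) (Hom.app θ' (α.e i))

end Intertwiner

open Intertwiner in
/-- The 2-category of marked unitary 2-representations of `G`. -/
instance twoRepBicategory {G : Type w} [Group G] : Bicategory (MarkedTwoRep.{w, v, u} G) where
  Hom α β := Intertwiner α β
  id α := Intertwiner.id α
  comp σ τ := Intertwiner.comp σ τ
  homCategory α β := inferInstanceAs (Category (Intertwiner α β))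
  whiskerLeft σ _ _ θ := Intertwiner.whiskerLeft σ θ
  whiskerRight θ τ := Intertwiner.whiskerRight θ τ
  associator σ τ ρ := Intertwiner.associator σ τ ρ
  leftUnitor σ := Intertwiner.leftUnitor σ
  rightUnitor σ := Intertwiner.rightUnitor σ
  whiskerLeft_id σ τ := Intertwiner.hom_ext fun a => rfl
  whiskerLeft_comp σ _ _ _ η θ := Intertwiner.hom_ext fun a => rfl
  id_whiskerLeft η := Intertwiner.hom_ext fun a =>
    ((Category.id_comp _).trans (Category.comp_id _)).symm
  comp_whiskerLeft σ τ _ _ η := Intertwiner.hom_ext fun a =>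
    ((Category.id_comp _).trans (Category.comp_id _)).symm
  id_whiskerRight σ τ := Intertwiner.hom_ext fun a => τ.functor.map_id _
  comp_whiskerRight η θ τ := Intertwiner.hom_ext fun a => τ.functor.map_comp _ _
  whiskerRight_id η := Intertwiner.hom_ext fun a =>
    ((Category.id_comp _).trans (Category.comp_id _)).symm
  whiskerRight_comp η σ τ := Intertwiner.hom_ext fun a =>
    ((Category.id_comp _).trans (Category.comp_id _)).symm
  whisker_assoc σ _ _ η τ := Intertwiner.hom_ext fun a =>
    ((Category.id_comp _).trans (Category.comp_id _)).symm
  whisker_exchange {_ _ _ σ σ' τ τ'} η θ := Intertwiner.hom_ext fun a =>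
    (Hom.naturality θ (Hom.app η a)).symm
  pentagon σ τ ρ κ := Intertwiner.hom_ext fun a =>
    (congrArg (· ≫ _) (κ.functor.map_id _)).trans (Category.id_comp _)
  triangle σ τ := Intertwiner.hom_ext fun a =>
    (Category.id_comp _).trans (τ.functor.map_id _).symm

/-! ## The gerbe of a marked unitary 2-representation -/

lemma homIp_zero_left {H : Type v} [Category.{u} H] [Preadditive H] [Linear ℂ H]
    [HStarCategory H] {a b : H} (f : a ⟶ b) : homIp (0 : a ⟶ b) f = 0 := by
  have := homIp_smul_left 0 (0 : a ⟶ b) f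
  simpa using this

namespace MarkedTwoRep

variable {G : Type w} [Group G] (α : MarkedTwoRep.{w, v, u} G)

lemma isSimple_act (g : G) {a : α.carrier} (ha : IsSimple a) : IsSimple ((α.act g).obj a) := by
  let L : (a ⟶ a) →ₗ[ℂ] ((α.act g).obj a ⟶ (α.act g).obj a) :=
    { toFun := (α.act g).map
      map_add' := (α.act_star g).map_add
      map_smul' := (α.act_star g).map_smul }
  have hinj : Function.Injective L := by
    rw [← LinearMap.ker_eq_bot, LinearMap.ker_eq_bot']
    intro f hf
    have hf' : (α.act g).map f = 0 := hf
    have h1 := α.act_isometry g f f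
    rw [hf', homIp_zero_left] at h1
    by_contra hne
    have := homIp_self_pos hne
    rw [← h1, Complex.zero_re] at this
    exact lt_irrefl _ this
  have := (LinearEquiv.ofBijective L ⟨hinj, α.act_surjective g a a⟩).finrank_eq
  rw [IsSimple, ← this]
  exact ha

/-- The action of `G` on the marked simple objects: `g • i` is the unique index with
`e (g • i) ≅ α_g (e i)`. -/
def smulIdx (g : G) (i : α.idx) : α.idx :=
  (α.exists_iso_e _ (α.isSimple_act g (α.isSimple_e i))).choose

lemma smulIdx_iso (g : G) (i : α.idx) :
    Nonempty (α.e (α.smulIdx g i) ≅ (α.act g).obj (α.e i)) :=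
  (α.exists_iso_e _ (α.isSimple_act g (α.isSimple_e i))).choose_spec.map Iso.symm

lemma smulIdx_eq {g : G} {i j : α.idx} (f : α.e j ≅ (α.act g).obj (α.e i)) :
    α.smulIdx g i = j := by
  obtain ⟨f'⟩ := α.smulIdx_iso g i
  exact α.e_injective _ _ ⟨f' ≪≫ f.symm⟩

/-- The action of `G` on the marked simple objects. -/
@[reducible] def mulAction : MulAction G α.idx where
  smul := α.smulIdx
  one_smul i := α.smulIdx_eq (α.unit.app (α.e i))
  mul_smul g h i := by
    obtain ⟨f⟩ := α.smulIdx_iso g (α.smulIdx h i)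
    obtain ⟨f'⟩ := α.smulIdx_iso h i
    exact α.smulIdx_eq (f ≪≫ (α.act g).mapIso f' ≪≫ (α.mul g h (g * h) rfl).app (α.e i))

/-- The arrows `i ⟶ j` of the gerbe of `α`: an element `g` of `G` and a unitary
`e_j ⟶ α_g (e_i)`. (Such a unitary exists only if `j = g • i`.) -/
structure Arrow (i j : α.idx) : Type (max u w) where
  deg : G
  u : α.e j ⟶ (α.act deg).obj (α.e i)
  unitary : IsUnitary u

namespace Arrow

variable {α}

lemma ext_u {i j : α.idx} {g : G} {u u' : α.e j ⟶ (α.act g).obj (α.e i)} {h : IsUnitary u}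
    {h' : IsUnitary u'} (huu : u = u') : (⟨g, u, h⟩ : Arrow α i j) = ⟨g, u', h'⟩ := by
  subst huu
  rfl

/-- The unitary underlying a composite, `a(g₂, g₁) ∘ α_{g₂}(u₁) ∘ u₂`. -/
def compU {i j l : α.idx} {g₁ g₂ g : G} (h : g₂ * g₁ = g)
    (u₁ : α.e j ⟶ (α.act g₁).obj (α.e i)) (u₂ : α.e l ⟶ (α.act g₂).obj (α.e j)) :
    α.e l ⟶ (α.act g).obj (α.e i) :=
  u₂ ≫ (α.act g₂).map u₁ ≫ (α.mul g₂ g₁ g h).hom.app (α.e i)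

lemma compU_unitary {i j l : α.idx} {g₁ g₂ g : G} (h : g₂ * g₁ = g)
    {u₁ : α.e j ⟶ (α.act g₁).obj (α.e i)} {u₂ : α.e l ⟶ (α.act g₂).obj (α.e j)}
    (h₁ : IsUnitary u₁) (h₂ : IsUnitary u₂) : IsUnitary (compU h u₁ u₂) :=
  h₂.comp (((α.act_star g₂).map_unitary h₁).comp (α.mul_unitary g₂ g₁ g h (α.e i)))

/-- Composition of arrows. -/
def comp {i j l : α.idx} (a : Arrow α i j) (b : Arrow α j l) : Arrow α i l :=
  ⟨b.deg * a.deg, compU rfl a.u b.u, compU_unitary rfl a.unitary b.unitary⟩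

lemma comp_eq {i j l : α.idx} (a : Arrow α i j) (b : Arrow α j l) {g : G}
    (h : b.deg * a.deg = g) :
    comp a b = ⟨g, compU h a.u b.u, compU_unitary h a.unitary b.unitary⟩ := by
  subst h
  rfl

variable (α) in
/-- The identity arrow. -/
def id (i : α.idx) : Arrow α i i := ⟨1, α.unit.hom.app (α.e i), α.unit_unitary (α.e i)⟩

/-- The unitary underlying the inverse of an arrow,
`α_{g⁻¹}(u^*) ∘ a(g⁻¹, g)^{-1} ∘ a(e)`. -/
def invU {i j : α.idx} {g : G} (u : α.e j ⟶ (α.act g).obj (α.e i)) :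
    α.e i ⟶ (α.act g⁻¹).obj (α.e j) :=
  α.unit.hom.app (α.e i) ≫ (α.mul g⁻¹ g 1 (inv_mul_cancel g)).inv.app (α.e i) ≫
    (α.act g⁻¹).map (dag u)

lemma invU_unitary {i j : α.idx} {g : G} {u : α.e j ⟶ (α.act g).obj (α.e i)}
    (h : IsUnitary u) : IsUnitary (invU u) :=
  (α.unit_unitary _).comp ((isUnitary_inv ((α.mul g⁻¹ g 1 (inv_mul_cancel g)).app (α.e i))
    (α.mul_unitary _ _ _ _ _)).comp ((α.act_star g⁻¹).map_unitary h.dag))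

/-- The inverse of an arrow. -/
def inv {i j : α.idx} (a : Arrow α i j) : Arrow α j i :=
  ⟨a.deg⁻¹, invU a.u, invU_unitary a.unitary⟩

lemma comp_inv {i j : α.idx} (a : Arrow α i j) : comp a (inv a) = id α i := by
  rw [comp_eq a (inv a) (inv_mul_cancel a.deg)]
  refine ext_u ?_
  dsimp only [compU, inv, invU]
  simp only [Category.assoc]
  rw [← Functor.map_comp_assoc, a.unitary.dag_comp, CategoryTheory.Functor.map_id, Category.id_comp]
  simp

lemma assoc {i j l m : α.idx} (a : Arrow α i j) (b : Arrow α j l) (c : Arrow α l m) :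
    comp (comp a b) c = comp a (comp b c) := by
  rw [comp_eq (comp a b) c (_root_.mul_assoc _ _ _).symm, comp_eq a (comp b c) rfl]
  refine ext_u ?_
  have h1 := α.mul_assoc c.deg b.deg a.deg _ _ _ rfl rfl rfl (_root_.mul_assoc _ _ _).symm (α.e i)
  have h2 := (α.mul c.deg b.deg _ rfl).hom.naturality a.u
  simp only [Functor.comp_map] at h2
  simp only [compU, comp, Functor.map_comp, Category.assoc]
  erw [← h1, ← reassoc_of% h2]

lemma id_comp {i j : α.idx} (a : Arrow α i j) : comp (id α i) a = a := by
  rw [comp_eq (id α i) a (mul_one _)]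
  refine ext_u ?_
  have := α.mul_unit a.deg (α.e i)
  simp only [compU, id]
  erw [this, Category.comp_id]

lemma comp_id {i j : α.idx} (a : Arrow α i j) : comp a (id α j) = a := by
  rw [comp_eq a (id α j) (one_mul _)]
  refine ext_u ?_
  have h1 := α.unit_mul a.deg (α.e i)
  have h2 := α.unit.hom.naturality a.u
  simp only [Functor.id_map] at h2
  simp only [compU, id]
  erw [← reassoc_of% h2, h1, Category.comp_id]

lemma inv_comp {i j : α.idx} (a : Arrow α i j) : comp (inv a) a = id α j := by
  have h : comp (inv a) (comp a (comp (inv a) (inv (inv a)))) = id α j := by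
    rw [← assoc a, comp_inv, id_comp, comp_inv]
  rwa [comp_inv, comp_id] at h

/-- Multiplication of an arrow by a phase. -/
def smul (ζ : Circle) {i j : α.idx} (a : Arrow α i j) : Arrow α i j :=
  ⟨a.deg, (ζ : ℂ) • a.u, a.unitary.circle_smul ζ⟩

lemma smul_comp (ζ : Circle) {i j l : α.idx} (a : Arrow α i j) (b : Arrow α j l) :
    comp (smul ζ a) b = smul ζ (comp a b) := by
  refine ext_u ?_
  simp only [compU, smul]
  rw [(α.act_star _).map_smul, Linear.smul_comp, Linear.comp_smul]
  rfl

lemma comp_smul (ζ : Circle) {i j l : α.idx} (a : Arrow α i j) (b : Arrow α j l) :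
    comp a (smul ζ b) = smul ζ (comp a b) := by
  refine ext_u ?_
  simp only [compU, smul]
  rw [Linear.smul_comp]
  rfl

lemma smul_smul (ζ ξ : Circle) {i j : α.idx} (a : Arrow α i j) :
    smul ζ (smul ξ a) = smul (ζ * ξ) a := by
  refine ext_u ?_
  rw [Circle.coe_mul, mul_smul]
  rfl

lemma comp_phase (ζ : Circle) {i j : α.idx} (a : Arrow α i j) :
    comp a (smul ζ (id α j)) = smul ζ a := by
  rw [comp_smul, comp_id]

lemma u_ne_zero {i j : α.idx} (a : Arrow α i j) : a.u ≠ 0 := by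
  intro h
  have := a.unitary.comp_dag
  rw [h, Limits.zero_comp] at this
  exact (α.isSimple_e j).id_ne_zero this.symm

lemma exists_smul {i : α.idx} (a : Arrow α i i) (h : a.deg = 1) : ∃ ζ, a = smul ζ (id α i) := by
  obtain ⟨g, u, hu⟩ := a
  dsimp only at h
  subst h
  set t := α.unit.hom.app (α.e i) with ht
  have hw := α.unit_unitary (α.e i)
  obtain ⟨c, hc⟩ := (α.isSimple_e i).exists_smul (u ≫ dag t)
  have huc : u = c • t := by
    have h1 : u = (u ≫ dag t) ≫ t := by
      rw [Category.assoc]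
      exact ((congrArg (u ≫ ·) hw.dag_comp).trans (Category.comp_id u)).symm
    rw [h1, hc, Linear.smul_comp]
    exact congrArg (c • ·) (Category.id_comp t)
  have hcc : c * conj c = 1 := by
    have h1 := hu.comp_dag
    rw [huc, dag_smul, Linear.smul_comp, Linear.comp_smul, _root_.smul_smul] at h1
    have h2 : (c * conj c) • 𝟙 (α.e i) = (1 : ℂ) • 𝟙 (α.e i) := by
      rw [one_smul]
      exact (congrArg ((c * conj c) • ·) hw.comp_dag).symm.trans h1
    exact smul_left_injective ℂ (α.isSimple_e i).id_ne_zero h2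
  have hmem : c ∈ Submonoid.unitSphere ℂ := by
    rw [Complex.mul_conj, Complex.ofReal_eq_one, Complex.normSq_eq_norm_sq] at hcc
    refine mem_sphere_zero_iff_norm.2 ?_
    nlinarith [norm_nonneg c]
  exact ⟨⟨c, hmem⟩, ext_u huc⟩

end Arrow

lemma k_aux {i j : α.idx} (a : Arrow α i j) :
    homIp (𝟙 (α.e j)) (𝟙 (α.e j)) = homIp (𝟙 (α.e i)) (𝟙 (α.e i)) := by
  have h1 := homIp_comp_unitary (𝟙 (α.e j)) (𝟙 (α.e j)) a.unitary
  have h2 := homIp_unitary_comp a.unitary (𝟙 _) (𝟙 _)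
  rw [← α.act_isometry a.deg (𝟙 (α.e i)), CategoryTheory.Functor.map_id, ← h2, ← h1, Category.comp_id, Category.id_comp]

/-- The gerbe of a marked unitary 2-representation. -/
def gerbe : Gerbe.{w, u} G where
  pt := α.idx
  action := α.mulAction
  groupoid :=
    { Hom := Arrow α
      id := Arrow.id α
      comp := Arrow.comp
      inv := Arrow.inv
      id_comp := Arrow.id_comp
      comp_id := Arrow.comp_id
      assoc := Arrow.assoc
      inv_comp := Arrow.inv_comp
      comp_inv := Arrow.comp_inv }
  deg a := Arrow.deg a
  deg_smul a := α.smulIdx_eq (Arrow.unitary a).iso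
  deg_comp _ _ := rfl
  deg_full g i := by
    obtain ⟨f⟩ := α.smulIdx_iso g i
    obtain ⟨u, hu⟩ := (α.isSimple_e _).exists_unitary f
    exact ⟨⟨g, u, hu⟩, rfl⟩
  phase ζ i := Arrow.smul ζ (Arrow.id α i)
  phase_mul ζ ξ i := by
    refine Eq.trans ?_ (Arrow.smul_comp ζ (Arrow.id α i) (Arrow.smul ξ (Arrow.id α i))).symm
    rw [Arrow.comp_smul, Arrow.smul_smul, Arrow.id_comp]
  phase_injective i ζ ξ h := by
    have h1 : (ζ : ℂ) • (Arrow.id α i).u = (ξ : ℂ) • (Arrow.id α i).u := by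
      have := (Arrow.mk.injEq ..).mp h
      exact eq_of_heq this.2
    exact Circle.ext (smul_left_injective ℂ (Arrow.u_ne_zero _) h1)
  deg_phase _ _ := rfl
  exists_phase a h := Arrow.exists_smul a h
  phase_comm ζ i j a := by
    refine (Arrow.smul_comp ζ (Arrow.id α i) a).trans ?_
    refine Eq.trans ?_ (Arrow.comp_smul ζ a (Arrow.id α j)).symm
    rw [Arrow.id_comp, Arrow.comp_id]
  k i := (homIp (𝟙 (α.e i)) (𝟙 (α.e i))).re
  k_pos i := homIp_self_pos (α.isSimple_e i).id_ne_zero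
  k_smul g i := by
    obtain ⟨f⟩ := α.smulIdx_iso g i
    obtain ⟨u, hu⟩ := (α.isSimple_e _).exists_unitary f
    exact congrArg Complex.re (α.k_aux ⟨g, u, hu⟩)

end MarkedTwoRep

/-! ## Morphisms of gerbes from intertwiners -/

namespace Intertwiner

variable {G : Type w} [Group G] {α β γ : MarkedTwoRep.{w, v, u} G} (σ : Intertwiner α β)

/-- For `v : e_{μ'} ⟶ β_g (e_μ)` and `u : e_{i'} ⟶ α_g (e_i)`, the map
`Hom (e_μ, σ (e_i)) → Hom (e_{μ'}, σ (e_{i'}))`, `λ ↦ σ(u)^* ∘ σ(g)_{e_i} ∘ β_g(λ) ∘ v`. -/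
def fiberMap {g : G} {μ μ' : β.idx} {i i' : α.idx} (v : β.e μ' ⟶ (β.act g).obj (β.e μ))
    (u : α.e i' ⟶ (α.act g).obj (α.e i)) :
    (β.e μ ⟶ σ.functor.obj (α.e i)) →ₗ[ℂ] (β.e μ' ⟶ σ.functor.obj (α.e i')) where
  toFun f := v ≫ (β.act g).map f ≫ (σ.comm g).hom.app (α.e i) ≫ dag (σ.functor.map u)
  map_add' f f' := by
    rw [(β.act_star g).map_add, Preadditive.add_comp, Preadditive.comp_add]
  map_smul' c f := by
    rw [(β.act_star g).map_smul, Linear.smul_comp, Linear.comp_smul, RingHom.id_apply]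

lemma fiberMap_apply {g : G} {μ μ' : β.idx} {i i' : α.idx}
    (v : β.e μ' ⟶ (β.act g).obj (β.e μ)) (u : α.e i' ⟶ (α.act g).obj (α.e i))
    (f : β.e μ ⟶ σ.functor.obj (α.e i)) :
    σ.fiberMap v u f =
      v ≫ (β.act g).map f ≫ (σ.comm g).hom.app (α.e i) ≫ dag (σ.functor.map u) := rfl

lemma fiberMap_unit (μ : β.idx) (i : α.idx) :
    σ.fiberMap (β.unit.hom.app (β.e μ)) (α.unit.hom.app (α.e i)) = LinearMap.id := by
  refine LinearMap.ext fun f => ?_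
  rw [fiberMap_apply, LinearMap.id_apply]
  have h1 := β.unit.hom.naturality f
  have h2 := σ.comm_unit (α.e i)
  have h3 := (σ.star.map_unitary (α.unit_unitary (α.e i))).comp_dag
  simp only [Functor.id_map] at h1
  erw [← reassoc_of% h1, reassoc_of% h2, h3, Category.comp_id]

lemma fiberMap_comp {g₁ g₂ g : G} (h : g₂ * g₁ = g) {μ μ' μ'' : β.idx} {i i' i'' : α.idx}
    (v₁ : β.e μ' ⟶ (β.act g₁).obj (β.e μ)) (v₂ : β.e μ'' ⟶ (β.act g₂).obj (β.e μ'))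
    (u₁ : α.e i' ⟶ (α.act g₁).obj (α.e i)) (u₂ : α.e i'' ⟶ (α.act g₂).obj (α.e i')) :
    σ.fiberMap (MarkedTwoRep.Arrow.compU h v₁ v₂) (MarkedTwoRep.Arrow.compU h u₁ u₂) =
      σ.fiberMap v₂ u₂ ∘ₗ σ.fiberMap v₁ u₁ := by
  refine LinearMap.ext fun f => ?_
  rw [LinearMap.comp_apply, fiberMap_apply, fiberMap_apply, fiberMap_apply]
  have hb := (β.mul g₂ g₁ g h).hom.naturality f
  have hc := σ.comm_mul g₂ g₁ g h (α.e i)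
  have hs := (σ.comm g₂).hom.naturality (dag u₁)
  have hm := (σ.star.map_unitary (α.mul_unitary g₂ g₁ g h (α.e i))).comp_dag
  simp only [Functor.comp_map] at hb hs
  rw [σ.star.map_dag, (α.act_star g₂).map_dag, σ.star.map_dag] at hs
  simp only [MarkedTwoRep.Arrow.compU, Functor.map_comp, dag_comp, Category.assoc]
  erw [← reassoc_of% hb, reassoc_of% hc, reassoc_of% hm, reassoc_of% hs]

lemma homIp_fiberMap {g : G} {μ μ' : β.idx} {i i' : α.idx}
    {v : β.e μ' ⟶ (β.act g).obj (β.e μ)} {u : α.e i' ⟶ (α.act g).obj (α.e i)}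
    (hv : IsUnitary v) (hu : IsUnitary u) (f f' : β.e μ ⟶ σ.functor.obj (α.e i)) :
    homIp (σ.fiberMap v u f) (σ.fiberMap v u f') = homIp f f' := by
  have h1 := (σ.comm_unitary g (α.e i)).comp (σ.star.map_unitary hu).dag
  rw [fiberMap_apply, fiberMap_apply, homIp_unitary_comp hv]
  exact (homIp_comp_unitary _ _ h1).trans (β.act_isometry g f f')

lemma fiberMap_smul_left {g : G} {μ μ' : β.idx} {i i' : α.idx} (c : ℂ)
    (v : β.e μ' ⟶ (β.act g).obj (β.e μ)) (u : α.e i' ⟶ (α.act g).obj (α.e i)) :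
    σ.fiberMap (c • v) u = c • σ.fiberMap v u := by
  refine LinearMap.ext fun f => ?_
  rw [LinearMap.smul_apply, fiberMap_apply, fiberMap_apply, Linear.smul_comp]

lemma fiberMap_smul_right {g : G} {μ μ' : β.idx} {i i' : α.idx} (c : ℂ)
    (v : β.e μ' ⟶ (β.act g).obj (β.e μ)) (u : α.e i' ⟶ (α.act g).obj (α.e i)) :
    σ.fiberMap v (c • u) = conj c • σ.fiberMap v u := by
  refine LinearMap.ext fun f => ?_
  rw [LinearMap.smul_apply, fiberMap_apply, fiberMap_apply, σ.star.map_smul, dag_smul]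
  simp only [Linear.comp_smul]

/-- The map `Hom (e_μ, σ (e_i)) → Hom (e_{μ'}, σ (e_{i'}))` attached to a pair of arrows of the
same degree. -/
def arrowMap : {μ μ' : β.idx} → {i i' : α.idx} → (b : β.Arrow μ μ') → (a : α.Arrow i i') →
    b.deg = a.deg →
      (homHilb (β.e μ) (σ.functor.obj (α.e i)) →ₗ[ℂ] homHilb (β.e μ') (σ.functor.obj (α.e i')))
  | _, _, _, _, ⟨_, v, _⟩, ⟨_, u, _⟩, rfl => σ.fiberMap v u

lemma arrowMap_mk {g : G} {μ μ' : β.idx} {i i' : α.idx}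
    {v : β.e μ' ⟶ (β.act g).obj (β.e μ)} {u : α.e i' ⟶ (α.act g).obj (α.e i)}
    (hv : IsUnitary v) (hu : IsUnitary u) :
    σ.arrowMap ⟨g, v, hv⟩ ⟨g, u, hu⟩ rfl = σ.fiberMap v u := rfl

section arrowMap

variable {μ μ' μ'' : β.idx} {i i' i'' : α.idx} (b : β.Arrow μ μ') (a : α.Arrow i i')
  (h : b.deg = a.deg)

lemma arrowMap_comp (b' : β.Arrow μ' μ'') (a' : α.Arrow i' i'') (h' : b'.deg = a'.deg)
    (h'' : (b.comp b').deg = (a.comp a').deg) :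
    σ.arrowMap (b.comp b') (a.comp a') h'' = σ.arrowMap b' a' h' ∘ₗ σ.arrowMap b a h := by
  obtain ⟨g, v, hv⟩ := b
  obtain ⟨_, u, hu⟩ := a
  obtain ⟨g', v', hv'⟩ := b'
  obtain ⟨_, u', hu'⟩ := a'
  dsimp only at h h'
  subst h h'
  exact σ.fiberMap_comp rfl v v' u u'

lemma homIp_arrowMap (f f' : β.e μ ⟶ σ.functor.obj (α.e i)) :
    Hilb.ip (σ.arrowMap b a h f) (σ.arrowMap b a h f') = homIp f f' := by
  obtain ⟨g, v, hv⟩ := b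
  obtain ⟨_, u, hu⟩ := a
  dsimp only at h
  subst h
  exact σ.homIp_fiberMap hv hu f f'

lemma arrowMap_smul_left (ζ : Circle) (b' : β.Arrow μ μ') (hb : b' = MarkedTwoRep.Arrow.smul ζ b)
    (h' : b'.deg = a.deg) : σ.arrowMap b' a h' = (ζ : ℂ) • σ.arrowMap b a h := by
  subst hb
  obtain ⟨g, v, hv⟩ := b
  obtain ⟨_, u, hu⟩ := a
  dsimp only at h
  subst h
  exact σ.fiberMap_smul_left _ v u

lemma arrowMap_smul_right (ζ : Circle) (a' : α.Arrow i i') (ha : a' = MarkedTwoRep.Arrow.smul ζ a)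
    (h' : b.deg = a'.deg) :
    σ.arrowMap b a' h' = ((ζ⁻¹ : Circle) : ℂ) • σ.arrowMap b a h := by
  subst ha
  obtain ⟨g, v, hv⟩ := b
  obtain ⟨_, u, hu⟩ := a
  dsimp only at h
  subst h
  rw [Circle.coe_inv_eq_conj]
  exact σ.fiberMap_smul_right _ v u

end arrowMap

/-- The morphism of gerbes `⟨σ⟩` of an intertwiner `σ`, with fibers
`⟨μ | σ | i⟩ = Hom (e_μ, σ (e_i))`. -/
def kernel : Kernel α.gerbe β.gerbe :=
  Kernel.ofAct (X := α.gerbe) (Y := β.gerbe)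
    (fun μ i => homHilb (β.e μ) (σ.functor.obj (α.e i)))
    (fun b a h => σ.arrowMap b a h)
    (fun μ i h => σ.fiberMap_unit μ i)
    (fun b a h b' a' h' h'' => σ.arrowMap_comp b a h b' a' h' h'')
    (fun b a h s t => σ.homIp_arrowMap b a h s t)
    (fun b a h ζ h' => σ.arrowMap_smul_left b a h ζ _ (MarkedTwoRep.Arrow.comp_phase ζ b) h')
    (fun b a h ζ h' => σ.arrowMap_smul_right b a h ζ _ (MarkedTwoRep.Arrow.comp_phase ζ a) h')

variable {σ} {ρ : Intertwiner α β}

lemma arrowMap_comp_app (θ : Hom σ ρ) {μ μ' : β.idx} {i i' : α.idx} (b : β.Arrow μ μ')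
    (a : α.Arrow i i') (h : b.deg = a.deg) (f : β.e μ ⟶ σ.functor.obj (α.e i)) :
    (show β.e μ' ⟶ σ.functor.obj (α.e i') from σ.arrowMap b a h f) ≫ θ.app (α.e i') =
      ρ.arrowMap b a h (f ≫ θ.app (α.e i) : β.e μ ⟶ ρ.functor.obj (α.e i)) := by
  obtain ⟨g, v, hv⟩ := b
  obtain ⟨_, u, hu⟩ := a
  dsimp only at h
  subst h
  change σ.fiberMap v u f ≫ θ.app _ = ρ.fiberMap v u (f ≫ θ.app _)
  rw [fiberMap_apply, fiberMap_apply]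
  have h1 := θ.comm g (α.e i)
  have h2 := θ.naturality (dag u)
  rw [σ.star.map_dag, ρ.star.map_dag] at h2
  simp only [Category.assoc, Functor.map_comp]
  erw [h2, reassoc_of% h1]

/-- The morphism of vector bundles `⟨θ⟩` of a 2-morphism `θ`, given by postcomposition with the
components of `θ`. -/
def Hom.kernelHom (θ : Hom σ ρ) : σ.kernel ⟶ ρ.kernel :=
  Kernel.homOfAct (X := α.gerbe) (Y := β.gerbe)
    (fun μ i =>
      ({ toFun := fun f => f ≫ θ.app (α.e i)
         map_add' := fun f f' => Preadditive.add_comp _ _ _ f f' _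
         map_smul' := fun c f => Linear.smul_comp _ _ _ c f _ } :
        (β.e μ ⟶ σ.functor.obj (α.e i)) →ₗ[ℂ] (β.e μ ⟶ ρ.functor.obj (α.e i))))
    (fun b a h f => arrowMap_comp_app θ b a h f)

/-- The vector underlying a morphism `e_μ ⟶ σ (e_i)`. -/
def vec {μ : β.idx} {i : α.idx} (f : β.e μ ⟶ σ.functor.obj (α.e i)) :
    Kernel.fiber (X := α.gerbe) (Y := β.gerbe) σ.kernel μ i := f

end Intertwiner

open Intertwiner in
/-- The assignment `α ↦ X_α`, `σ ↦ ⟨σ⟩`, `θ ↦ ⟨θ⟩` on objects, morphisms and 2-morphisms. -/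
def extraction (G : Type w) [Group G] :
    PrelaxFunctorStruct (MarkedTwoRep.{w, v, u} G) (Gerbe.{w, u} G) where
  obj α := α.gerbe
  map σ := Intertwiner.kernel σ
  map₂ θ := Intertwiner.Hom.kernelHom θ

/-! ## Weak 2-functors and equivalences of 2-categories -/

/-- The structure of a weak 2-functor on given assignments `P` on objects, morphisms and
2-morphisms: compositors and unit isomorphisms satisfying the usual axioms. -/
structure WeakTwoFunctorStructure {B : Type*} [Bicategory B] {C : Type*} [Bicategory C]
    (P : PrelaxFunctorStruct B C) where
  map₂_id : ∀ {a b : B} (f : a ⟶ b), P.map₂ (𝟙 f) = 𝟙 (P.map f)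
  map₂_comp : ∀ {a b : B} {f g h : a ⟶ b} (η : f ⟶ g) (θ : g ⟶ h),
    P.map₂ (η ≫ θ) = P.map₂ η ≫ P.map₂ θ
  mapId (a : B) : P.map (𝟙 a) ≅ 𝟙 (P.obj a)
  mapComp {a b c : B} (f : a ⟶ b) (g : b ⟶ c) : P.map (f ≫ g) ≅ P.map f ≫ P.map g
  map₂_whisker_left : ∀ {a b c : B} (f : a ⟶ b) {g h : b ⟶ c} (η : g ⟶ h),
    P.map₂ (f ◁ η) = (mapComp f g).hom ≫ P.map f ◁ P.map₂ η ≫ (mapComp f h).inv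
  map₂_whisker_right : ∀ {a b c : B} {f g : a ⟶ b} (η : f ⟶ g) (h : b ⟶ c),
    P.map₂ (η ▷ h) = (mapComp f h).hom ≫ P.map₂ η ▷ P.map h ≫ (mapComp g h).inv
  map₂_associator : ∀ {a b c d : B} (f : a ⟶ b) (g : b ⟶ c) (h : c ⟶ d),
    P.map₂ (α_ f g h).hom = (mapComp (f ≫ g) h).hom ≫ (mapComp f g).hom ▷ P.map h ≫
      (α_ (P.map f) (P.map g) (P.map h)).hom ≫ P.map f ◁ (mapComp g h).inv ≫
      (mapComp f (g ≫ h)).inv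
  map₂_left_unitor : ∀ {a b : B} (f : a ⟶ b),
    P.map₂ (λ_ f).hom = (mapComp (𝟙 a) f).hom ≫ (mapId a).hom ▷ P.map f ≫ (λ_ (P.map f)).hom
  map₂_right_unitor : ∀ {a b : B} (f : a ⟶ b),
    P.map₂ (ρ_ f).hom = (mapComp f (𝟙 b)).hom ≫ P.map f ◁ (mapId b).hom ≫ (ρ_ (P.map f)).hom

/-- The weak 2-functor given by such a structure. -/
def WeakTwoFunctorStructure.toPseudofunctor {B : Type*} [Bicategory B] {C : Type*}
    [Bicategory C] {P : PrelaxFunctorStruct B C} (W : WeakTwoFunctorStructure P) :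
    Pseudofunctor B C where
  toPrelaxFunctorStruct := P
  map₂_id := W.map₂_id
  map₂_comp := W.map₂_comp
  mapId := W.mapId
  mapComp := W.mapComp
  map₂_whisker_left := W.map₂_whisker_left
  map₂_whisker_right := W.map₂_whisker_right
  map₂_associator := W.map₂_associator
  map₂_left_unitor := W.map₂_left_unitor
  map₂_right_unitor := W.map₂_right_unitor

/-- A weak 2-functor is an equivalence of 2-categories if it is surjective on objects up to
equivalence, and an equivalence on each hom-category. -/
structure IsEquivalenceOfTwoCategories {B : Type*} [Bicategory B] {C : Type*} [Bicategory C]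
    (F : Pseudofunctor B C) : Prop where
  essentiallySurjective : ∀ c : C, ∃ b : B, Nonempty (Bicategory.Equivalence (F.obj b) c)
  local_isEquivalence : ∀ a b : B, (F.mapFunctor a b).IsEquivalence

end

end TwoRepGerbe

open TwoRepGerbe

namespace TwoRepGerbe

noncomputable section

/-! ## Finite-dimensional Hilbert spaces -/

namespace Hilb

variable {V W : Hilb.{u}}

/-! A finite-dimensional 2-Hilbert space is semisimple, so an object `a` is known through the
Hilbert spaces Hom(e_i, a), and all the data of the theorem can be read off there. Semisimplicity
starts from `exists_isIdempotent`: when End(a) contains a non-scalar, orthogonal projection of the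
identity onto a proper nonzero one-sided ideal is a nontrivial idempotent. Splitting idempotents
repeatedly shows that every nonzero morphism is detected by a morphism from some e_i
(`exists_comp_ne_zero`). With Schur's lemma this gives `exists_frame`: morphisms q : e_i → a with
q^* q' = δ and ∑ q q^* = id. Consequently morphisms a → b are the same as families of linear maps
Hom(e_i, a) → Hom(e_i, b) (`comp_ofLinear`, `hom_ext_e`), and every family of Hilbert spaces is
isometric to that of some object (`exists_object`).

The 2-functor: for a linear *-functor F the composition map from ⊕_μ Hom(x, F e_μ) ⊗ Hom(e_μ, S) to
Hom(x, F S) is bijective, with inverse given by a frame of S (`convMap_bijective`). This makes the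
compositors invertible. Their coherence is checked on pure tensors, where it is functoriality of
composition and naturality of modifications.

Equivalence on 2-morphisms: a 2-morphism ⟨σ⟩ ⇒ ⟨ρ⟩ prescribes the components at the simple objects.
Frames extend them uniquely to a natural transformation, and equivariance under pairs of arrows
becomes the intertwining condition (`extendHom_comm`). Unitarity is the trace formula (f, f') = ∑
k_i Tr(f_i^* f'_i), where f_i is composition with f on Hom(e_i, a) (`sum_traceAdjMul`).

Surjectivity on morphisms: for a bundle E, let σ(a) be an object with Hom(e_μ, σ(a)) = ⊕_i (1/k_i)
⟨μ|E|i⟩ ⊗ Hom(e_i, a). The rule s ⊗ x ↦ E(v ⊗ u) s ⊗ α_g(x) u does not depend on the unitary u,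
because U(1) acts conjugate-linearly through u on the first factor and linearly on the second
(`trans_tm`). It supplies the isomorphisms σ(g) (`commHom`), and s ↦ s ⊗ id identifies E with ⟨σ⟩
(`liftIso`).

Surjectivity on objects: choose one arrow of the gerbe for each degree and pair of endpoints. The
failure of these choices to compose is a U(1)-valued cocycle `mulPhase`. Families of matrices over
the points form a 2-Hilbert space, on which G acts by permuting the points, with the cocycle as
coherence data (`modelTwoRep`). Its objects are functions from a finite set to ℕ, a countable
collection, so they fit into any universe. Its gerbe is strictly isomorphic to the given one
(`modelEquiv`), and a strict isomorphism yields an equivalence given by line bundles supported on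
its graph (`nonempty_equivalence`). -/

lemma exists_orthogonal_decomposition (I : Submodule ℂ V) (x : V) :
    ∃ y ∈ I, ∃ z : V, (∀ t ∈ I, ip t z = 0) ∧ x = y + z := by
  let _ : NormedAddCommGroup V := V.core.toNormedAddCommGroup
  let _ : InnerProductSpace ℂ V := InnerProductSpace.ofCore V.core.toCore
  obtain ⟨y, hy, z, hz, h⟩ := I.exists_add_mem_mem_orthogonal x
  exact ⟨y, hy, z, fun t ht => (Submodule.mem_orthogonal I z).1 hz t ht, h⟩

lemma exists_orthonormal_basis (V : Hilb.{u}) :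
    ∃ b : Module.Basis (Fin (Module.finrank ℂ V)) ℂ V,
      ∀ m n, ip (b m) (b n) = if m = n then 1 else 0 := by
  let _ : NormedAddCommGroup V := V.core.toNormedAddCommGroup
  let _ : InnerProductSpace ℂ V := InnerProductSpace.ofCore V.core.toCore
  refine ⟨(stdOrthonormalBasis ℂ V).toBasis, fun m n => ?_⟩
  rw [OrthonormalBasis.coe_toBasis]
  exact orthonormal_iff_ite.1 (stdOrthonormalBasis ℂ V).orthonormal m n

/-- This form of the trace pairing makes it comparable with inner products of composites, where
frames supply the basis. -/
lemma traceAdjMul_eq_sum {ι : Type*} [Fintype ι] [DecidableEq ι] (b : Module.Basis ι ℂ V)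
    (hb : ∀ m n, ip (b m) (b n) = if m = n then 1 else 0) (f g : V →ₗ[ℂ] W) :
    traceAdjMul f g = ∑ n, ip (f (b n)) (g (b n)) := by
  let _ : NormedAddCommGroup V := V.core.toNormedAddCommGroup
  let _ : InnerProductSpace ℂ V := InnerProductSpace.ofCore V.core.toCore
  let _ : NormedAddCommGroup W := W.core.toNormedAddCommGroup
  let _ : InnerProductSpace ℂ W := InnerProductSpace.ofCore W.core.toCore
  have ho : Orthonormal ℂ b := orthonormal_iff_ite.2 hb
  rw [traceAdjMul, LinearMap.trace_eq_sum_inner _ (b.toOrthonormalBasis ho)]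
  refine Finset.sum_congr rfl fun n _ => ?_
  rw [LinearMap.comp_apply, LinearMap.adjoint_inner_right, Module.Basis.coe_toOrthonormalBasis]
  rfl

lemma ip_sum_left {ι : Type*} (s : Finset ι) (f : ι → V) (x : V) :
    ip (∑ n ∈ s, f n) x = ∑ n ∈ s, ip (f n) x := by
  classical
  induction s using Finset.induction_on with
  | empty => simp [ip_zero_left]
  | insert a s ha ih => rw [Finset.sum_insert ha, Finset.sum_insert ha, ip_add_left, ih]

lemma ip_sum_right {ι : Type*} (s : Finset ι) (f : ι → V) (x : V) :
    ip x (∑ n ∈ s, f n) = ∑ n ∈ s, ip x (f n) := by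
  rw [← ip_conj, ip_sum_left, map_sum]
  simp only [ip_conj]

lemma eq_zero_of_ip_self {x : V} (h : ip x x = 0) : x = 0 := V.core.definite x h

lemma eq_of_ip_left {x y : V} (h : ∀ z, ip x z = ip y z) : x = y := by
  have h1 : ip (x + (-1 : ℂ) • y) (x + (-1 : ℂ) • y) = 0 := by
    rw [ip_add_left, ip_smul_left, h]
    simp
  have h2 := eq_zero_of_ip_self h1
  rw [neg_one_smul, add_neg_eq_zero] at h2
  exact h2

lemma exists_isometry (h : Module.finrank ℂ V = Module.finrank ℂ W) :
    ∃ J : V ≃ₗ[ℂ] W, ∀ x y, ip (J x) (J y) = ip x y := by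
  obtain ⟨b, hb⟩ := exists_orthonormal_basis V
  obtain ⟨c, hc⟩ := exists_orthonormal_basis W
  refine ⟨b.equiv c (finCongr h), fun x y => ?_⟩
  rw [← b.sum_repr x, ← b.sum_repr y]
  simp only [map_sum, map_smul, ip_sum_left, ip_sum_right, ip_smul_left, ip_smul_right,
    Module.Basis.equiv_apply, hb, hc, (finCongr h).injective.eq_iff]

end Hilb

/-! ## Semisimplicity of 2-Hilbert spaces -/

section HStar

variable {H : Type v} [Category.{u} H] [Preadditive H] [Linear ℂ H] [HStarCategory H]

instance finite_hom (a b : H) : Module.Finite ℂ (a ⟶ b) := HStarCategory.finite a b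

lemma homIp_smul_right {a b : H} (r : ℂ) (f g : a ⟶ b) : homIp f (r • g) = r * homIp f g :=
  Hilb.ip_smul_right (V := homHilb a b) r f g

lemma homIp_sum_left {a b : H} {ι : Type*} (s : Finset ι) (f : ι → (a ⟶ b)) (g : a ⟶ b) :
    homIp (∑ n ∈ s, f n) g = ∑ n ∈ s, homIp (f n) g :=
  Hilb.ip_sum_left (V := homHilb a b) s f g

lemma homIp_zero_right {a b : H} (f : a ⟶ b) : homIp f (0 : a ⟶ b) = 0 :=
  Hilb.ip_zero_right (V := homHilb a b) f

lemma eq_zero_of_homIp_self {a b : H} {f : a ⟶ b} (h : homIp f f = 0) : f = 0 :=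
  Hilb.eq_zero_of_ip_self (V := homHilb a b) h

/-- The source of all decompositions. Over ℂ, composition with `f` has an eigenvalue `c`, and the
eigenspace is a one-sided ideal of End(a). It is nonzero, and it is proper since `f` is not the
scalar `c`. Compatibility of the inner product with the adjoint makes the projection of the identity
onto this ideal a right unit for it, hence idempotent. -/
lemma exists_isIdempotent {a : H} (f : a ⟶ a) (hf : ∀ c : ℂ, f ≠ c • 𝟙 a) :
    ∃ p : a ⟶ a, p ≫ p = p ∧ p ≠ 0 ∧ p ≠ 𝟙 a := by
  have : Nontrivial (a ⟶ a) := ⟨⟨f, 0, fun h => hf 0 (by rw [h, zero_smul])⟩⟩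
  obtain ⟨c, hc⟩ := Module.End.exists_eigenvalue (K := ℂ) (Linear.rightComp ℂ a f)
  obtain ⟨h, hh, hne⟩ := hc.exists_hasEigenvector
  let I : Submodule ℂ (homHilb a a) := LinearMap.ker (Linear.rightComp ℂ a (f - c • 𝟙 a))
  have memI : ∀ k : a ⟶ a, k ∈ I ↔ k ≫ f = c • k := fun k => by
    change k ≫ (f - c • 𝟙 a) = 0 ↔ _
    rw [Preadditive.comp_sub, Linear.comp_smul, Category.comp_id, sub_eq_zero]
  have hI : h ∈ I := (memI h).2 (Module.End.mem_eigenspace_iff.1 hh)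
  have hmul : ∀ k l : a ⟶ a, l ∈ I → k ≫ l ∈ I := fun k l hl => by
    rw [memI] at hl ⊢
    rw [Category.assoc, hl, Linear.comp_smul]
  obtain ⟨p, hp, z, hz, h1⟩ := Hilb.exists_orthogonal_decomposition I (𝟙 a)
  change a ⟶ a at p z
  replace h1 : 𝟙 a = p + z := h1
  -- `l ≫ z` lies in the ideal, being `l - l ≫ p`. Its norm squared is the pairing of `z` with `dag
  -- l ≫ l ≫ z`, again in the ideal, and `z` is orthogonal to the ideal.
  have hz' : ∀ l : a ⟶ a, l ∈ I → l ≫ z = 0 := fun l hl => by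
    have h2 : l ≫ z = l - l ≫ p := by
      rw [eq_sub_iff_add_eq', ← Preadditive.comp_add, ← h1, Category.comp_id]
    have h3 : l ≫ z ∈ I := by
      rw [h2]; exact I.sub_mem hl (hmul l p hp)
    refine eq_zero_of_homIp_self ?_
    rw [homIp_comp_left, ← homIp_conj]
    have : homIp (dag l ≫ l ≫ z) z = 0 := hz _ (hmul _ _ h3)
    rw [this, map_zero]
  have hid : ∀ l : a ⟶ a, l ∈ I → l ≫ p = l := fun l hl => by
    rw [← add_zero (l ≫ p), ← hz' l hl, ← Preadditive.comp_add, ← h1, Category.comp_id]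
  refine ⟨p, hid p hp, fun h0 => hne ?_, fun h0 => hf c ?_⟩
  · rw [← hid h hI, h0, Limits.comp_zero]
  · have := (memI p).1 hp
    rwa [h0, Category.id_comp] at this

lemma exists_orthonormal_basis_hom (a b : H) :
    ∃ q : Module.Basis (Fin (Module.finrank ℂ (a ⟶ b))) ℂ (a ⟶ b),
      ∀ m n, homIp (q m) (q n) = if m = n then 1 else 0 :=
  Hilb.exists_orthonormal_basis (homHilb a b)

omit [HStarCategory H] in
lemma IsSimple.of_forall_smul {a : H} (h0 : 𝟙 a ≠ 0) (h : ∀ f : a ⟶ a, ∃ c : ℂ, f = c • 𝟙 a) :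
    IsSimple a :=
  (finrank_eq_one_iff_of_nonzero' (𝟙 a) h0).2 fun f => (h f).imp fun _ h => h.symm

end HStar

namespace MarkedTwoHilb

variable (H : MarkedTwoHilb.{v, u})

/-- Induction on dim End(a). If `a` is not simple, a nontrivial idempotent splits it into two
objects with smaller endomorphism algebras, and `f` does not vanish on both. -/
lemma exists_comp_ne_zero {a b : H.carrier} (f : a ⟶ b) (hf : f ≠ 0) :
    ∃ (i : H.idx) (q : H.e i ⟶ a), q ≫ f ≠ 0 := by
  induction hn : Module.finrank ℂ (a ⟶ a) using Nat.strong_induction_on generalizing a with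
  | _ n ih =>
  subst hn
  have h0 : 𝟙 a ≠ 0 := fun h => hf (by rw [← Category.id_comp f, h, Limits.zero_comp])
  by_cases hs : IsSimple a
  · obtain ⟨i, ⟨φ⟩⟩ := H.exists_iso_e a hs
    refine ⟨i, φ.inv, fun h => hf ?_⟩
    rw [← φ.hom_inv_id_assoc f, h, Limits.comp_zero]
  · have : ∃ g : a ⟶ a, ∀ c : ℂ, g ≠ c • 𝟙 a := by
      by_contra! hc
      exact hs (IsSimple.of_forall_smul h0 hc)
    obtain ⟨g, hg⟩ := this
    obtain ⟨p, hpp, hp0, hp1⟩ := exists_isIdempotent g hg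
    have key : ∀ p : a ⟶ a, p ≫ p = p → p ≠ 𝟙 a → p ≫ f ≠ 0 →
        ∃ (i : H.idx) (q : H.e i ⟶ a), q ≫ f ≠ 0 := by
      intro p hpp hp1 hpf
      obtain ⟨c, s, r, hsr, hrs⟩ := H.isIdempotentComplete.idempotents_split a p hpp
      have hsf : s ≫ f ≠ 0 := fun h => hpf (by rw [← hrs, Category.assoc, h, Limits.comp_zero])
      -- End(c) embeds as the corner of End(a) cut out by `p`. The identity of `a` lies in this
      -- corner only if `p` is the identity, so the dimension drops strictly.
      let L : (c ⟶ c) →ₗ[ℂ] (a ⟶ a) := Linear.leftComp ℂ a r ∘ₗ Linear.rightComp ℂ c s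
      have hL : ∀ h, L h = r ≫ h ≫ s := fun h => rfl
      have hinj : Function.Injective L := fun h h' hh => by
        rw [hL, hL] at hh
        have := congrArg (fun t => s ≫ t ≫ r) hh
        simpa [hsr, reassoc_of% hsr] using this
      have hlt : Module.finrank ℂ (c ⟶ c) < Module.finrank ℂ (a ⟶ a) := by
        rw [← LinearMap.finrank_range_of_inj hinj]
        refine Submodule.finrank_lt fun htop => hp1 ?_
        obtain ⟨h, hh⟩ : 𝟙 a ∈ LinearMap.range L := htop ▸ Submodule.mem_top
        rw [hL] at hh
        rw [← Category.id_comp p, ← hh, ← hrs]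
        simp [reassoc_of% hsr]
      obtain ⟨i, q, hq⟩ := ih _ hlt (s ≫ f) hsf rfl
      exact ⟨i, q ≫ s, by rwa [Category.assoc]⟩
    -- One of the complementary idempotents `p` and `𝟙 a - p` has nonzero composite with `f`.
    by_cases hpf : p ≫ f = 0
    · refine key (𝟙 a - p) ?_ ?_ ?_
      · simp [Preadditive.sub_comp, Preadditive.comp_sub, hpp]
      · intro h
        exact hp0 (by simpa using h)
      · rw [Preadditive.sub_comp, hpf, sub_zero, Category.id_comp]
        exact hf
    · exact key p hpp hp1 hpf

variable {H}

/-- Schur's lemma. -/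
lemma hom_eq_zero {i j : H.idx} (hij : i ≠ j) (f : H.e i ⟶ H.e j) : f = 0 := by
  by_contra hf
  have h1 : f ≫ dag f ≠ 0 := fun h => hf (eq_zero_of_homIp_self (by
    rw [← Category.id_comp f, homIp_comp_right, Category.id_comp, h, homIp_zero_right]))
  obtain ⟨c, hc⟩ := (H.isSimple_e i).exists_smul (f ≫ dag f)
  obtain ⟨d, hd⟩ := (H.isSimple_e j).exists_smul (dag f ≫ f)
  have hc0 : c ≠ 0 := fun h => h1 (by rw [hc, h, zero_smul])
  -- The two scalars given by composing `f` with its adjoint in either order agree by associativity,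
  -- so a multiple of `dag f` inverts `f`.
  have hcd : c = d := by
    have h2 : c • f = d • f := by
      have := Category.assoc f (dag f) f
      rwa [hc, hd, Linear.smul_comp, Linear.comp_smul, Category.id_comp, Category.comp_id] at this
    exact smul_left_injective ℂ hf h2
  refine hij (H.e_injective i j ⟨⟨f, c⁻¹ • dag f, ?_, ?_⟩⟩)
  · rw [Linear.comp_smul, hc, smul_smul, inv_mul_cancel₀ hc0, one_smul]
  · rw [Linear.smul_comp, hd, ← hcd, smul_smul, inv_mul_cancel₀ hc0, one_smul]

lemma hom_ext_e {a b : H.carrier} {f g : a ⟶ b}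
    (h : ∀ (i : H.idx) (q : H.e i ⟶ a), q ≫ f = q ≫ g) : f = g := by
  by_contra hfg
  obtain ⟨i, q, hq⟩ := H.exists_comp_ne_zero (f - g) (sub_ne_zero.2 hfg)
  exact hq (by rw [Preadditive.comp_sub, h, sub_self])

variable (H) in
/-- The norm squared of the identity of `e i`. -/
def kc (i : H.idx) : ℝ := (homIp (𝟙 (H.e i)) (𝟙 (H.e i))).re

variable (H) in
lemma kc_pos (i : H.idx) : 0 < H.kc i := homIp_self_pos (H.isSimple_e i).id_ne_zero

variable (H) in
lemma homIp_id (i : H.idx) : homIp (𝟙 (H.e i)) (𝟙 (H.e i)) = (H.kc i : ℂ) := homIp_self_eq _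

/-- An orthonormal basis of Hom(e_i, a) is rescaled by √k_i, because the wanted normalization is q^*
q = id and id has norm squared k_i. Completeness need only be tested on Hom(e_i, a), which the
rescaled basis spans. -/
lemma exists_frame (a : H.carrier) :
    ∃ q : (i : H.idx) → Fin (Module.finrank ℂ (H.e i ⟶ a)) → (H.e i ⟶ a),
      (∀ i m n, q i m ≫ dag (q i n) = if m = n then 𝟙 (H.e i) else 0) ∧
      ∑ i, ∑ n, dag (q i n) ≫ q i n = 𝟙 a ∧
      ∀ i, ∃ b : Module.Basis (Fin (Module.finrank ℂ (H.e i ⟶ a))) ℂ (H.e i ⟶ a),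
        (∀ m n, homIp (b m) (b n) = if m = n then 1 else 0) ∧
        ∀ n, q i n = (Real.sqrt (H.kc i) : ℂ) • b n := by
  choose b hb using fun i => exists_orthonormal_basis_hom (H.e i) a
  let q : (i : H.idx) → Fin (Module.finrank ℂ (H.e i ⟶ a)) → (H.e i ⟶ a) :=
    fun i n => (Real.sqrt (H.kc i) : ℂ) • b i n
  have hk : ∀ i, (Real.sqrt (H.kc i) : ℂ) * (Real.sqrt (H.kc i) : ℂ) = H.kc i := fun i => by
    rw [← Complex.ofReal_mul, Real.mul_self_sqrt (H.kc_pos i).le]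
  have hk0 : ∀ i, (H.kc i : ℂ) ≠ 0 := fun i => Complex.ofReal_ne_zero.2 (H.kc_pos i).ne'
  have hs0 : ∀ i, (Real.sqrt (H.kc i) : ℂ) ≠ 0 := fun i h => hk0 i (by rw [← hk, h, zero_mul])
  have hq : ∀ i m n, q i m ≫ dag (q i n) = if m = n then 𝟙 (H.e i) else 0 := by
    intro i m n
    -- The composite is a scalar by simplicity. Pairing it with the identity gives the scalar times
    -- k_i, which is compared with the inner product of the rescaled basis vectors.
    obtain ⟨c, hc⟩ := (H.isSimple_e i).exists_smul (q i m ≫ dag (q i n))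
    have h1 : homIp (q i n) (q i m) = c * H.kc i := by
      rw [← Category.id_comp (q i n), homIp_comp_right, hc, homIp_smul_right, homIp_id]
    have h2 : homIp (q i n) (q i m) = H.kc i * (if n = m then 1 else 0) := by
      rw [← hb i n m, ← hk, homIp_smul_left, homIp_smul_right, Complex.conj_ofReal, mul_assoc]
    rw [hc]
    rw [h1, mul_comm] at h2
    have h3 := mul_left_cancel₀ (hk0 i) h2
    rw [h3]
    by_cases h : m = n
    · simp [h]
    · simp [h, Ne.symm h]
  refine ⟨q, hq, ?_, fun i => ⟨b i, hb i, fun n => rfl⟩⟩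
  have hqq : ∀ i m, q i m ≫ (∑ i, ∑ n, dag (q i n) ≫ q i n) = q i m := by
    intro i m
    rw [Preadditive.comp_sum, Finset.sum_eq_single i, Preadditive.comp_sum,
      Finset.sum_eq_single m]
    · rw [← Category.assoc, hq, if_pos rfl, Category.id_comp]
    · intro n _ hn
      rw [← Category.assoc, hq, if_neg (Ne.symm hn), Limits.zero_comp]
    · simp
    · intro j _ hj
      rw [Preadditive.comp_sum]
      refine Finset.sum_eq_zero fun n _ => ?_
      rw [← Category.assoc, hom_eq_zero (Ne.symm hj) (q i m ≫ dag (q j n)), Limits.zero_comp]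
    · simp
  refine hom_ext_e fun i x => ?_
  rw [Category.comp_id]
  have h1 : Linear.rightComp ℂ (H.e i) (∑ i, ∑ n, dag (q i n) ≫ q i n) =
      (LinearMap.id : (H.e i ⟶ a) →ₗ[ℂ] (H.e i ⟶ a)) := by
    refine (b i).ext fun n => ?_
    have h2 := hqq i n
    simp only [q] at h2
    rw [Linear.smul_comp] at h2
    exact smul_right_injective _ (hs0 i) h2
  exact LinearMap.congr_fun h1 x

/-- A family of morphisms `e i ⟶ a` which exhibits `a` as an orthogonal direct sum of simple
objects. -/
def frame (a : H.carrier) (i : H.idx) (n : Fin (Module.finrank ℂ (H.e i ⟶ a))) : H.e i ⟶ a :=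
  (exists_frame a).choose i n

lemma sum_frame (a : H.carrier) : ∑ i, ∑ n, dag (frame a i n) ≫ frame a i n = 𝟙 a :=
  (exists_frame a).choose_spec.2.1

lemma frame_eq_smul (a : H.carrier) (i : H.idx) :
    ∃ b : Module.Basis (Fin (Module.finrank ℂ (H.e i ⟶ a))) ℂ (H.e i ⟶ a),
      (∀ m n, homIp (b m) (b n) = if m = n then 1 else 0) ∧
      ∀ n, frame a i n = (Real.sqrt (H.kc i) : ℂ) • b n :=
  (exists_frame a).choose_spec.2.2 i

lemma comp_sum_frame {a b : H.carrier} (f : b ⟶ a) :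
    ∑ i, ∑ n, (f ≫ dag (frame a i n)) ≫ frame a i n = f := by
  conv_rhs => rw [← Category.comp_id f, ← sum_frame a]
  simp only [Preadditive.comp_sum, Category.assoc]

lemma sum_frame_comp {a b : H.carrier} (f : a ⟶ b) :
    ∑ i, ∑ n, dag (frame a i n) ≫ frame a i n ≫ f = f := by
  conv_rhs => rw [← Category.id_comp f, ← sum_frame a]
  simp only [Preadditive.sum_comp, Category.assoc]

/-- By Schur's lemma naturality in the simple object is automatic: morphisms between marked simples
are scalars or zero, and linear maps commute with both. -/
lemma map_comp_e {a b : H.carrier} (T : (i : H.idx) → (H.e i ⟶ a) →ₗ[ℂ] (H.e i ⟶ b))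
    {i j : H.idx} (l : H.e i ⟶ H.e j) (q : H.e j ⟶ a) : T i (l ≫ q) = l ≫ T j q := by
  by_cases h : i = j
  · subst h
    obtain ⟨c, rfl⟩ := (H.isSimple_e i).exists_smul l
    rw [Linear.smul_comp, Linear.smul_comp, map_smul, Category.id_comp, Category.id_comp]
  · rw [hom_eq_zero h l, Limits.zero_comp, Limits.zero_comp, map_zero]

/-- The morphism with prescribed action on morphisms out of the simple objects. -/
def ofLinear {a b : H.carrier} (T : (i : H.idx) → (H.e i ⟶ a) →ₗ[ℂ] (H.e i ⟶ b)) : a ⟶ b :=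
  ∑ i, ∑ n, dag (frame a i n) ≫ T i (frame a i n)

/-- Any prescribed family of linear maps is realized by a morphism, and by `hom_ext_e` by only one.
Expanding `q` in the frame used by `ofLinear` reduces this to `map_comp_e`. -/
lemma comp_ofLinear {a b : H.carrier} (T : (i : H.idx) → (H.e i ⟶ a) →ₗ[ℂ] (H.e i ⟶ b))
    {i : H.idx} (q : H.e i ⟶ a) : q ≫ ofLinear T = T i q := by
  conv_rhs => rw [← comp_sum_frame q]
  simp only [ofLinear, Preadditive.comp_sum, map_sum]
  refine Finset.sum_congr rfl fun j _ => Finset.sum_congr rfl fun n _ => ?_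
  rw [map_comp_e T, Category.assoc]

end MarkedTwoHilb

end

end TwoRepGerbe

namespace TwoRepGerbe

noncomputable section

namespace MarkedTwoHilb

variable {H : MarkedTwoHilb.{v, u}}

lemma finrank_hom_e [DecidableEq H.idx] (i j : H.idx) :
    Module.finrank ℂ (H.e i ⟶ H.e j) = if i = j then 1 else 0 := by
  split_ifs with h
  · subst h
    exact H.isSimple_e i
  · have : Subsingleton (H.e i ⟶ H.e j) :=
      ⟨fun f g => by rw [hom_eq_zero h f, hom_eq_zero h g]⟩
    exact Module.finrank_zero_of_subsingleton

/-- Take the biproduct of dim V_i copies of each e_i. By Schur's lemma its spaces of morphisms from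
the simples have the right dimensions, and Hilbert spaces of equal dimension are isometric. The
isometries are arbitrary choices; no naturality is asked of them. -/
lemma exists_object (V : H.idx → Hilb.{u}) :
    ∃ (S : H.carrier) (J : (i : H.idx) → V i ≃ₗ[ℂ] (H.e i ⟶ S)),
      ∀ i x y, homIp (J i x) (J i y) = Hilb.ip x y := by
  classical
  have := H.hasFiniteBiproducts
  let f : (Σ i, Fin (Module.finrank ℂ (V i))) → H.carrier := fun p => H.e p.1
  let L : (i : H.idx) → (H.e i ⟶ ⨁ f) ≃ₗ[ℂ] ((p : _) → (H.e i ⟶ f p)) := fun i =>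
    { toFun := fun h p => h ≫ Limits.biproduct.π f p
      map_add' := fun h h' => by ext; simp
      map_smul' := fun c h => by ext; simp
      invFun := fun h => Limits.biproduct.lift h
      left_inv := fun h => by ext; simp
      right_inv := fun h => by ext; simp }
  have hL : ∀ i, Module.finrank ℂ (V i) = Module.finrank ℂ (homHilb (H.e i) (⨁ f)) := fun i => by
    refine Eq.trans ?_ (L i).finrank_eq.symm
    rw [Module.finrank_pi_fintype, Fintype.sum_sigma, Finset.sum_eq_single i]
    · simp [f, finrank_hom_e]
    · intro j _ hj
      simp [f, finrank_hom_e, Ne.symm hj]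
    · simp
  choose J hJ using fun i => Hilb.exists_isometry (hL i)
  exact ⟨⨁ f, J, hJ⟩

end MarkedTwoHilb

/-! ### Invertible 2-morphisms of gerbes, and morphisms out of the identity bundle -/

namespace Kernel

variable {G : Type w} [Group G] {X Y Z : Gerbe.{w, u} G}

/-- A fiberwise bijective 2-morphism of gerbes is invertible. -/
def isoOfBijective {E F : Kernel X Y} (f : E ⟶ F)
    (hf : ∀ y x, Function.Bijective (app f y x)) : E ≅ F where
  hom := f
  inv := homOfAct (fun y x => (LinearEquiv.ofBijective (app f y x) (hf y x)).symm.toLinearMap)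
    (fun {y y' x x'} a b h s => by
      apply (hf y' x').1
      rw [app_act]
      have h1 : ∀ y x t, app f y x ((LinearEquiv.ofBijective (app f y x) (hf y x)).symm t) = t :=
        fun y x t => (LinearEquiv.ofBijective (app f y x) (hf y x)).apply_symm_apply t
      rw [LinearEquiv.coe_coe, LinearEquiv.coe_coe, h1, h1])
  hom_inv_id := hom_ext fun y x => LinearMap.ext fun s =>
    (LinearEquiv.ofBijective (app f y x) (hf y x)).symm_apply_apply s
  inv_hom_id := hom_ext fun y x => LinearMap.ext fun s =>
    (LinearEquiv.ofBijective (app f y x) (hf y x)).apply_symm_apply s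

lemma act_congr (E : Kernel X Y) {y y' : Y.pt} {x x' : X.pt} {a a' : y ⟶ y'} {b b' : x ⟶ x'}
    (ha : a = a') (hb : b = b') (h : Y.deg a = X.deg b) (h' : Y.deg a' = X.deg b') :
    E.act a b h = E.act a' b' h' := by
  subst ha hb
  rfl

section ofUnit

variable {K : Kernel X X} (k : (x : X.pt) → K.fiber x x)

open Classical in
/-- The component at `(y, x)` of the morphism from the identity with prescribed values. -/
def ofUnitApp (y x : X.pt) : (idKernel X).fiber y x →ₗ[ℂ] K.fiber y x :=
  if h : y = x then
    LinearMap.toSpanSingleton ℂ (K.fiber y x) (h ▸ k y) ∘ₗ (idFiber.val X : idFiber X y x →ₗ[ℂ] ℂ)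
  else 0

lemma ofUnitApp_apply (x : X.pt) (s : (idKernel X).fiber x x) :
    ofUnitApp k x x s = idFiber.val X s • k x := by
  rw [ofUnitApp, dif_pos rfl]
  rfl

/-- The morphism from the identity which maps the basis vectors to a given family of invariant
vectors. -/
def ofUnit (hk : ∀ {x x' : X.pt} (a : x ⟶ x'), K.act a a rfl (k x) = k x') : idKernel X ⟶ K :=
  homOfAct (ofUnitApp k) (fun {y y' x x'} b a h s => by
    by_cases hyx : y = x
    · subst hyx
      obtain rfl := eq_of_deg_eq b a h
      -- On the diagonal the two arrows have the same ends and degree, so `b` is a phase times `a`.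
      -- That phase multiplies both sides, and invariance under the pair (a, a) does the rest.
      obtain ⟨ζ, rfl⟩ := Gerbe.exists_eq_comp_phase a b h.symm
      have h1 : idFiber.val X ((idKernel X).act (a ≫ X.phase ζ y') a h s) =
          (ζ : ℂ) * idFiber.val X s :=
        (val_idAct (a ≫ X.phase ζ y') a h s).trans (by rw [relPhase_phase])
      rw [ofUnitApp_apply, ofUnitApp_apply, map_smul, act_comp_phase_left K a a rfl ζ h,
        LinearMap.smul_apply, hk, h1, smul_smul, mul_comm]
    · have hs : s = 0 := idFiber.eq_zero hyx s
      rw [hs, map_zero, map_zero, map_zero, map_zero])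

lemma ofUnit_app_idOne (hk : ∀ {x x' : X.pt} (a : x ⟶ x'), K.act a a rfl (k x) = k x')
    (x : X.pt) : app (ofUnit k hk) x x (idOne x) = k x := by
  refine (ofUnitApp_apply k x (idOne x)).trans ?_
  exact one_smul ℂ (k x)

/-- The hypotheses say that, like the identity bundle, `K` is supported on the diagonal with fibers
the lines spanned by `k x`. -/
lemma ofUnit_bijective (hk : ∀ {x x' : X.pt} (a : x ⟶ x'), K.act a a rfl (k x) = k x')
    (h0 : ∀ x, k x ≠ 0) (h1 : ∀ y x, y ≠ x → ∀ s : K.fiber y x, s = 0)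
    (h2 : ∀ x (s : K.fiber x x), ∃ c : ℂ, s = c • k x) (y x : X.pt) :
    Function.Bijective (app (ofUnit k hk) y x) := by
  change Function.Bijective (ofUnitApp k y x)
  by_cases hyx : y = x
  · subst hyx
    constructor
    · intro s t hst
      rw [ofUnitApp_apply, ofUnitApp_apply] at hst
      exact idFiber.ext (smul_left_injective ℂ (h0 y) hst)
    · intro s
      obtain ⟨c, rfl⟩ := h2 y s
      refine ⟨c • idOne y, ?_⟩
      rw [map_smul, ofUnitApp_apply]
      exact congrArg (c • ·) (one_smul ℂ (k y))
  · exact ⟨fun s t _ => (idFiber.eq_zero hyx s).trans (idFiber.eq_zero hyx t).symm,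
      fun s => ⟨0, by rw [map_zero, h1 y x hyx s]⟩⟩

end ofUnit

end Kernel

/-! ## The compositors and unit isomorphisms -/

namespace Intertwiner

variable {G : Type w} [Group G] {α β γ δ : MarkedTwoRep.{w, v, u} G}

lemma vec_surjective (σ : Intertwiner α β) {μ : β.idx} {i : α.idx}
    (s : Kernel.fiber (X := α.gerbe) (Y := β.gerbe) σ.kernel μ i) :
    ∃ f : β.e μ ⟶ σ.functor.obj (α.e i), σ.vec f = s := ⟨s, rfl⟩

/-- The action on the fibers of `⟨σ⟩`, in terms of morphisms. -/
def arrowHom (σ : Intertwiner α β) {μ μ' : β.idx} {i i' : α.idx} (b : β.Arrow μ μ')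
    (a : α.Arrow i i') (h : b.deg = a.deg) (f : β.e μ ⟶ σ.functor.obj (α.e i)) :
    β.e μ' ⟶ σ.functor.obj (α.e i') := σ.arrowMap b a h f

lemma arrowHom_mk (σ : Intertwiner α β) {g : G} {μ μ' : β.idx} {i i' : α.idx}
    {v : β.e μ' ⟶ (β.act g).obj (β.e μ)} {u : α.e i' ⟶ (α.act g).obj (α.e i)}
    (hv : IsUnitary v) (hu : IsUnitary u) (f : β.e μ ⟶ σ.functor.obj (α.e i)) :
    σ.arrowHom ⟨g, v, hv⟩ ⟨g, u, hu⟩ rfl f =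
      v ≫ (β.act g).map f ≫ (σ.comm g).hom.app (α.e i) ≫ dag (σ.functor.map u) := rfl

lemma act_vec (σ : Intertwiner α β) {μ μ' : β.idx} {i i' : α.idx} (b : β.Arrow μ μ')
    (a : α.Arrow i i') (h : b.deg = a.deg) (f : β.e μ ⟶ σ.functor.obj (α.e i)) :
    Kernel.act (X := α.gerbe) (Y := β.gerbe) σ.kernel (y := μ) (y' := μ') (x := i) (x' := i')
      b a h (σ.vec f) = σ.vec (σ.arrowHom b a h f) := rfl

lemma kernelHom_app_vec {σ ρ : Intertwiner α β} (θ : σ ⟶ ρ) {μ : β.idx} {i : α.idx}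
    (f : β.e μ ⟶ σ.functor.obj (α.e i)) :
    Kernel.app (X := α.gerbe) (Y := β.gerbe) (Hom.kernelHom θ) μ i (σ.vec f) =
      ρ.vec (f ≫ Hom.app θ (α.e i)) := rfl

/-- Equivariance of f ⊗ f' ↦ ρ(f') f. The intermediate unitary `v` enters the first factor through
ρ(v)^* and the second through ρ(v), so it cancels. Naturality of ρ(g) then moves f' past it. -/
lemma arrowHom_comp_map (σ : Intertwiner α β) (ρ : Intertwiner β γ) {κ κ' : γ.idx}
    {μ μ' : β.idx} {i i' : α.idx} (c : γ.Arrow κ κ') (b : β.Arrow μ μ') (a : α.Arrow i i')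
    (h : c.deg = b.deg) (h' : b.deg = a.deg) (h'' : c.deg = a.deg)
    (f : γ.e κ ⟶ ρ.functor.obj (β.e μ)) (f' : β.e μ ⟶ σ.functor.obj (α.e i)) :
    ρ.arrowHom c b h f ≫ ρ.functor.map (σ.arrowHom b a h' f') =
      (comp σ ρ).arrowHom c a h'' (f ≫ ρ.functor.map f') := by
  obtain ⟨g, w, hw⟩ := c
  obtain ⟨_, v, hv⟩ := b
  obtain ⟨_, u, hu⟩ := a
  dsimp only at h h'
  subst h h'
  rw [arrowHom_mk, arrowHom_mk, arrowHom_mk]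
  have h1 := (ρ.star.map_unitary hv).dag_comp
  have h2 := (ρ.comm g).hom.naturality f'
  simp only [Functor.comp_map] at h2
  rw [comp_comm_app]
  simp only [Functor.map_comp, Category.assoc, reassoc_of% h1, ρ.star.map_dag]
  change _ = w ≫ (γ.act g).map (f ≫ ρ.functor.map f') ≫
    ((ρ.comm g).hom.app (σ.functor.obj (α.e i)) ≫ ρ.functor.map ((σ.comm g).hom.app (α.e i))) ≫
      dag (ρ.functor.map (σ.functor.map u))
  rw [Functor.map_comp, Category.assoc, Category.assoc, reassoc_of% h2]

/-- The pairing `f, f' ↦ ρ(f') ∘ f`. -/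
def mapPairing (σ : Intertwiner α β) (ρ : Intertwiner β γ) (κ : γ.idx) (μ : β.idx) (i : α.idx) :
    (γ.e κ ⟶ ρ.functor.obj (β.e μ)) →ₗ[ℂ] (β.e μ ⟶ σ.functor.obj (α.e i)) →ₗ[ℂ]
      (γ.e κ ⟶ (comp σ ρ).functor.obj (α.e i)) :=
  LinearMap.mk₂ ℂ (fun f f' => f ≫ ρ.functor.map f')
    (fun _ _ _ => Preadditive.add_comp _ _ _ _ _ _)
    (fun _ _ _ => Linear.smul_comp _ _ _ _ _ _)
    (fun _ _ _ => by
      rw [ρ.star.map_add]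
      exact Preadditive.comp_add _ _ _ _ _ _)
    (fun _ _ _ => by
      rw [ρ.star.map_smul]
      exact Linear.comp_smul _ _ _ _ _ _)

/-- The component `f ⊗ f' ↦ ρ(f') ∘ f` of the compositor. -/
def compositorApp (σ : Intertwiner α β) (ρ : Intertwiner β γ) (κ : γ.idx) (i : α.idx) :
    (Kernel.comp (X := α.gerbe) (Y := β.gerbe) (Z := γ.gerbe) σ.kernel ρ.kernel).fiber κ i →ₗ[ℂ]
      (Kernel.fiber (X := α.gerbe) (Y := γ.gerbe) (comp σ ρ).kernel κ i) :=
  Kernel.compLift (X := α.gerbe) (Y := β.gerbe) (Z := γ.gerbe) (E := σ.kernel) (F := ρ.kernel)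
    fun μ : β.idx => mapPairing σ ρ κ μ i

lemma compositorApp_cmk (σ : Intertwiner α β) (ρ : Intertwiner β γ) {κ : γ.idx} {i : α.idx}
    {μ : β.idx} (f : γ.e κ ⟶ ρ.functor.obj (β.e μ)) (f' : β.e μ ⟶ σ.functor.obj (α.e i)) :
    compositorApp σ ρ κ i (Kernel.cmk (X := α.gerbe) (Y := β.gerbe) (Z := γ.gerbe)
      (E := σ.kernel) (F := ρ.kernel) μ (ρ.vec f) (σ.vec f')) =
      (comp σ ρ).vec (f ≫ ρ.functor.map f') :=
  Kernel.compLift_cmk (X := α.gerbe) (Y := β.gerbe) (Z := γ.gerbe) (E := σ.kernel)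
    (F := ρ.kernel) _ _ _ _

/-- The compositor `⟨ρ⟩ ∘ ⟨σ⟩ ⟶ ⟨ρ ∘ σ⟩`. -/
def compositor (σ : Intertwiner α β) (ρ : Intertwiner β γ) :
    Kernel.comp (X := α.gerbe) (Y := β.gerbe) (Z := γ.gerbe) σ.kernel ρ.kernel ⟶
      (comp σ ρ).kernel :=
  Kernel.homOfAct (X := α.gerbe) (Y := γ.gerbe) (compositorApp σ ρ)
    (fun {κ κ' i i'} c a h s => by
      revert s
      refine LinearMap.congr_fun (f := _ ∘ₗ _) (g := _ ∘ₗ _)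
        (Kernel.comp_hom_ext fun μ f e => ?_)
      obtain ⟨f, rfl⟩ := ρ.vec_surjective f
      obtain ⟨e, rfl⟩ := σ.vec_surjective e
      have hy := Gerbe.deg_arrow (X := β.gerbe) (α.gerbe.deg a) μ
      refine (congrArg (compositorApp σ ρ κ' i') (Kernel.act_cmk (X := α.gerbe) (Y := β.gerbe)
        (Z := γ.gerbe) σ.kernel ρ.kernel c a h
        (β.gerbe.arrow (α.gerbe.deg a) μ) (by rw [h, hy]) hy _ _)).trans ?_
      refine (compositorApp_cmk σ ρ _ _).trans ?_
      refine Eq.trans ?_ (congrArg ((comp σ ρ).kernel.act (X := α.gerbe) (Y := γ.gerbe) c a h)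
        (compositorApp_cmk σ ρ f e).symm)
      refine Eq.trans ?_ (act_vec (comp σ ρ) c a h _).symm
      exact congrArg (comp σ ρ).vec (arrowHom_comp_map σ ρ c _ a _ _ _ f e))

lemma compositor_app_cmk (σ : Intertwiner α β) (ρ : Intertwiner β γ) {κ : γ.idx} {i : α.idx}
    {μ : β.idx} (f : γ.e κ ⟶ ρ.functor.obj (β.e μ)) (f' : β.e μ ⟶ σ.functor.obj (α.e i)) :
    Kernel.app (X := α.gerbe) (Y := γ.gerbe) (compositor σ ρ) κ i
      (Kernel.cmk (X := α.gerbe) (Y := β.gerbe) (Z := γ.gerbe)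
      (E := σ.kernel) (F := ρ.kernel) μ (ρ.vec f) (σ.vec f')) =
      (comp σ ρ).vec (f ≫ ρ.functor.map f') := compositorApp_cmk σ ρ f f'

end Intertwiner

end

end TwoRepGerbe

namespace TwoRepGerbe

noncomputable section

open MarkedTwoHilb

/-! ### Spaces of morphisms into the values of a *-functor, as convolutions -/

section convolution

variable {H : MarkedTwoHilb.{v, u}} {K : Type u₁} [Category.{u} K] [Preadditive K] [Linear ℂ K]
  [HStarCategory K]

/-- The Hilbert space of morphisms, as a space of morphisms. -/
def homVec (a b : K) : (a ⟶ b) ≃ₗ[ℂ] homHilb a b := LinearEquiv.refl ℂ (a ⟶ b)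

lemma homVec_surjective {a b : K} (s : homHilb a b) : ∃ f : a ⟶ b, homVec a b f = s := ⟨s, rfl⟩

lemma IsStarFunctor.map_zero {F : H.carrier ⥤ K} (hF : IsStarFunctor F) (a b : H.carrier) :
    F.map (0 : a ⟶ b) = 0 := by
  have := hF.map_smul (0 : ℂ) (0 : a ⟶ b)
  simpa only [zero_smul] using this

lemma IsStarFunctor.map_sum {F : H.carrier ⥤ K} (hF : IsStarFunctor F) {a b : H.carrier}
    {ι : Type*} (s : Finset ι) (f : ι → (a ⟶ b)) :
    F.map (∑ n ∈ s, f n) = ∑ n ∈ s, F.map (f n) :=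
  _root_.map_sum (⟨⟨F.map, hF.map_zero a b⟩, hF.map_add⟩ : (a ⟶ b) →+ _) f s

variable {F : H.carrier ⥤ K} (hF : IsStarFunctor F) (k : H.idx → ℝ) (hk : ∀ y, 0 < k y)
  (x : K) (S : H.carrier)

/-- The bilinear map `f, f' ↦ F(f') ∘ f`. -/
def mapPair (hF : IsStarFunctor F) (x : K) (μ : H.idx) (S : H.carrier) :
    (x ⟶ F.obj (H.e μ)) →ₗ[ℂ] (H.e μ ⟶ S) →ₗ[ℂ] (x ⟶ F.obj S) :=
  LinearMap.mk₂ ℂ (fun f f' => f ≫ F.map f')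
    (fun _ _ _ => Preadditive.add_comp _ _ _ _ _ _)
    (fun _ _ _ => Linear.smul_comp _ _ _ _ _ _)
    (fun _ _ _ => by rw [hF.map_add, Preadditive.comp_add])
    (fun _ _ _ => by rw [hF.map_smul, Linear.comp_smul])

/-- The map `f ⊗ f' ↦ F(f') ∘ f`. -/
def convMap : conv k hk (fun μ => homHilb x (F.obj (H.e μ))) (fun μ => homHilb (H.e μ) S) →ₗ[ℂ]
    (x ⟶ F.obj S) :=
  conv.lift fun μ => mapPair hF x μ S

lemma convMap_mk {μ : H.idx} (f : x ⟶ F.obj (H.e μ)) (f' : H.e μ ⟶ S) :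
    convMap hF k hk x S (conv.mk μ (homVec x (F.obj (H.e μ)) f) (homVec (H.e μ) S f')) =
      f ≫ F.map f' :=
  conv.lift_mk _ μ _ _

/-- The balancing relation of a coend over all the objects. Over the marked simples it already holds
in the direct sum, since `l` is a scalar or zero. -/
lemma conv_mk_map_comp (hF : IsStarFunctor F) {μ ν : H.idx} (f : x ⟶ F.obj (H.e μ))
    (l : H.e μ ⟶ H.e ν) (q : H.e ν ⟶ S) :
    (conv.mk ν (homVec x (F.obj (H.e ν)) (f ≫ F.map l)) (homVec (H.e ν) S q) :
      conv k hk (fun μ => homHilb x (F.obj (H.e μ))) (fun μ => homHilb (H.e μ) S)) =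
    conv.mk μ (homVec x (F.obj (H.e μ)) f) (homVec (H.e μ) S (l ≫ q)) := by
  by_cases h : μ = ν
  · subst h
    obtain ⟨c, rfl⟩ := (H.isSimple_e μ).exists_smul l
    rw [hF.map_smul, CategoryTheory.Functor.map_id, Linear.comp_smul, Category.comp_id,
      Linear.smul_comp, Category.id_comp]
    simp only [map_smul, LinearMap.smul_apply]
  · rw [hom_eq_zero h l, hF.map_zero, Limits.comp_zero, Limits.zero_comp]
    simp only [map_zero, LinearMap.zero_apply]

/-- The inverse of `convMap`. -/
def convMapInv (F : H.carrier ⥤ K) : (x ⟶ F.obj S) →ₗ[ℂ]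
    conv k hk (fun μ => homHilb x (F.obj (H.e μ))) (fun μ => homHilb (H.e μ) S) :=
  ∑ μ, ∑ n, (conv.mk μ).flip (homVec (H.e μ) S (frame S μ n)) ∘ₗ
    (homVec x (F.obj (H.e μ))).toLinearMap ∘ₗ
    Linear.rightComp ℂ x (F.map (dag (frame S μ n)))

lemma convMapInv_apply (h : x ⟶ F.obj S) :
    convMapInv k hk x S F h = ∑ μ, ∑ n,
      conv.mk μ (homVec x (F.obj (H.e μ)) (h ≫ F.map (dag (frame S μ n))))
        (homVec (H.e μ) S (frame S μ n)) := by
  simp only [convMapInv, LinearMap.sum_apply]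
  rfl

/-- Inserting ∑ q q^* = id_S, a morphism h : x → F(S) is the sum of F(q) F(q^*) h. So h ↦ ∑ F(q^*) h
⊗ q is a right inverse, and sliding morphisms between simples across the tensor sign shows that it
is a left inverse. -/
lemma convMap_bijective : Function.Bijective (convMap hF k hk x S) := by
  refine Function.bijective_iff_has_inverse.2 ⟨convMapInv k hk x S F, fun s => ?_, fun h => ?_⟩
  · refine LinearMap.congr_fun (f := convMapInv k hk x S F ∘ₗ convMap hF k hk x S)
      (g := LinearMap.id) (conv.hom_ext fun μ f e => ?_) s
    obtain ⟨f, rfl⟩ := homVec_surjective f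
    obtain ⟨e, rfl⟩ := homVec_surjective e
    rw [LinearMap.comp_apply, convMap_mk, convMapInv_apply]
    simp only [Category.assoc, ← F.map_comp]
    simp only [conv_mk_map_comp k hk x S hF]
    conv_rhs => rw [LinearMap.id_apply, ← comp_sum_frame e]
    simp only [map_sum, Category.assoc]
  · rw [convMapInv_apply]
    simp only [map_sum, convMap_mk, Category.assoc, ← F.map_comp, ← Preadditive.comp_sum,
      ← hF.map_sum, sum_frame]
    rw [F.map_id, Category.comp_id]

end convolution

namespace Intertwiner

variable {G : Type w} [Group G] {α β γ δ : MarkedTwoRep.{w, v, u} G}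

/-- The component of the compositor unfolds to `convMap` for the functor of `ρ`, with x = e_κ and S
= σ(e_i). -/
lemma compositor_bijective (σ : Intertwiner α β) (ρ : Intertwiner β γ) (κ : γ.idx) (i : α.idx) :
    Function.Bijective (Kernel.app (X := α.gerbe) (Y := γ.gerbe) (compositor σ ρ) κ i) :=
  convMap_bijective ρ.star β.gerbe.k β.gerbe.k_pos (γ.e κ) (σ.functor.obj (α.e i))

/-- The compositor as an isomorphism. -/
def compositorIso (σ : Intertwiner α β) (ρ : Intertwiner β γ) :
    Kernel.comp (X := α.gerbe) (Y := β.gerbe) (Z := γ.gerbe) σ.kernel ρ.kernel ≅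
      (comp σ ρ).kernel :=
  Kernel.isoOfBijective (X := α.gerbe) (Y := γ.gerbe) (compositor σ ρ) (compositor_bijective σ ρ)

/-- This is what makes 1 ↦ id equivariant: α_g preserves identities, so only u^* u = id remains. -/
lemma arrowHom_id {i i' : α.idx} (a : α.Arrow i i') :
    (Intertwiner.id α).arrowHom a a rfl (𝟙 (α.e i)) = 𝟙 (α.e i') := by
  obtain ⟨g, u, hu⟩ := a
  refine (arrowHom_mk _ hu hu _).trans ?_
  change u ≫ (α.act g).map (𝟙 (α.e i)) ≫ 𝟙 ((α.act g).obj (α.e i)) ≫ dag u = _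
  rw [CategoryTheory.Functor.map_id, Category.id_comp, Category.id_comp, hu.comp_dag]

/-- The unit isomorphism `id ≅ ⟨id⟩`. -/
def unitIso (α : MarkedTwoRep.{w, v, u} G) :
    Kernel.idKernel α.gerbe ≅ (Intertwiner.id α).kernel :=
  Kernel.isoOfBijective (X := α.gerbe) (Y := α.gerbe)
    (Kernel.ofUnit (X := α.gerbe) (K := (Intertwiner.id α).kernel)
      (fun i => (Intertwiner.id α).vec (𝟙 (α.e i)))
      (fun a => congrArg (Intertwiner.id α).vec (arrowHom_id a)))
    (Kernel.ofUnit_bijective (X := α.gerbe) (K := (Intertwiner.id α).kernel)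
      (fun i => (Intertwiner.id α).vec (𝟙 (α.e i)))
      (fun a => congrArg (Intertwiner.id α).vec (arrowHom_id a))
      (fun i => (α.isSimple_e i).id_ne_zero)
      (fun _ _ h s => hom_eq_zero h s) (fun i s => (α.isSimple_e i).exists_smul s))

lemma unitIso_hom_app_idOne (α : MarkedTwoRep.{w, v, u} G) (i : α.idx) :
    Kernel.app (X := α.gerbe) (Y := α.gerbe) (unitIso α).hom i i (Kernel.idOne (X := α.gerbe) i) =
      (Intertwiner.id α).vec (𝟙 (α.e i)) :=
  Kernel.ofUnit_app_idOne (X := α.gerbe) (K := (Intertwiner.id α).kernel)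
    (fun i => (Intertwiner.id α).vec (𝟙 (α.e i)))
    (fun a => congrArg (Intertwiner.id α).vec (arrowHom_id a)) i

/-! ### The axioms of a weak 2-functor, evaluated on pure tensors -/

section coherence

/-- On f ⊗ e this is naturality of `η` at the morphism e. -/
lemma whisker_left_aux (σ : Intertwiner α β) {ρ τ : Intertwiner β γ} (η : ρ ⟶ τ) {κ : γ.idx}
    {μ : β.idx} {i : α.idx} (f : γ.e κ ⟶ ρ.functor.obj (β.e μ))
    (e : β.e μ ⟶ σ.functor.obj (α.e i)) :
    Kernel.app (X := α.gerbe) (Y := γ.gerbe)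
      (compositor σ ρ ≫ Hom.kernelHom (whiskerLeft σ η)) κ i
      (Kernel.cmk (X := α.gerbe) (Y := β.gerbe) (Z := γ.gerbe) μ (ρ.vec f) (σ.vec e)) =
    Kernel.app (X := α.gerbe) (Y := γ.gerbe)
      (Kernel.whiskerLeft (X := α.gerbe) (Y := β.gerbe) (Z := γ.gerbe) σ.kernel (Hom.kernelHom η) ≫
        compositor σ τ) κ i
      (Kernel.cmk (X := α.gerbe) (Y := β.gerbe) (Z := γ.gerbe) μ (ρ.vec f) (σ.vec e)) := by
  refine (congrArg (Kernel.app (X := α.gerbe) (Y := γ.gerbe)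
    (Hom.kernelHom (whiskerLeft σ η)) κ i) (compositor_app_cmk σ ρ f e)).trans ?_
  refine Eq.trans ?_ (congrArg (Kernel.app (X := α.gerbe) (Y := γ.gerbe) (compositor σ τ) κ i)
    (Kernel.whiskerLeft_app_cmk (X := α.gerbe) (Y := β.gerbe) (Z := γ.gerbe) _ _ _ _ _)).symm
  refine Eq.trans ?_ (compositor_app_cmk σ τ (f ≫ Hom.app η (β.e μ)) e).symm
  refine congrArg (comp σ τ).vec ?_
  change (f ≫ ρ.functor.map e) ≫ Hom.app η (σ.functor.obj (α.e i)) =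
    (f ≫ Hom.app η (β.e μ)) ≫ τ.functor.map e
  rw [Category.assoc, Category.assoc, Hom.naturality]

/-- Only functoriality of `ρ` is involved: composing e with the component of `η` commutes with
applying `ρ`. -/
lemma whisker_right_aux {σ τ : Intertwiner α β} (η : σ ⟶ τ) (ρ : Intertwiner β γ) {κ : γ.idx}
    {μ : β.idx} {i : α.idx} (f : γ.e κ ⟶ ρ.functor.obj (β.e μ))
    (e : β.e μ ⟶ σ.functor.obj (α.e i)) :
    Kernel.app (X := α.gerbe) (Y := γ.gerbe)
      (compositor σ ρ ≫ Hom.kernelHom (whiskerRight η ρ)) κ i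
      (Kernel.cmk (X := α.gerbe) (Y := β.gerbe) (Z := γ.gerbe) μ (ρ.vec f) (σ.vec e)) =
    Kernel.app (X := α.gerbe) (Y := γ.gerbe)
      (Kernel.whiskerRight (X := α.gerbe) (Y := β.gerbe) (Z := γ.gerbe) (Hom.kernelHom η)
        ρ.kernel ≫ compositor τ ρ) κ i
      (Kernel.cmk (X := α.gerbe) (Y := β.gerbe) (Z := γ.gerbe) μ (ρ.vec f) (σ.vec e)) := by
  refine (congrArg (Kernel.app (X := α.gerbe) (Y := γ.gerbe)
    (Hom.kernelHom (whiskerRight η ρ)) κ i) (compositor_app_cmk σ ρ f e)).trans ?_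
  refine Eq.trans ?_ (congrArg (Kernel.app (X := α.gerbe) (Y := γ.gerbe) (compositor τ ρ) κ i)
    (Kernel.whiskerRight_app_cmk (X := α.gerbe) (Y := β.gerbe) (Z := γ.gerbe) _ _ _ _ _)).symm
  refine Eq.trans ?_ (compositor_app_cmk τ ρ f (e ≫ Hom.app η (α.e i))).symm
  refine congrArg (comp τ ρ).vec ?_
  change (f ≫ ρ.functor.map e) ≫ ρ.functor.map (Hom.app η (α.e i)) =
    f ≫ ρ.functor.map (e ≫ Hom.app η (α.e i))
  rw [Category.assoc, ρ.functor.map_comp]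

/-- Both composites send f ⊗ f' ⊗ f'' to τ(ρ(f'')) τ(f') f. -/
lemma associator_aux {σ : Intertwiner α β} {ρ : Intertwiner β γ} {τ : Intertwiner γ δ}
    {κ : δ.idx} {z : γ.idx} {y : β.idx} {i : α.idx} (f : δ.e κ ⟶ τ.functor.obj (γ.e z))
    (f' : γ.e z ⟶ ρ.functor.obj (β.e y)) (f'' : β.e y ⟶ σ.functor.obj (α.e i)) :
    Kernel.app (X := α.gerbe) (Y := δ.gerbe)
      (Kernel.whiskerRight (X := α.gerbe) (Y := γ.gerbe) (Z := δ.gerbe) (compositor σ ρ)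
        τ.kernel ≫ compositor (comp σ ρ) τ ≫ Hom.kernelHom (associator σ ρ τ).hom) κ i
      (Kernel.cmk (X := α.gerbe) (Y := γ.gerbe) (Z := δ.gerbe) z (τ.vec f)
        (Kernel.cmk (X := α.gerbe) (Y := β.gerbe) (Z := γ.gerbe) y (ρ.vec f') (σ.vec f''))) =
    Kernel.app (X := α.gerbe) (Y := δ.gerbe)
      ((Kernel.associator (X := α.gerbe) (Y := β.gerbe) (Z := γ.gerbe) (W := δ.gerbe) σ.kernel
        ρ.kernel τ.kernel).hom ≫
        Kernel.whiskerLeft (X := α.gerbe) (Y := β.gerbe) (Z := δ.gerbe) σ.kernel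
          (compositor ρ τ) ≫ compositor σ (comp ρ τ)) κ i
      (Kernel.cmk (X := α.gerbe) (Y := γ.gerbe) (Z := δ.gerbe) z (τ.vec f)
        (Kernel.cmk (X := α.gerbe) (Y := β.gerbe) (Z := γ.gerbe) y (ρ.vec f') (σ.vec f''))) := by
  refine (congrArg (Kernel.app (X := α.gerbe) (Y := δ.gerbe)
    (compositor (comp σ ρ) τ ≫ Hom.kernelHom (associator σ ρ τ).hom) κ i)
    ((Kernel.whiskerRight_app_cmk (X := α.gerbe) (Y := γ.gerbe) (Z := δ.gerbe) _ _ _ _ _).trans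
      (congrArg (Kernel.cmk (X := α.gerbe) (Y := γ.gerbe) (Z := δ.gerbe) z (τ.vec f))
        (compositor_app_cmk σ ρ f' f'')))).trans ?_
  refine (congrArg (Kernel.app (X := α.gerbe) (Y := δ.gerbe)
    (Hom.kernelHom (associator σ ρ τ).hom) κ i)
    (compositor_app_cmk (comp σ ρ) τ f (f' ≫ ρ.functor.map f''))).trans ?_
  refine Eq.trans ?_ (congrArg (Kernel.app (X := α.gerbe) (Y := δ.gerbe)
    (compositor σ (comp ρ τ)) κ i)
    ((congrArg (Kernel.app (X := α.gerbe) (Y := δ.gerbe) (Kernel.whiskerLeft (X := α.gerbe)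
      (Y := β.gerbe) (Z := δ.gerbe) σ.kernel (compositor ρ τ)) κ i)
      (Kernel.associator_hom_app_cmk (X := α.gerbe) (Y := β.gerbe) (Z := γ.gerbe) (W := δ.gerbe)
        _ _ _ _ _ _ _ _)).trans
      ((Kernel.whiskerLeft_app_cmk (X := α.gerbe) (Y := β.gerbe) (Z := δ.gerbe) _ _ _ _ _).trans
        (congrArg (fun t => Kernel.cmk (X := α.gerbe) (Y := β.gerbe) (Z := δ.gerbe) y t
          (σ.vec f'')) (compositor_app_cmk ρ τ f f'))))).symm
  refine Eq.trans ?_ (compositor_app_cmk σ (comp ρ τ) (f ≫ τ.functor.map f') f'').symm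
  refine congrArg (comp σ (comp ρ τ)).vec ?_
  change (f ≫ τ.functor.map (f' ≫ ρ.functor.map f'')) ≫ 𝟙 _ =
    (f ≫ τ.functor.map f') ≫ τ.functor.map (ρ.functor.map f'')
  rw [Category.comp_id, τ.functor.map_comp, Category.assoc]

lemma left_unitor_aux {σ : Intertwiner α β} {μ : β.idx} {i : α.idx}
    (f : β.e μ ⟶ σ.functor.obj (α.e i)) :
    Kernel.app (X := α.gerbe) (Y := β.gerbe)
      (Kernel.whiskerRight (X := α.gerbe) (Y := α.gerbe) (Z := β.gerbe) (unitIso α).hom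
        σ.kernel ≫ compositor (Intertwiner.id α) σ ≫ Hom.kernelHom (leftUnitor σ).hom) μ i
      (Kernel.cmk (X := α.gerbe) (Y := α.gerbe) (Z := β.gerbe) i (σ.vec f)
        (Kernel.idOne (X := α.gerbe) i)) =
    Kernel.app (X := α.gerbe) (Y := β.gerbe)
      (Kernel.leftUnitor (X := α.gerbe) (Y := β.gerbe) σ.kernel).hom μ i
      (Kernel.cmk (X := α.gerbe) (Y := α.gerbe) (Z := β.gerbe) i (σ.vec f)
        (Kernel.idOne (X := α.gerbe) i)) := by
  refine (congrArg (Kernel.app (X := α.gerbe) (Y := β.gerbe)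
    (compositor (Intertwiner.id α) σ ≫ Hom.kernelHom (leftUnitor σ).hom) μ i)
    ((Kernel.whiskerRight_app_cmk (X := α.gerbe) (Y := α.gerbe) (Z := β.gerbe) _ _ _ _ _).trans
      (congrArg (Kernel.cmk (X := α.gerbe) (Y := α.gerbe) (Z := β.gerbe) i (σ.vec f))
        (unitIso_hom_app_idOne α i)))).trans ?_
  refine (congrArg (Kernel.app (X := α.gerbe) (Y := β.gerbe)
    (Hom.kernelHom (leftUnitor σ).hom) μ i)
    (compositor_app_cmk (Intertwiner.id α) σ f (𝟙 (α.e i)))).trans ?_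
  refine Eq.trans ?_ (Kernel.leftUnitor_hom_app_cmk (X := α.gerbe) (Y := β.gerbe) _ _ _ _).symm
  refine congrArg σ.vec ?_
  change (f ≫ σ.functor.map (𝟙 (α.e i))) ≫ 𝟙 _ = f
  rw [Category.comp_id, σ.functor.map_id, Category.comp_id]

lemma right_unitor_aux {σ : Intertwiner α β} {μ : β.idx} {i : α.idx}
    (f : β.e μ ⟶ σ.functor.obj (α.e i)) :
    Kernel.app (X := α.gerbe) (Y := β.gerbe)
      (Kernel.whiskerLeft (X := α.gerbe) (Y := β.gerbe) (Z := β.gerbe) σ.kernel (unitIso β).hom ≫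
        compositor σ (Intertwiner.id β) ≫ Hom.kernelHom (rightUnitor σ).hom) μ i
      (Kernel.cmk (X := α.gerbe) (Y := β.gerbe) (Z := β.gerbe) μ
        (Kernel.idOne (X := β.gerbe) μ) (σ.vec f)) =
    Kernel.app (X := α.gerbe) (Y := β.gerbe)
      (Kernel.rightUnitor (X := α.gerbe) (Y := β.gerbe) σ.kernel).hom μ i
      (Kernel.cmk (X := α.gerbe) (Y := β.gerbe) (Z := β.gerbe) μ
        (Kernel.idOne (X := β.gerbe) μ) (σ.vec f)) := by
  refine (congrArg (Kernel.app (X := α.gerbe) (Y := β.gerbe)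
    (compositor σ (Intertwiner.id β) ≫ Hom.kernelHom (rightUnitor σ).hom) μ i)
    ((Kernel.whiskerLeft_app_cmk (X := α.gerbe) (Y := β.gerbe) (Z := β.gerbe) _ _ _ _ _).trans
      (congrArg (fun t => Kernel.cmk (X := α.gerbe) (Y := β.gerbe) (Z := β.gerbe) μ t (σ.vec f))
        (unitIso_hom_app_idOne β μ)))).trans ?_
  refine (congrArg (Kernel.app (X := α.gerbe) (Y := β.gerbe)
    (Hom.kernelHom (rightUnitor σ).hom) μ i)
    (compositor_app_cmk σ (Intertwiner.id β) (𝟙 (β.e μ)) f)).trans ?_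
  refine Eq.trans ?_ (Kernel.rightUnitor_hom_app_cmk (X := α.gerbe) (Y := β.gerbe) _ _ _ _).symm
  refine congrArg σ.vec ?_
  change (𝟙 (β.e μ) ≫ f) ≫ 𝟙 _ = f
  rw [Category.comp_id, Category.id_comp]

end coherence

end Intertwiner

open Intertwiner in
/-- The weak 2-functor from 2-representations to gerbes. -/
def extractionStructure (G : Type w) [Group G] :
    WeakTwoFunctorStructure (extraction.{w, v, u} G) where
  map₂_id {α β} σ := Kernel.hom_ext (X := α.gerbe) (Y := β.gerbe) fun μ i =>
    LinearMap.ext fun f =>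
      Category.comp_id (X := β.e μ) (Y := (Intertwiner.functor σ).obj (α.e i)) f
  map₂_comp {α β σ ρ τ} η θ := Kernel.hom_ext (X := α.gerbe) (Y := β.gerbe) fun μ i =>
    LinearMap.ext fun f => (Category.assoc (W := β.e μ) (X := (Intertwiner.functor σ).obj (α.e i)) f
      (Hom.app η (α.e i)) (Hom.app θ (α.e i))).symm
  mapId α := (unitIso α).symm
  mapComp σ ρ := (compositorIso σ ρ).symm
  map₂_whisker_left {α β γ} σ ρ τ η := by
    -- The structure isomorphism runs from ⟨ρ ∘ σ⟩ to the convolution. It is moved to the other side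
    -- of the equation so that both sides start at the convolution, where pure tensors suffice. The
    -- later axioms are treated alike.
    refine (Iso.inv_comp_eq (compositorIso σ ρ).symm).1 ?_
    refine Kernel.hom_ext (X := α.gerbe) (Y := γ.gerbe) fun κ i =>
      Kernel.comp_hom_ext fun μ f e => ?_
    obtain ⟨f, rfl⟩ := vec_surjective ρ f
    obtain ⟨e, rfl⟩ := vec_surjective σ e
    exact whisker_left_aux σ η f e
  map₂_whisker_right {α β γ} σ τ η ρ := by
    refine (Iso.inv_comp_eq (compositorIso σ ρ).symm).1 ?_
    refine Kernel.hom_ext (X := α.gerbe) (Y := γ.gerbe) fun κ i =>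
      Kernel.comp_hom_ext fun μ f e => ?_
    obtain ⟨f, rfl⟩ := vec_surjective ρ f
    obtain ⟨e, rfl⟩ := vec_surjective σ e
    exact whisker_right_aux η ρ f e
  map₂_associator {α β γ δ} σ ρ τ := by
    refine (Iso.inv_comp_eq (compositorIso (comp σ ρ) τ).symm).1 ?_
    refine (Iso.inv_comp_eq (Bicategory.whiskerRightIso (a := α.gerbe) (b := γ.gerbe) (c := δ.gerbe)
      (compositorIso σ ρ).symm (Intertwiner.kernel τ))).1 ?_
    refine Kernel.hom_ext (X := α.gerbe) (Y := δ.gerbe) fun κ i =>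
      Kernel.assoc_hom_ext fun z y f f' f'' => ?_
    obtain ⟨f, rfl⟩ := vec_surjective τ f
    obtain ⟨f', rfl⟩ := vec_surjective ρ f'
    obtain ⟨f'', rfl⟩ := vec_surjective σ f''
    exact associator_aux f f' f''
  map₂_left_unitor {α β} σ := by
    refine (Iso.inv_comp_eq (compositorIso (Intertwiner.id α) σ).symm).1 ?_
    refine (Iso.inv_comp_eq (Bicategory.whiskerRightIso (a := α.gerbe) (b := α.gerbe) (c := β.gerbe)
      (unitIso α).symm (Intertwiner.kernel σ))).1 ?_
    refine Kernel.hom_ext (X := α.gerbe) (Y := β.gerbe) fun κ i =>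
      Kernel.left_hom_ext fun f => ?_
    obtain ⟨f, rfl⟩ := vec_surjective σ f
    exact left_unitor_aux f
  map₂_right_unitor {α β} σ := by
    refine (Iso.inv_comp_eq (compositorIso σ (Intertwiner.id β)).symm).1 ?_
    refine (Iso.inv_comp_eq (Bicategory.whiskerLeftIso (a := α.gerbe) (b := β.gerbe) (c := β.gerbe)
      (Intertwiner.kernel σ) (unitIso β).symm)).1 ?_
    refine Kernel.hom_ext (X := α.gerbe) (Y := β.gerbe) fun κ i =>
      Kernel.right_hom_ext fun f => ?_
    obtain ⟨f, rfl⟩ := vec_surjective σ f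
    exact right_unitor_aux f

end

end TwoRepGerbe

namespace TwoRepGerbe

noncomputable section

open MarkedTwoHilb

/-! ### Natural transformations determined on simple objects, and the trace formula -/

section

variable {H : MarkedTwoHilb.{v, u}} {K : Type u₁} [Category.{u} K] [Preadditive K] [Linear ℂ K]
  [HStarCategory K]

/-- A linear functor carries the resolution of the identity given by a frame of `a` to one of F(a).
-/
lemma IsStarFunctor.hom_ext {F : H.carrier ⥤ K} (hF : IsStarFunctor F) {a : H.carrier} {x : K}
    {f f' : F.obj a ⟶ x}
    (h : ∀ (i : H.idx) (q : H.e i ⟶ a), F.map q ≫ f = F.map q ≫ f') : f = f' := by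
  have key : ∀ f : F.obj a ⟶ x,
      f = ∑ i, ∑ n, F.map (dag (frame a i n)) ≫ F.map (frame a i n) ≫ f := fun f => by
    conv_lhs => rw [← Category.id_comp f, ← F.map_id, ← sum_frame a]
    simp only [hF.map_sum, F.map_comp, Preadditive.sum_comp, Category.assoc]
  rw [key f, key f']
  simp only [h]

lemma IsStarFunctor.comp {K' : Type u₂} [Category.{u} K'] [Preadditive K'] [Linear ℂ K']
    [HStarCategory K'] {F : H.carrier ⥤ K} (hF : IsStarFunctor F) {F' : K ⥤ K'}
    (hF' : IsStarFunctor F') : IsStarFunctor (F ⋙ F') :=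
  ⟨fun f f' => by rw [Functor.comp_map, hF.map_add, hF'.map_add, Functor.comp_map,
    Functor.comp_map],
    fun c f => by rw [Functor.comp_map, hF.map_smul, hF'.map_smul, Functor.comp_map],
    fun f => by rw [Functor.comp_map, hF.map_dag, hF'.map_dag, Functor.comp_map]⟩

section extend

variable {F F' : H.carrier ⥤ K} (t : (i : H.idx) → (F.obj (H.e i) ⟶ F'.obj (H.e i)))

/-- The extension to all objects of a family of morphisms between the values of two functors at
the simple objects. -/
def extendHom (a : H.carrier) : F.obj a ⟶ F'.obj a :=
  ∑ i, ∑ n, F.map (dag (frame a i n)) ≫ t i ≫ F'.map (frame a i n)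

variable (hF : IsStarFunctor F) (hF' : IsStarFunctor F')
include hF hF'

/-- Schur's lemma makes any family of components at the simples natural among the simples. -/
lemma map_comp_family {i j : H.idx} (l : H.e i ⟶ H.e j) :
    F.map l ≫ t j = t i ≫ F'.map l := by
  by_cases h : i = j
  · subst h
    obtain ⟨c, rfl⟩ := (H.isSimple_e i).exists_smul l
    rw [hF.map_smul, hF'.map_smul, F.map_id, F'.map_id, Linear.smul_comp, Linear.comp_smul,
      Category.id_comp, Category.comp_id]
  · rw [hom_eq_zero h l, hF.map_zero, hF'.map_zero, Limits.zero_comp, Limits.comp_zero]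

/-- The characterizing property of the extension, in which the frame no longer appears. Naturality
at all morphisms follows from it by testing on simples. -/
lemma map_comp_extendHom {i : H.idx} {a : H.carrier} (x : H.e i ⟶ a) :
    F.map x ≫ extendHom t a = t i ≫ F'.map x := by
  conv_rhs => rw [← comp_sum_frame x]
  simp only [extendHom, Preadditive.comp_sum, hF'.map_sum]
  refine Finset.sum_congr rfl fun j _ => Finset.sum_congr rfl fun n _ => ?_
  rw [← F.map_comp_assoc, reassoc_of% map_comp_family t hF hF', ← F'.map_comp]

lemma extendHom_e (i : H.idx) : extendHom t (H.e i) = t i := by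
  have := map_comp_extendHom t hF hF' (𝟙 (H.e i))
  rwa [F.map_id, F'.map_id, Category.id_comp, Category.comp_id] at this

lemma extendHom_naturality {a b : H.carrier} (f : a ⟶ b) :
    F.map f ≫ extendHom t b = extendHom t a ≫ F'.map f := by
  refine hF.hom_ext fun i q => ?_
  rw [← F.map_comp_assoc, map_comp_extendHom t hF hF', reassoc_of% map_comp_extendHom t hF hF',
    F'.map_comp]

end extend

/-- Composition with a morphism, as a linear map on spaces of morphisms from a simple object. -/
def postcomp {a b : H.carrier} (f : a ⟶ b) (i : H.idx) :
    homHilb (H.e i) a →ₗ[ℂ] homHilb (H.e i) b := Linear.rightComp ℂ (H.e i) f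

/-- Expand `f` in a frame of `a`: (f, f') is the sum of the inner products of the composites of f
and f' with the frame vectors. These are √k_i times orthonormal ones, whence the weight k_i in front
of each trace. This accounts for the target metric in the inner product of 2-morphisms of gerbes. -/
lemma sum_traceAdjMul {a b : H.carrier} (f f' : a ⟶ b) :
    ∑ i, (H.kc i : ℂ) * Hilb.traceAdjMul (postcomp f i) (postcomp f' i) = homIp f f' := by
  conv_rhs => rw [← sum_frame_comp f]
  simp only [homIp_sum_left]
  refine Finset.sum_congr rfl fun i _ => ?_
  obtain ⟨b, hb, hq⟩ := frame_eq_smul a i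
  have hk : (Real.sqrt (H.kc i) : ℂ) * (Real.sqrt (H.kc i) : ℂ) = H.kc i := by
    rw [← Complex.ofReal_mul, Real.mul_self_sqrt (H.kc_pos i).le]
  rw [Hilb.traceAdjMul_eq_sum (V := homHilb (H.e i) a) b hb, Finset.mul_sum]
  refine Finset.sum_congr rfl fun n _ => ?_
  rw [homIp_comp_left, dag_dag, hq, Linear.smul_comp, Linear.smul_comp, homIp_smul_left,
    homIp_smul_right, Complex.conj_ofReal, ← mul_assoc, hk]
  rfl

end

namespace MarkedTwoRep

variable {G : Type w} [Group G] (β : MarkedTwoRep.{w, v, u} G)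

lemma exists_unitary_from (g : G) (i : β.idx) :
    ∃ (j : β.idx) (u : β.e j ⟶ (β.act g).obj (β.e i)), IsUnitary u := by
  obtain ⟨a, ha⟩ := β.gerbe.deg_full g i
  obtain ⟨g', u, hu⟩ : β.Arrow i _ := a
  have h : g' = g := ha
  subst h
  exact ⟨_, u, hu⟩

/-- Here the target e_j is given and the source index is sought. The formula is that of the inverse
arrow, applied to a unitary over g⁻¹ out of j. -/
lemma exists_unitary_to (g : G) (j : β.idx) :
    ∃ (i : β.idx) (u : β.e j ⟶ (β.act g).obj (β.e i)), IsUnitary u := by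
  obtain ⟨i, v, hv⟩ := β.exists_unitary_from g⁻¹ j
  refine ⟨i, β.unit.hom.app (β.e j) ≫ (β.mul g g⁻¹ 1 (mul_inv_cancel g)).inv.app (β.e j) ≫
    (β.act g).map (dag v), (β.unit_unitary _).comp
    ((isUnitary_inv ((β.mul g g⁻¹ 1 (mul_inv_cancel g)).app (β.e j))
    (β.mul_unitary _ _ _ _ _)).comp ((β.act_star g).map_unitary hv.dag))⟩

variable {β}

/-- Since β_g is full, morphisms from simples into β_g(b) reduce to morphisms from simples into b.
This is how statements about values of the action are tested. -/
lemma exists_eq_comp_map {g : G} {μ μ' : β.idx} {v : β.e μ' ⟶ (β.act g).obj (β.e μ)}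
    (hv : IsUnitary v) {b : β.carrier} (q : β.e μ' ⟶ (β.act g).obj b) :
    ∃ l : β.e μ ⟶ b, q = v ≫ (β.act g).map l := by
  obtain ⟨l, hl⟩ := β.act_surjective g _ _ (dag v ≫ q)
  exact ⟨l, by rw [hl, ← Category.assoc, hv.comp_dag, Category.id_comp]⟩

end MarkedTwoRep

/-! ### Full faithfulness and unitarity on 2-morphisms -/

namespace Intertwiner

variable {G : Type w} [Group G] {α β : MarkedTwoRep.{w, v, u} G} {σ ρ : Intertwiner α β}

/-- The components at the simples are recovered by testing on morphisms from simples of `β`.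
Naturality along frames then determines all the components. -/
lemma kernelHom_injective :
    Function.Injective (fun θ : σ ⟶ ρ => (Hom.kernelHom θ : σ.kernel ⟶ ρ.kernel)) := by
  intro θ θ' h
  have h1 : ∀ i, Hom.app θ (α.e i) = Hom.app θ' (α.e i) := fun i => hom_ext_e fun μ q =>
    LinearMap.congr_fun (congrArg (fun f => Kernel.app (X := α.gerbe) (Y := β.gerbe) f μ i) h) q
  refine hom_ext fun a => σ.star.hom_ext fun i q => ?_
  rw [Hom.naturality, Hom.naturality, h1]

/-- The components of a 2-morphism of gerbes, as maps of spaces of morphisms. -/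
def appHom (φ : σ.kernel ⟶ ρ.kernel) (i : α.idx) (μ : β.idx) :
    (β.e μ ⟶ σ.functor.obj (α.e i)) →ₗ[ℂ] (β.e μ ⟶ ρ.functor.obj (α.e i)) :=
  Kernel.app (X := α.gerbe) (Y := β.gerbe) φ μ i

lemma appHom_arrowHom (φ : σ.kernel ⟶ ρ.kernel) {μ μ' : β.idx} {i i' : α.idx}
    (b : β.Arrow μ μ') (a : α.Arrow i i') (h : b.deg = a.deg)
    (f : β.e μ ⟶ σ.functor.obj (α.e i)) :
    appHom φ i' μ' (σ.arrowHom b a h f) = ρ.arrowHom b a h (appHom φ i μ f) :=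
  Kernel.app_act (X := α.gerbe) (Y := β.gerbe) φ b a h f

/-- At a simple object the intertwining condition is a rewriting of the equivariance of `φ` under
pairs of arrows over g. Naturality of all the transformations involved carries it to every object.
-/
lemma extendHom_comm (φ : σ.kernel ⟶ ρ.kernel) (g : G) (a : α.carrier) :
    (σ.comm g).hom.app a ≫ extendHom (fun i => ofLinear (appHom φ i)) ((α.act g).obj a) =
      (β.act g).map (extendHom (fun i => ofLinear (appHom φ i)) a) ≫ (ρ.comm g).hom.app a := by
  set t : (i : α.idx) → (σ.functor.obj (α.e i) ⟶ ρ.functor.obj (α.e i)) :=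
    fun i => ofLinear (appHom φ i) with ht
  have base : ∀ i, (σ.comm g).hom.app (α.e i) ≫ extendHom t ((α.act g).obj (α.e i)) =
      (β.act g).map (t i) ≫ (ρ.comm g).hom.app (α.e i) := by
    intro i
    obtain ⟨i', u, hu⟩ := α.exists_unitary_from g i
    have hρu := ρ.star.map_unitary hu.dag
    have := hρu.iso.isIso_hom
    rw [IsUnitary.iso_hom] at this
    -- Composing with the invertible ρ(u^*) and testing on morphisms β_g(l) v turns the equation
    -- into equivariance of `φ` under the arrows v and u, evaluated at l.
    rw [← cancel_mono (ρ.functor.map (dag u))]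
    refine hom_ext_e fun μ' q => ?_
    obtain ⟨μ, v, hv⟩ := β.exists_unitary_to g μ'
    obtain ⟨l, rfl⟩ := MarkedTwoRep.exists_eq_comp_map hv q
    have h1 := extendHom_naturality t σ.star ρ.star (dag u)
    rw [extendHom_e t σ.star ρ.star] at h1
    have h2 := appHom_arrowHom φ ⟨g, v, hv⟩ ⟨g, u, hu⟩ rfl l
    rw [arrowHom_mk, arrowHom_mk, ← comp_ofLinear (appHom φ i'), ← comp_ofLinear (appHom φ i),
      ← σ.star.map_dag, ← ρ.star.map_dag] at h2
    simp only [Category.assoc, Functor.map_comp] at h2 ⊢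
    erw [← h1]
    exact h2
  -- The composite of σ with β_g is a *-functor, so morphisms out of its values are detected on the
  -- images of morphisms from simples.
  refine (σ.star.comp (β.act_star g)).hom_ext fun i q => ?_
  have n1 := (σ.comm g).hom.naturality q
  have n2 := (ρ.comm g).hom.naturality q
  have n3 := extendHom_naturality t σ.star ρ.star ((α.act g).map q)
  have n4 := congrArg (β.act g).map (map_comp_extendHom t σ.star ρ.star q)
  simp only [Functor.comp_map, Functor.map_comp] at n1 n2 n4 ⊢
  erw [reassoc_of% n1, n3, reassoc_of% base, reassoc_of% n4, ← n2]

lemma kernelHom_surjective :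
    Function.Surjective (fun θ : σ ⟶ ρ => (Hom.kernelHom θ : σ.kernel ⟶ ρ.kernel)) := by
  intro φ
  refine ⟨Hom.mk (extendHom (fun i => ofLinear (appHom φ i)))
    (extendHom_naturality _ σ.star ρ.star) (extendHom_comm φ), ?_⟩
  refine Kernel.hom_ext (X := α.gerbe) (Y := β.gerbe) fun μ i => LinearMap.ext fun f => ?_
  obtain ⟨f, rfl⟩ := vec_surjective σ f
  refine (kernelHom_app_vec _ f).trans ?_
  refine congrArg ρ.vec (Eq.trans ?_ (comp_ofLinear (appHom φ i) f))
  exact congrArg (f ≫ ·) (extendHom_e _ σ.star ρ.star i)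

variable (σ ρ) in
/-- The linear isomorphism `θ ↦ ⟨θ⟩`. -/
def kernelHomEquiv : (σ ⟶ ρ) ≃ₗ[ℂ] (σ.kernel ⟶ ρ.kernel) :=
  LinearEquiv.ofBijective
    { toFun := fun θ => Hom.kernelHom θ
      map_add' := fun θ θ' => Kernel.hom_ext (X := α.gerbe) (Y := β.gerbe) fun μ i =>
        LinearMap.ext fun f => Preadditive.comp_add (β.e μ) (σ.functor.obj (α.e i))
          (ρ.functor.obj (α.e i)) f (Hom.app θ (α.e i)) (Hom.app θ' (α.e i))
      map_smul' := fun c θ => Kernel.hom_ext (X := α.gerbe) (Y := β.gerbe)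
        (g := c • (show σ.kernel ⟶ ρ.kernel from Hom.kernelHom θ)) fun μ i =>
        LinearMap.ext fun f => Linear.comp_smul (β.e μ) (σ.functor.obj (α.e i))
          (ρ.functor.obj (α.e i)) f c (Hom.app θ (α.e i)) }
    ⟨kernelHom_injective, kernelHom_surjective⟩

/-- For each i, the sum over the points μ of the target is the trace formula at σ(e_i); the factor
k_i of the source is common to both sides. -/
lemma innerProduct_kernelHom (θ θ' : σ ⟶ ρ) :
    Kernel.innerProduct (X := α.gerbe) (Y := β.gerbe) (Hom.kernelHom θ) (Hom.kernelHom θ') =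
      innerProduct θ θ' := by
  refine Finset.sum_congr (M := ℂ) rfl fun (i : α.idx) _ => ?_
  have h := congrArg (homIp (𝟙 (α.e i)) (𝟙 (α.e i)) * ·)
    (sum_traceAdjMul (Hom.app θ (α.e i)) (Hom.app θ' (α.e i)))
  refine Eq.trans ?_ h
  rw [homIp_id, Finset.mul_sum]
  exact Finset.sum_congr rfl fun μ _ => _root_.mul_assoc _ _ _

end Intertwiner

end

end TwoRepGerbe

namespace TwoRepGerbe

noncomputable section

open MarkedTwoHilb

/-! ### Unitarity tested on simples, and unitaries e_j → α_g(e_i) up to phase -/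

section

variable {H : MarkedTwoHilb.{v, u}}

lemma eq_of_homIp_left {K : Type v} [Category.{u} K] [Preadditive K] [Linear ℂ K]
    [HStarCategory K] {a b : K} {f g : a ⟶ b} (h : ∀ r, homIp f r = homIp g r) : f = g :=
  Hilb.eq_of_ip_left (V := homHilb a b) h

/-- Preservation of inner products gives c^* c = id by nondegeneracy. Surjectivity on morphisms from
simples then makes this one-sided inverse two-sided. -/
lemma isUnitary_of_isometry {a b : H.carrier} (c : a ⟶ b)
    (h1 : ∀ (i : H.idx) (q r : H.e i ⟶ a), homIp (q ≫ c) (r ≫ c) = homIp q r)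
    (h2 : ∀ (i : H.idx) (r : H.e i ⟶ b), ∃ q : H.e i ⟶ a, q ≫ c = r) : IsUnitary c := by
  have h3 : c ≫ dag c = 𝟙 a := hom_ext_e fun i q => eq_of_homIp_left fun r => by
    rw [← Category.assoc, homIp_comp_right, dag_dag, h1, Category.comp_id]
  refine ⟨h3, hom_ext_e fun i r => ?_⟩
  obtain ⟨q, rfl⟩ := h2 i r
  rw [Category.assoc, reassoc_of% h3, Category.comp_id]

end

namespace MarkedTwoRep

variable {G : Type w} [Group G] {α : MarkedTwoRep.{w, v, u} G}

lemma Arrow.target_eq {g : G} {i j j' : α.idx} {u : α.e j ⟶ (α.act g).obj (α.e i)}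
    (hu : IsUnitary u) {u' : α.e j' ⟶ (α.act g).obj (α.e i)} (hu' : IsUnitary u') : j = j' :=
  α.e_injective j j' ⟨hu.iso ≪≫ hu'.iso.symm⟩

/-- Both sources are carried to `j` by `g`, and a group element acts injectively on the indices. -/
lemma Arrow.source_eq {g : G} {i i' j : α.idx} {u : α.e j ⟶ (α.act g).obj (α.e i)}
    (hu : IsUnitary u) {u' : α.e j ⟶ (α.act g).obj (α.e i')} (hu' : IsUnitary u') : i = i' := by
  have h1 : g • (show α.gerbe.pt from i) = j :=
    α.gerbe.deg_smul (show α.gerbe.groupoid.Hom i j from (⟨g, u, hu⟩ : Arrow α i j))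
  have h2 : g • (show α.gerbe.pt from i') = j :=
    α.gerbe.deg_smul (show α.gerbe.groupoid.Hom i' j from (⟨g, u', hu'⟩ : Arrow α i' j))
  exact smul_left_cancel (β := α.gerbe.pt) g (h1.trans h2.symm)

/-- The torsor property of the gerbe, stated for the underlying unitaries. Every choice of unitary
made below is controlled by it. -/
lemma Arrow.exists_eq_smul {g : G} {i j : α.idx} {u : α.e j ⟶ (α.act g).obj (α.e i)}
    (hu : IsUnitary u) {u' : α.e j ⟶ (α.act g).obj (α.e i)} (hu' : IsUnitary u') :
    ∃ ζ : Circle, u' = (ζ : ℂ) • u := by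
  obtain ⟨ζ, h⟩ := Gerbe.exists_eq_comp_phase (X := α.gerbe) (x := i) (y := j)
    (⟨g, u, hu⟩ : Arrow α i j) (⟨g, u', hu'⟩ : Arrow α i j) rfl
  have h' : (⟨g, u', hu'⟩ : Arrow α i j) = Arrow.smul ζ ⟨g, u, hu⟩ :=
    h.trans (Arrow.comp_phase ζ _)
  refine ⟨ζ, ?_⟩
  have := (Arrow.mk.injEq ..).mp h'
  exact eq_of_heq this.2

variable (α) in
/-- The index of the simple object isomorphic to `α_g (e i)`. -/
def targetIdx (g : G) (i : α.idx) : α.idx := (α.exists_unitary_from g i).choose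

variable (α) in
/-- A unitary onto `α_g (e i)` from a marked simple object. -/
def targetUnitary (g : G) (i : α.idx) : α.e (α.targetIdx g i) ⟶ (α.act g).obj (α.e i) :=
  (α.exists_unitary_from g i).choose_spec.choose

variable (α) in
lemma targetUnitary_unitary (g : G) (i : α.idx) : IsUnitary (α.targetUnitary g i) :=
  (α.exists_unitary_from g i).choose_spec.choose_spec

/-- The action of a group element on spaces of morphisms. -/
def actEquiv (α : MarkedTwoRep.{w, v, u} G) (g : G) (a b : α.carrier) :
    (a ⟶ b) ≃ₗ[ℂ] ((α.act g).obj a ⟶ (α.act g).obj b) :=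
  LinearEquiv.ofBijective
    { toFun := (α.act g).map
      map_add' := (α.act_star g).map_add
      map_smul' := (α.act_star g).map_smul }
    ⟨fun f f' h => eq_of_homIp_left fun r => by
      rw [← α.act_isometry g, ← α.act_isometry g f']
      exact congrArg (homIp · _) h, α.act_surjective g a b⟩

end MarkedTwoRep

/-! ## Intertwiners from morphisms of gerbes -/

namespace KernelLift

variable {G : Type w} [Group G] {α β : MarkedTwoRep.{w, v, u} G}
  (E : Kernel α.gerbe β.gerbe)

/-- The fibers of a morphism of gerbes. -/
def fib (μ : β.idx) (i : α.idx) : Hilb.{u} := Kernel.fiber (X := α.gerbe) (Y := β.gerbe) E μ i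

/-- The action of a pair of unitaries on the fibers. -/
def fact {g : G} {μ μ' : β.idx} {i i' : α.idx} {v : β.e μ' ⟶ (β.act g).obj (β.e μ)}
    (hv : IsUnitary v) {u : α.e i' ⟶ (α.act g).obj (α.e i)} (hu : IsUnitary u) :
    fib E μ i →ₗ[ℂ] fib E μ' i' :=
  Kernel.act (X := α.gerbe) (Y := β.gerbe) E (y := μ) (y' := μ') (x := i) (x' := i')
    (⟨g, v, hv⟩ : β.Arrow μ μ') (⟨g, u, hu⟩ : α.Arrow i i') rfl

section fact

variable {g : G} {μ μ' : β.idx} {i i' : α.idx} {v : β.e μ' ⟶ (β.act g).obj (β.e μ)}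
    (hv : IsUnitary v) {u : α.e i' ⟶ (α.act g).obj (α.e i)} (hu : IsUnitary u)

lemma ip_fact (s t : fib E μ i) : Hilb.ip (fact E hv hu s) (fact E hv hu t) = Hilb.ip s t :=
  Kernel.ip_act (X := α.gerbe) (Y := β.gerbe) E _ _ _ s t

lemma fact_unit (μ : β.idx) (i : α.idx) (s : fib E μ i) :
    fact E (β.unit_unitary (β.e μ)) (α.unit_unitary (α.e i)) s = s :=
  LinearMap.congr_fun (Kernel.act_id (X := α.gerbe) (Y := β.gerbe) E μ i rfl) s

lemma fact_comp {g₁ g₂ g : G} (h : g₂ * g₁ = g) {μ μ' μ'' : β.idx} {i i' i'' : α.idx}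
    {v₁ : β.e μ' ⟶ (β.act g₁).obj (β.e μ)} {v₂ : β.e μ'' ⟶ (β.act g₂).obj (β.e μ')}
    {u₁ : α.e i' ⟶ (α.act g₁).obj (α.e i)} {u₂ : α.e i'' ⟶ (α.act g₂).obj (α.e i')}
    (hv₁ : IsUnitary v₁) (hv₂ : IsUnitary v₂) (hu₁ : IsUnitary u₁) (hu₂ : IsUnitary u₂)
    (s : fib E μ i) :
    fact E (MarkedTwoRep.Arrow.compU_unitary h hv₁ hv₂)
      (MarkedTwoRep.Arrow.compU_unitary h hu₁ hu₂) s = fact E hv₂ hu₂ (fact E hv₁ hu₁ s) := by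
  subst h
  exact LinearMap.congr_fun (Kernel.act_comp (X := α.gerbe) (Y := β.gerbe) E
    (⟨g₁, v₁, hv₁⟩ : β.Arrow μ μ') (⟨g₁, u₁, hu₁⟩ : α.Arrow i i') rfl
    (⟨g₂, v₂, hv₂⟩ : β.Arrow μ' μ'') (⟨g₂, u₂, hu₂⟩ : α.Arrow i' i'') rfl rfl) s

lemma fact_smul_left (ζ : Circle) (hv' : IsUnitary ((ζ : ℂ) • v)) (s : fib E μ i) :
    fact E hv' hu s = (ζ : ℂ) • fact E hv hu s := by
  have h := Kernel.act_comp_phase_left (X := α.gerbe) (Y := β.gerbe) E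
    (⟨g, v, hv⟩ : β.Arrow μ μ') (⟨g, u, hu⟩ : α.Arrow i i') rfl ζ (one_mul g)
  refine Eq.trans ?_ (LinearMap.congr_fun h s)
  -- Composition with a phase yields an arrow whose recorded degree is `1 * g`, so it is identified
  -- with the rescaled arrow over `g` as an arrow, not merely through its unitary.
  refine LinearMap.congr_fun (Kernel.act_congr (X := α.gerbe) (Y := β.gerbe) E
    (y := μ) (y' := μ') (x := i) (x' := i') ?_ rfl rfl (by exact one_mul g)) s
  exact (MarkedTwoRep.Arrow.comp_phase ζ (⟨g, v, hv⟩ : β.Arrow μ μ')).symm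

lemma fact_smul_right (ζ : Circle) (hu' : IsUnitary ((ζ : ℂ) • u)) (s : fib E μ i) :
    fact E hv hu' s = ((ζ⁻¹ : Circle) : ℂ) • fact E hv hu s := by
  have h := Kernel.act_comp_phase_right (X := α.gerbe) (Y := β.gerbe) E
    (⟨g, v, hv⟩ : β.Arrow μ μ') (⟨g, u, hu⟩ : α.Arrow i i') rfl ζ (one_mul g).symm
  refine Eq.trans ?_ (LinearMap.congr_fun h s)
  refine LinearMap.congr_fun (Kernel.act_congr (X := α.gerbe) (Y := β.gerbe) E
    (y := μ) (y' := μ') (x := i) (x' := i') rfl ?_ rfl (by exact (one_mul g).symm)) s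
  exact (MarkedTwoRep.Arrow.comp_phase ζ (⟨g, u, hu⟩ : α.Arrow i i')).symm

/-- A preimage is obtained by acting with the inverse arrows of the gerbes. -/
lemma fact_surjective : Function.Surjective (fact E hv hu) := by
  intro s
  let b : β.Arrow μ μ' := ⟨g, v, hv⟩
  let a : α.Arrow i i' := ⟨g, u, hu⟩
  refine ⟨Kernel.act (X := α.gerbe) (Y := β.gerbe) E (y := μ') (y' := μ) (x := i') (x' := i)
    b.inv a.inv rfl s, ?_⟩
  have h1 := Kernel.act_comp (X := α.gerbe) (Y := β.gerbe) E (y := μ') (y' := μ) (y'' := μ')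
    (x := i') (x' := i) (x'' := i') b.inv a.inv rfl b a rfl rfl
  refine (LinearMap.congr_fun h1 s).symm.trans ?_
  refine Eq.trans ?_ (LinearMap.congr_fun
    (Kernel.act_id (X := α.gerbe) (Y := β.gerbe) E μ' i' rfl) s)
  exact LinearMap.congr_fun (Kernel.act_congr (X := α.gerbe) (Y := β.gerbe) E
    (y := μ') (y' := μ') (x := i') (x' := i') (MarkedTwoRep.Arrow.inv_comp b)
    (MarkedTwoRep.Arrow.inv_comp a) rfl rfl) s

end fact

/-- The Hilbert space `⊕_i (1 / k_i) ⟨μ | E | i⟩ ⊗ Hom (e_i, a)`. -/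
def space (μ : β.idx) (a : α.carrier) : Hilb.{u} :=
  conv α.kc α.kc_pos (fun i => fib E μ i) (fun i => homHilb (α.e i) a)

section space

variable {μ μ' μ'' : β.idx} {a b c : α.carrier}

/-- The element `s ⊗ x` of the summand at `i`. -/
def tm (i : α.idx) : fib E μ i →ₗ[ℂ] (α.e i ⟶ a) →ₗ[ℂ] space E μ a :=
  (conv.mk (k := α.kc) (hk := α.kc_pos) (V := fun i => fib E μ i)
    (W := fun i => homHilb (α.e i) a) i).compl₂ (homVec (α.e i) a).toLinearMap

/-- Linear maps out of `space E μ a` are families of bilinear maps. -/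
def slift {M : Type u₁} [AddCommGroup M] [Module ℂ M]
    (B : (i : α.idx) → fib E μ i →ₗ[ℂ] (α.e i ⟶ a) →ₗ[ℂ] M) : space E μ a →ₗ[ℂ] M :=
  conv.lift (k := α.kc) (hk := α.kc_pos) (V := fun i => fib E μ i)
    (W := fun i => homHilb (α.e i) a) B

lemma slift_tm {M : Type u₁} [AddCommGroup M] [Module ℂ M]
    (B : (i : α.idx) → fib E μ i →ₗ[ℂ] (α.e i ⟶ a) →ₗ[ℂ] M) (i : α.idx) (s : fib E μ i)
    (x : α.e i ⟶ a) : slift E B (tm E i s x) = B i s x :=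
  conv.lift_mk (k := α.kc) (hk := α.kc_pos) (V := fun i => fib E μ i)
    (W := fun i => homHilb (α.e i) a) B i s x

variable {E}

lemma space_induction {p : space E μ a → Prop} (s : space E μ a) (h0 : p 0)
    (hadd : ∀ s t, p s → p t → p (s + t)) (hmk : ∀ i s x, p (tm E i s x)) : p s :=
  conv.induction (k := α.kc) (hk := α.kc_pos) (V := fun i => fib E μ i)
    (W := fun i => homHilb (α.e i) a) s h0 hadd hmk

lemma space_hom_ext {M : Type u₁} [AddCommGroup M] [Module ℂ M] {f f' : space E μ a →ₗ[ℂ] M}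
    (h : ∀ i s x, f (tm E i s x) = f' (tm E i s x)) : f = f' :=
  conv.hom_ext (k := α.kc) (hk := α.kc_pos) (V := fun i => fib E μ i)
    (W := fun i => homHilb (α.e i) a) h

lemma ip_tm (i : α.idx) (s s' : fib E μ i) (x x' : α.e i ⟶ a) :
    Hilb.ip (tm E i s x) (tm E i s' x') =
      ((1 / α.kc i : ℝ) : ℂ) * (Hilb.ip s s' * homIp x x') :=
  conv.ip_mk (k := α.kc) (hk := α.kc_pos) (V := fun i => fib E μ i)
    (W := fun i => homHilb (α.e i) a) i s s' x x'

lemma ip_tm_ne {i j : α.idx} (h : i ≠ j) (s : fib E μ i) (s' : fib E μ j) (x : α.e i ⟶ a)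
    (x' : α.e j ⟶ a) : Hilb.ip (tm E i s x) (tm E j s' x') = 0 :=
  conv.ip_mk_ne (k := α.kc) (hk := α.kc_pos) (V := fun i => fib E μ i)
    (W := fun i => homHilb (α.e i) a) h s s' x x'

variable (E μ) in
/-- The functoriality of `space E μ a` in `a`. -/
def smap (f : a ⟶ b) : space E μ a →ₗ[ℂ] space E μ b :=
  slift E fun i => (tm E i).compl₂ (Linear.rightComp ℂ (α.e i) f)

lemma smap_tm (f : a ⟶ b) (i : α.idx) (s : fib E μ i) (x : α.e i ⟶ a) :
    smap E μ f (tm E i s x) = tm E i s (x ≫ f) := by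
  rw [smap, slift_tm]
  rfl

lemma smap_id : smap E μ (𝟙 a) = LinearMap.id := space_hom_ext fun i s x => by
  rw [smap_tm, Category.comp_id, LinearMap.id_apply]

lemma smap_comp (f : a ⟶ b) (f' : b ⟶ c) : smap E μ (f ≫ f') = smap E μ f' ∘ₗ smap E μ f :=
  space_hom_ext fun i s x => by
    rw [smap_tm, LinearMap.comp_apply, smap_tm, smap_tm, Category.assoc]

lemma smap_add (f f' : a ⟶ b) : smap E μ (f + f') = smap E μ f + smap E μ f' :=
  space_hom_ext fun i s x => by
    rw [smap_tm, LinearMap.add_apply, smap_tm, smap_tm, Preadditive.comp_add, map_add]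

lemma smap_smul (r : ℂ) (f : a ⟶ b) : smap E μ (r • f) = r • smap E μ f :=
  space_hom_ext fun i s x => by
    rw [smap_tm, LinearMap.smul_apply, smap_tm, Linear.comp_smul, map_smul]

/-- Adjoints in `α` act as Hilbert space adjoints on these spaces; this will make the lifted functor
a *-functor. -/
lemma ip_smap_dag (f : a ⟶ b) (s : space E μ b) (t : space E μ a) :
    Hilb.ip (smap E μ (dag f) s) t = Hilb.ip s (smap E μ f t) := by
  induction s using space_induction with
  | h0 => simp only [map_zero, Hilb.ip_zero_left]
  | hadd s s' hs hs' => simp only [map_add, Hilb.ip_add_left, hs, hs']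
  | hmk i s x =>
  induction t using space_induction with
  | h0 => simp only [map_zero, Hilb.ip_zero_right]
  | hadd s s' hs hs' => simp only [map_add, Hilb.ip_add_right, hs, hs']
  | hmk j t y =>
  rw [smap_tm, smap_tm]
  by_cases h : i = j
  · subst h
    rw [ip_tm, ip_tm, homIp_comp_right, dag_dag]
  · rw [ip_tm_ne h, ip_tm_ne h]

end space

section trans

variable {g : G} {μ μ' μ'' : β.idx} {v : β.e μ' ⟶ (β.act g).obj (β.e μ)} (hv : IsUnitary v)

/-- The equivariance of `space E μ a`. On the summand at `i` it is
`s ⊗ x ↦ E(v ⊗ u) s ⊗ α_g(x) u`, where `u` is any unitary `e_j ⟶ α_g (e_i)`. -/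
def trans (a : α.carrier) : space E μ a →ₗ[ℂ] space E μ' ((α.act g).obj a) :=
  slift E fun i => (tm E (α.targetIdx g i)).compl₁₂ (fact E hv (α.targetUnitary_unitary g i))
    (Linear.leftComp ℂ ((α.act g).obj a) (α.targetUnitary g i) ∘ₗ
      (α.actEquiv g (α.e i) a).toLinearMap)

variable {E} {a b : α.carrier}

/-- Independence of the chosen unitary. Two choices have the same source simple and differ by a
phase ζ, which contributes ζ⁻¹ to the action on the fiber of E and ζ to the morphism factor. With
this, every computation may use a convenient `u`. -/
lemma trans_tm {i i' : α.idx} {u : α.e i' ⟶ (α.act g).obj (α.e i)} (hu : IsUnitary u)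
    (s : fib E μ i) (x : α.e i ⟶ a) :
    trans E hv a (tm E i s x) = tm E i' (fact E hv hu s) (u ≫ (α.act g).map x) := by
  rw [trans, slift_tm, LinearMap.compl₁₂_apply]
  suffices h : ∀ (j : α.idx) (u0 : α.e j ⟶ (α.act g).obj (α.e i)) (hu0 : IsUnitary u0),
      tm E j (fact E hv hu0 s) (u0 ≫ (α.act g).map x) =
        tm E i' (fact E hv hu s) (u ≫ (α.act g).map x) from
    h _ _ (α.targetUnitary_unitary g i)
  intro j u0 hu0
  obtain rfl := MarkedTwoRep.Arrow.target_eq hu hu0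
  obtain ⟨ζ, rfl⟩ := MarkedTwoRep.Arrow.exists_eq_smul hu hu0
  rw [fact_smul_right E hv hu, Linear.smul_comp, map_smul, map_smul, LinearMap.smul_apply,
    smul_smul, ← Circle.coe_mul, mul_inv_cancel, Circle.coe_one, one_smul]

lemma trans_smul (ζ : Circle) (hv' : IsUnitary ((ζ : ℂ) • v)) (s : space E μ a) :
    trans E hv' a s = (ζ : ℂ) • trans E hv a s := by
  refine LinearMap.congr_fun (g := (ζ : ℂ) • trans E hv a) (space_hom_ext fun i s x => ?_) s
  obtain ⟨i', u, hu⟩ := α.exists_unitary_from g i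
  rw [LinearMap.smul_apply, trans_tm hv' hu, trans_tm hv hu, fact_smul_left E hv hu, map_smul,
    LinearMap.smul_apply]

lemma smap_trans (f : a ⟶ b) (s : space E μ a) :
    smap E μ' ((α.act g).map f) (trans E hv a s) = trans E hv b (smap E μ f s) := by
  refine LinearMap.congr_fun (f := smap E μ' ((α.act g).map f) ∘ₗ trans E hv a)
    (g := trans E hv b ∘ₗ smap E μ f) (space_hom_ext fun i s x => ?_) s
  obtain ⟨i', u, hu⟩ := α.exists_unitary_from g i
  rw [LinearMap.comp_apply, LinearMap.comp_apply, smap_tm, trans_tm hv hu, trans_tm hv hu,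
    smap_tm, Functor.map_comp, Category.assoc]

/-- Each factor of a summand is preserved, and so is the weight 1/k_i, because the metric is
invariant. Different summands go to different summands. -/
lemma ip_trans (s t : space E μ a) : Hilb.ip (trans E hv a s) (trans E hv a t) = Hilb.ip s t := by
  induction s using space_induction with
  | h0 => simp only [map_zero, Hilb.ip_zero_left]
  | hadd s s' hs hs' => simp only [map_add, Hilb.ip_add_left, hs, hs']
  | hmk i s x =>
  induction t using space_induction with
  | h0 => simp only [map_zero, Hilb.ip_zero_right]
  | hadd s s' hs hs' => simp only [map_add, Hilb.ip_add_right, hs, hs']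
  | hmk j t y =>
  obtain ⟨i', u, hu⟩ := α.exists_unitary_from g i
  obtain ⟨j', u', hu'⟩ := α.exists_unitary_from g j
  rw [trans_tm hv hu, trans_tm hv hu']
  by_cases h : i = j
  · subst h
    obtain rfl := MarkedTwoRep.Arrow.target_eq hu hu'
    obtain ⟨ζ, rfl⟩ := MarkedTwoRep.Arrow.exists_eq_smul hu hu'
    have hk : α.kc i' = α.kc i := congrArg Complex.re (α.k_aux ⟨g, u, hu⟩)
    -- The unitaries chosen for the two tensors may differ by a phase; the second image is
    -- recomputed with the first unitary.
    have h1 : tm E i' (fact E hv hu' t) (((ζ : ℂ) • u) ≫ (α.act g).map y) =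
        tm E i' (fact E hv hu t) (u ≫ (α.act g).map y) := by
      rw [← trans_tm hv hu', ← trans_tm hv hu]
    rw [h1, ip_tm, ip_tm, ip_fact, homIp_unitary_comp hu, α.act_isometry, hk]
  · have h' : i' ≠ j' := by
      rintro rfl
      exact h (MarkedTwoRep.Arrow.source_eq hu hu')
    rw [ip_tm_ne h, ip_tm_ne h']

/-- A pure tensor is hit because the action on fibers is surjective and α_g is full. -/
lemma trans_surjective : Function.Surjective (trans E hv a) := by
  intro s
  induction s using space_induction with
  | h0 => exact ⟨0, map_zero _⟩
  | hadd s s' hs hs' =>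
    obtain ⟨t, rfl⟩ := hs
    obtain ⟨t', rfl⟩ := hs'
    exact ⟨t + t', map_add _ _ _⟩
  | hmk i' s y =>
    obtain ⟨i, u, hu⟩ := α.exists_unitary_to g i'
    obtain ⟨x, rfl⟩ := MarkedTwoRep.exists_eq_comp_map hu y
    obtain ⟨t, rfl⟩ := fact_surjective E hv hu s
    exact ⟨tm E i t x, trans_tm hv hu t x⟩

/-- If u₁ and u₂ are used for the two steps, their composite in the gerbe may be used for the
product. Functoriality of E handles the fibers, and naturality of a(g₂, g₁) the morphism factor. -/
lemma trans_comp {g₁ g₂ g : G} (h : g₂ * g₁ = g)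
    {v₁ : β.e μ' ⟶ (β.act g₁).obj (β.e μ)} {v₂ : β.e μ'' ⟶ (β.act g₂).obj (β.e μ')}
    (hv₁ : IsUnitary v₁) (hv₂ : IsUnitary v₂) (s : space E μ a) :
    trans E (MarkedTwoRep.Arrow.compU_unitary h hv₁ hv₂) a s =
      smap E μ'' ((α.mul g₂ g₁ g h).hom.app a) (trans E hv₂ _ (trans E hv₁ a s)) := by
  refine LinearMap.congr_fun (g := smap E μ'' ((α.mul g₂ g₁ g h).hom.app a) ∘ₗ
    trans E hv₂ _ ∘ₗ trans E hv₁ a) (space_hom_ext fun i s x => ?_) s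
  obtain ⟨i', u₁, hu₁⟩ := α.exists_unitary_from g₁ i
  obtain ⟨i'', u₂, hu₂⟩ := α.exists_unitary_from g₂ i'
  have hn := (α.mul g₂ g₁ g h).hom.naturality x
  rw [LinearMap.comp_apply, LinearMap.comp_apply, trans_tm hv₁ hu₁, trans_tm hv₂ hu₂,
    trans_tm _ (MarkedTwoRep.Arrow.compU_unitary h hu₁ hu₂), fact_comp]
  refine Eq.trans ?_ (smap_tm _ _ _ _).symm
  refine congrArg (tm E i'' _) ?_
  simp only [Functor.comp_map] at hn
  simp only [MarkedTwoRep.Arrow.compU, Functor.map_comp, Category.assoc]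
  erw [hn]

lemma trans_unit (s : space E μ a) :
    trans E (β.unit_unitary (β.e μ)) a s = smap E μ (α.unit.hom.app a) s := by
  refine LinearMap.congr_fun (g := smap E μ (α.unit.hom.app a))
    (space_hom_ext fun i s x => ?_) s
  have hn := α.unit.hom.naturality x
  rw [trans_tm _ (α.unit_unitary (α.e i)), fact_unit, smap_tm]
  exact congrArg (tm E i s) hn.symm

end trans

end KernelLift

end

end TwoRepGerbe

namespace TwoRepGerbe

noncomputable section

open MarkedTwoHilb

/-! ### The intertwiner lifting a morphism of gerbes -/

namespace KernelLift

variable {G : Type w} [Group G] {α β : MarkedTwoRep.{w, v, u} G}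
  (E : Kernel α.gerbe β.gerbe)

/-- The object of `β` with morphism spaces `Hom (e_μ, -)` given by `space E μ a`. -/
def obj (a : α.carrier) : β.carrier :=
  (exists_object (H := β.toMarkedTwoHilb) fun μ => space E μ a).choose

/-- The identification of `space E μ a` with a space of morphisms. -/
def J (μ : β.idx) (a : α.carrier) : space E μ a ≃ₗ[ℂ] (β.e μ ⟶ obj E a) :=
  (exists_object (H := β.toMarkedTwoHilb) fun μ => space E μ a).choose_spec.choose μ

variable {E}
variable {μ : β.idx} {a b c : α.carrier}

lemma homIp_J (s t : space E μ a) : homIp (J E μ a s) (J E μ a t) = Hilb.ip s t :=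
  (exists_object (H := β.toMarkedTwoHilb) fun μ => space E μ a).choose_spec.choose_spec μ s t

/-- The morphisms `J E μ a s` exhaust those from simples into the lifted object, so identities
between morphisms out of it become identities in the spaces `space E μ a`. -/
lemma hom_ext_J {x : β.carrier} {f f' : obj E a ⟶ x}
    (h : ∀ (μ : β.idx) (s : space E μ a), J E μ a s ≫ f = J E μ a s ≫ f') : f = f' :=
  hom_ext_e fun μ q => by
    obtain ⟨s, rfl⟩ := (J E μ a).surjective q
    exact h μ s

variable (E) in
/-- The action of the lifted functor on morphisms. -/
def map (f : a ⟶ b) : obj E a ⟶ obj E b :=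
  ofLinear fun μ => (J E μ b).toLinearMap ∘ₗ smap E μ f ∘ₗ (J E μ a).symm.toLinearMap

lemma J_comp_map (f : a ⟶ b) (s : space E μ a) : J E μ a s ≫ map E f = J E μ b (smap E μ f s) := by
  rw [map, comp_ofLinear]
  simp

lemma map_dag (f : a ⟶ b) : map E (dag f) = dag (map E f) :=
  hom_ext_J fun μ s => eq_of_homIp_left fun r => by
    obtain ⟨t, rfl⟩ := (J E μ a).surjective r
    rw [J_comp_map, homIp_comp_right, dag_dag, J_comp_map, homIp_J, homIp_J, ip_smap_dag]

variable (E) in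
/-- The lifted functor. -/
def functor : α.carrier ⥤ β.carrier where
  obj := obj E
  map := map E
  map_id a := hom_ext_J fun μ s => by
    rw [J_comp_map, smap_id, LinearMap.id_apply, Category.comp_id]
  map_comp f f' := hom_ext_J fun μ s => by
    rw [J_comp_map, smap_comp, LinearMap.comp_apply, ← Category.assoc, J_comp_map, J_comp_map]

lemma J_comp_functor_map (f : a ⟶ b) (s : space E μ a) :
    J E μ a s ≫ (functor E).map f = J E μ b (smap E μ f s) := J_comp_map f s

variable (E) in
lemma functor_star : IsStarFunctor (functor E) where
  map_add f f' := hom_ext_J fun μ s => by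
    rw [J_comp_functor_map, smap_add, LinearMap.add_apply, map_add]
    erw [Preadditive.comp_add]
    rw [J_comp_functor_map, J_comp_functor_map]
    rfl
  map_smul r f := hom_ext_J fun μ s => by
    rw [J_comp_functor_map, smap_smul, LinearMap.smul_apply, map_smul]
    erw [Linear.comp_smul]
    rw [J_comp_functor_map]
    rfl
  map_dag f := map_dag f

lemma exists_eq_comp_map_J (g : G) {μ' : β.idx} (q : β.e μ' ⟶ (β.act g).obj (obj E a)) :
    ∃ (μ : β.idx) (v : β.e μ' ⟶ (β.act g).obj (β.e μ)) (_ : IsUnitary v) (s : space E μ a),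
      q = v ≫ (β.act g).map (J E μ a s) := by
  obtain ⟨μ, v, hv⟩ := β.exists_unitary_to g μ'
  obtain ⟨l, rfl⟩ := MarkedTwoRep.exists_eq_comp_map hv q
  obtain ⟨s, rfl⟩ := (J E μ a).surjective l
  exact ⟨μ, v, hv, s, rfl⟩

lemma act_hom_ext_J {g : G} {x : β.carrier} {f f' : (β.act g).obj (obj E a) ⟶ x}
    (h : ∀ (μ μ' : β.idx) (v : β.e μ' ⟶ (β.act g).obj (β.e μ)) (_ : IsUnitary v)
      (s : space E μ a), v ≫ (β.act g).map (J E μ a s) ≫ f =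
        v ≫ (β.act g).map (J E μ a s) ≫ f') : f = f' :=
  hom_ext_e fun μ' q => by
    obtain ⟨μ, v, hv, s, rfl⟩ := exists_eq_comp_map_J g q
    rw [Category.assoc, Category.assoc, h μ μ' v hv s]

variable (E) in
-- Every morphism from a simple into β_g(σ(a)) has the form β_g(J s) v, and it has to go to
-- J(trans_v s). This is well defined: the pair (ζ v, s) represents the same morphism as (v, ζ s),
-- and `trans` is linear both in the phase of v and in s.
lemma exists_commHom (g : G) (a : α.carrier) :
    ∃ c : (β.act g).obj (obj E a) ⟶ obj E ((α.act g).obj a),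
      ∀ (μ μ' : β.idx) (v : β.e μ' ⟶ (β.act g).obj (β.e μ)) (hv : IsUnitary v)
        (s : space E μ a), v ≫ (β.act g).map (J E μ a s) ≫ c =
          J E μ' ((α.act g).obj a) (trans E hv a s) := by
  -- One unitary for each μ' serves to define the linear maps; independence of the choice then gives
  -- the formula for an arbitrary v.
  choose μ₀ v₀ hv₀ using fun μ' => β.exists_unitary_to g μ'
  refine ⟨ofLinear fun μ' => (J E μ' ((α.act g).obj a)).toLinearMap ∘ₗ trans E (hv₀ μ') a ∘ₗ
    (J E (μ₀ μ') a).symm.toLinearMap ∘ₗ (β.actEquiv g (β.e (μ₀ μ')) (obj E a)).symm.toLinearMap ∘ₗ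
    Linear.leftComp ℂ ((β.act g).obj (obj E a)) (dag (v₀ μ')), ?_⟩
  intro μ μ' v hv s
  suffices h : ∀ (μ₁ : β.idx) (v₁ : β.e μ' ⟶ (β.act g).obj (β.e μ₁)) (hv₁ : IsUnitary v₁),
      trans E hv₁ a ((J E μ₁ a).symm ((β.actEquiv g (β.e μ₁) (obj E a)).symm
        (dag v₁ ≫ v ≫ (β.act g).map (J E μ a s)))) = trans E hv a s by
    rw [← Category.assoc, comp_ofLinear]
    exact congrArg (J E μ' ((α.act g).obj a)) (h _ _ (hv₀ μ'))
  intro μ₁ v₁ hv₁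
  obtain rfl := MarkedTwoRep.Arrow.source_eq hv hv₁
  obtain ⟨ζ, rfl⟩ := MarkedTwoRep.Arrow.exists_eq_smul hv₁ hv
  -- The phase between the two unitaries is absorbed into the vector `s`.
  have h1 : dag v₁ ≫ ((ζ : ℂ) • v₁) ≫ (β.act g).map (J E μ a s) =
      β.actEquiv g (β.e μ) (obj E a) (J E μ a ((ζ : ℂ) • s)) := by
    rw [Linear.smul_comp, Linear.comp_smul, ← Category.assoc, hv₁.dag_comp, Category.id_comp,
      map_smul, map_smul]
    rfl
  rw [h1, LinearEquiv.symm_apply_apply, LinearEquiv.symm_apply_apply, map_smul,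
    trans_smul hv₁ ζ hv]

variable (E) in
/-- The components of the equivariance isomorphisms of the lifted functor. -/
def commHom (g : G) (a : α.carrier) : (β.act g).obj (obj E a) ⟶ obj E ((α.act g).obj a) :=
  (exists_commHom E g a).choose

lemma map_J_comp_commHom {g : G} {μ μ' : β.idx} {v : β.e μ' ⟶ (β.act g).obj (β.e μ)}
    (hv : IsUnitary v) (s : space E μ a) : v ≫ (β.act g).map (J E μ a s) ≫ commHom E g a =
      J E μ' ((α.act g).obj a) (trans E hv a s) :=
  (exists_commHom E g a).choose_spec μ μ' v hv s

/-- On morphisms from simples this is `trans`, which is isometric and surjective. -/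
lemma commHom_unitary (g : G) (a : α.carrier) : IsUnitary (commHom E g a) := by
  refine isUnitary_of_isometry _ (fun μ' q r => ?_) (fun μ' r => ?_)
  · obtain ⟨μ, v, hv, s, rfl⟩ := exists_eq_comp_map_J g q
    obtain ⟨l, rfl⟩ := MarkedTwoRep.exists_eq_comp_map hv r
    obtain ⟨t, rfl⟩ := (J E μ a).surjective l
    rw [Category.assoc, Category.assoc, map_J_comp_commHom hv, map_J_comp_commHom hv, homIp_J,
      ip_trans, homIp_unitary_comp hv, β.act_isometry, homIp_J]
  · obtain ⟨s, rfl⟩ := (J E μ' ((α.act g).obj a)).surjective r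
    obtain ⟨μ, v, hv⟩ := β.exists_unitary_to g μ'
    obtain ⟨t, rfl⟩ := trans_surjective hv s
    exact ⟨v ≫ (β.act g).map (J E μ a t), by rw [Category.assoc, map_J_comp_commHom hv]⟩

lemma commHom_naturality (g : G) (f : a ⟶ b) :
    (β.act g).map (map E f) ≫ commHom E g b = commHom E g a ≫ map E ((α.act g).map f) := by
  refine act_hom_ext_J fun μ μ' v hv s => ?_
  rw [← Functor.map_comp_assoc, J_comp_map, map_J_comp_commHom hv, ← smap_trans hv,
    ← J_comp_map, ← map_J_comp_commHom hv, Category.assoc, Category.assoc]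

/-- Tested on the morphisms β_{g₂}(β_{g₁}(J s) v₁) v₂, the coherence condition becomes `trans_comp`.
Naturality of the multiplication isomorphism of `β` assembles v₁ and v₂ into the composite arrow. -/
lemma commHom_mul (g₂ g₁ g : G) (h : g₂ * g₁ = g) (a : α.carrier) :
    (β.mul g₂ g₁ g h).hom.app (obj E a) ≫ commHom E g a =
      (β.act g₂).map (commHom E g₁ a) ≫ commHom E g₂ ((α.act g₁).obj a) ≫
        map E ((α.mul g₂ g₁ g h).hom.app a) := by
  refine hom_ext_e fun μ'' q => ?_
  obtain ⟨μ', v₂, hv₂⟩ := β.exists_unitary_to g₂ μ''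
  obtain ⟨l, rfl⟩ := MarkedTwoRep.exists_eq_comp_map hv₂ q
  obtain ⟨μ, v₁, hv₁, s, rfl⟩ := exists_eq_comp_map_J g₁ l
  have hn := (β.mul g₂ g₁ g h).hom.naturality (J E μ a s)
  have h1 := map_J_comp_commHom (MarkedTwoRep.Arrow.compU_unitary h hv₁ hv₂) s
  rw [trans_comp h hv₁ hv₂] at h1
  have h2 := congrArg (· ≫ map E ((α.mul g₂ g₁ g h).hom.app a))
    (map_J_comp_commHom hv₂ (trans E hv₁ a s))
  rw [← map_J_comp_commHom hv₁] at h2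
  simp only [MarkedTwoRep.Arrow.compU, Functor.comp_map, Functor.map_comp, Category.assoc]
    at hn h1 h2 ⊢
  erw [reassoc_of% hn, h1, h2]
  exact (J_comp_map _ _).symm

lemma commHom_unit (a : α.carrier) :
    β.unit.hom.app (obj E a) ≫ commHom E 1 a = map E (α.unit.hom.app a) := by
  refine hom_ext_J fun μ s => ?_
  have hn := β.unit.hom.naturality (J E μ a s)
  have h1 := map_J_comp_commHom (β.unit_unitary (β.e μ)) s
  rw [trans_unit] at h1
  simp only [Functor.id_map] at hn
  erw [reassoc_of% hn, h1]
  exact (J_comp_map _ _).symm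

variable (E) in
/-- The intertwiner of a morphism of gerbes. -/
def lift : Intertwiner α β where
  functor := functor E
  star := functor_star E
  comm g := NatIso.ofComponents (fun a => (commHom_unitary (E := E) g a).iso)
    (fun f => commHom_naturality g f)
  comm_unitary g a := commHom_unitary g a
  comm_mul g₂ g₁ g h a := commHom_mul g₂ g₁ g h a
  comm_unit a := commHom_unit a

variable (E) in
/-- The map `s ↦ s ⊗ id`. -/
def fiberMap (μ : β.idx) (i : α.idx) : fib E μ i →ₗ[ℂ] (β.e μ ⟶ obj E (α.e i)) :=
  (J E μ (α.e i)).toLinearMap ∘ₗ (tm E i).flip (𝟙 (α.e i))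

lemma fiberMap_apply (μ : β.idx) (i : α.idx) (s : fib E μ i) :
    fiberMap E μ i s = J E μ (α.e i) (tm E i s (𝟙 (α.e i))) := rfl

/-- By Schur's lemma only the i-th summand of `space E μ (e i)` survives, and there the second
factor is the line spanned by the identity. For injectivity, the norm squared k_i of the identity
cancels the weight 1/k_i. -/
lemma fiberMap_bijective (μ : β.idx) (i : α.idx) : Function.Bijective (fiberMap E μ i) := by
  refine (J E μ (α.e i)).bijective.comp ⟨?_, fun s => ?_⟩
  · refine LinearMap.ker_eq_bot.1 (LinearMap.ker_eq_bot'.2 fun s hs => ?_)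
    have h1 : Hilb.ip (tm E i s (𝟙 (α.e i))) (tm E i s (𝟙 (α.e i))) = 0 := by
      have h2 : tm E i s (𝟙 (α.e i)) = 0 := hs
      rw [h2, Hilb.ip_zero_left]
    rw [ip_tm, homIp_id] at h1
    have hk : (α.kc i : ℂ) ≠ 0 := Complex.ofReal_ne_zero.2 (α.kc_pos i).ne'
    have hk' : ((1 / α.kc i : ℝ) : ℂ) ≠ 0 :=
      Complex.ofReal_ne_zero.2 (one_div_pos.2 (α.kc_pos i)).ne'
    exact Hilb.eq_zero_of_ip_self
      ((mul_eq_zero.1 ((mul_eq_zero.1 h1).resolve_left hk')).resolve_right hk)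
  · induction s using space_induction with
    | h0 => exact ⟨0, map_zero _⟩
    | hadd s s' hs hs' =>
      obtain ⟨t, rfl⟩ := hs
      obtain ⟨t', rfl⟩ := hs'
      exact ⟨t + t', map_add _ _ _⟩
    | hmk j s x =>
      by_cases h : j = i
      · subst h
        obtain ⟨c, rfl⟩ := (α.isSimple_e j).exists_smul x
        refine ⟨c • s, ?_⟩
        change tm E j (c • s) (𝟙 (α.e j)) = _
        rw [map_smul, map_smul, LinearMap.smul_apply]
      · rw [hom_eq_zero h x, map_zero]
        exact ⟨0, map_zero _⟩

/-- Computing σ(g) with the same unitary u sends s ⊗ id to E(v ⊗ u) s ⊗ u; the σ(u)^* in the action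
on ⟨σ⟩ turns the second factor back into id. -/
lemma fiberMap_act {g : G} {μ μ' : β.idx} {i i' : α.idx} {v : β.e μ' ⟶ (β.act g).obj (β.e μ)}
    (hv : IsUnitary v) {u : α.e i' ⟶ (α.act g).obj (α.e i)} (hu : IsUnitary u) (s : fib E μ i) :
    fiberMap E μ' i' (fact E hv hu s) = (lift E).fiberMap v u (fiberMap E μ i s) := by
  have h1 := map_J_comp_commHom hv (tm E i s (𝟙 (α.e i)))
  change fiberMap E μ' i' _ = v ≫ (β.act g).map (J E μ (α.e i) (tm E i s (𝟙 (α.e i)))) ≫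
    commHom E g (α.e i) ≫ dag (map E u)
  rw [← map_dag, reassoc_of% h1, trans_tm hv hu, J_comp_map, smap_tm, (α.act g).map_id,
    Category.comp_id, hu.comp_dag, fiberMap_apply]

lemma fiberMap_arrow {μ μ' : β.idx} {i i' : α.idx} (b : β.Arrow μ μ') (a : α.Arrow i i')
    (h : b.deg = a.deg) (s : fib E μ i) :
    fiberMap E μ' i' (Kernel.act (X := α.gerbe) (Y := β.gerbe) E (y := μ) (y' := μ') (x := i)
      (x' := i') b a h s) = (lift E).arrowHom b a h (fiberMap E μ i s) := by
  obtain ⟨g, v, hv⟩ := b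
  obtain ⟨_, u, hu⟩ := a
  dsimp only at h
  subst h
  exact fiberMap_act hv hu s

variable (E) in
/-- A morphism of gerbes is isomorphic to the morphism extracted from its lift. -/
def liftIso : E ≅ (lift E).kernel :=
  Kernel.isoOfBijective (X := α.gerbe) (Y := β.gerbe)
    (Kernel.homOfAct (X := α.gerbe) (Y := β.gerbe) (fiberMap E)
      (fun b a h s => fiberMap_arrow b a h s))
    (fun μ i => fiberMap_bijective μ i)

end KernelLift

open Intertwiner in
lemma extraction_local_isEquivalence {G : Type w} [Group G] (α β : MarkedTwoRep.{w, v, u} G) :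
    ((extractionStructure.{w, v, u} G).toPseudofunctor.mapFunctor α β).IsEquivalence where
  faithful := ⟨fun {σ ρ} _ _ h => kernelHom_injective (σ := σ) (ρ := ρ) h⟩
  full := ⟨fun {σ ρ} φ => kernelHom_surjective (σ := σ) (ρ := ρ) φ⟩
  essSurj := ⟨fun E => ⟨KernelLift.lift E, ⟨(KernelLift.liftIso E).symm⟩⟩⟩

end

end TwoRepGerbe

namespace TwoRepGerbe

noncomputable section

/-! ## Matrices with coefficients in `ℂ` -/

/-- Factor the idempotent through its range, in a basis of the range. -/
lemma exists_splitting {n : ℕ} (M : Matrix (Fin n) (Fin n) ℂ) (hM : M * M = M) :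
    ∃ (r : ℕ) (A : Matrix (Fin n) (Fin r) ℂ) (B : Matrix (Fin r) (Fin n) ℂ),
      B * A = 1 ∧ A * B = M := by
  classical
  let L := Matrix.toLin' M
  have hL : ∀ v, L (L v) = L v := fun v => by
    rw [← LinearMap.comp_apply, ← Matrix.toLin'_mul, hM]
  let b := Module.finBasis ℂ (LinearMap.range L)
  let c := Pi.basisFun ℂ (Fin n)
  refine ⟨_, LinearMap.toMatrix b c (Submodule.subtype _), LinearMap.toMatrix c b L.rangeRestrict,
    ?_, ?_⟩
  · rw [← LinearMap.toMatrix_comp, ← LinearMap.toMatrix_id b]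
    refine congrArg _ (LinearMap.ext ?_)
    rintro ⟨_, v, rfl⟩
    exact Subtype.ext (hL v)
  · rw [← LinearMap.toMatrix_comp]
    exact LinearMap.toMatrix'_toLin' M

/-- The identity matrix, with its rows and columns indexed by equal numbers. -/
def castMatrix {m n : ℕ} (h : m = n) : Matrix (Fin m) (Fin n) ℂ :=
  (1 : Matrix (Fin n) (Fin n) ℂ).submatrix (Fin.cast h) id

lemma castMatrix_rfl (m : ℕ) : castMatrix (rfl : m = m) = 1 := rfl

/-- Dimensions that agree only propositionally are compared through these identity matrices. Since
any two with the same sizes coincide and they compose, they cancel wherever they meet. -/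
lemma castMatrix_mul {l m n : ℕ} (h : l = m) (h' : m = n) :
    castMatrix h * castMatrix h' = castMatrix (h.trans h') := by
  subst h h'
  rw [castMatrix_rfl, one_mul]

lemma castMatrix_conjTranspose {m n : ℕ} (h : m = n) :
    (castMatrix h).conjTranspose = castMatrix h.symm := by
  subst h
  rw [castMatrix_rfl, Matrix.conjTranspose_one]

/-! ### The 2-Hilbert space of families of matrices over the points of a gerbe -/

namespace Gerbe

variable {G : Type w} [Group G] (X : Gerbe.{w, u} G)

/-- The objects of the 2-Hilbert space of `X`: the functions from the points of `X` to the natural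
numbers, in an arbitrary universe. An object represents a family of Hilbert spaces `ℂ ^ n`. -/
structure ModelObj : Type v where
  /-- An encoding of the dimensions. -/
  code : Shrink.{v} (X.pt → ℕ)

namespace ModelObj

variable {X}

/-- The dimensions of the spaces in a family. -/
def dim (a : ModelObj.{w, v, u} X) : X.pt → ℕ := (equivShrink.{v, u} (X.pt → ℕ)).symm a.code

variable (X) in
/-- The family of Hilbert spaces of given dimensions. -/
def of (d : X.pt → ℕ) : ModelObj.{w, v, u} X := ⟨equivShrink.{v, u} (X.pt → ℕ) d⟩

@[simp] lemma dim_of (d : X.pt → ℕ) : dim (of.{w, v, u} X d) = d :=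
  (equivShrink.{v, u} (X.pt → ℕ)).symm_apply_apply d

lemma ext {a b : ModelObj.{w, v, u} X} (h : dim a = dim b) : a = b := by
  obtain ⟨a⟩ := a
  obtain ⟨b⟩ := b
  exact congrArg mk ((equivShrink.{v, u} (X.pt → ℕ)).symm.injective h)

instance : Category.{u} (ModelObj.{w, v, u} X) where
  Hom a b := (x : X.pt) → Matrix (Fin (dim a x)) (Fin (dim b x)) ℂ
  id _ := fun _ => 1
  comp f g := fun x => f x * g x
  id_comp _ := funext fun _ => Matrix.one_mul _
  comp_id _ := funext fun _ => Matrix.mul_one _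
  assoc _ _ _ := funext fun _ => Matrix.mul_assoc _ _ _

variable {a b c : ModelObj.{w, v, u} X}

/-- The matrix of a morphism at a point. -/
def mat (f : a ⟶ b) (x : X.pt) : Matrix (Fin (dim a x)) (Fin (dim b x)) ℂ := f x

/-- The morphism with given matrices. -/
def homMk (f : (x : X.pt) → Matrix (Fin (dim a x)) (Fin (dim b x)) ℂ) : a ⟶ b := f

@[simp] lemma mat_homMk (f : (x : X.pt) → Matrix (Fin (dim a x)) (Fin (dim b x)) ℂ) (x : X.pt) :
    mat (homMk f) x = f x := rfl

lemma hom_ext {f g : a ⟶ b} (h : ∀ x, mat f x = mat g x) : f = g := funext h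

@[simp] lemma mat_id (a : ModelObj.{w, v, u} X) (x : X.pt) : mat (𝟙 a) x = 1 := rfl

@[simp] lemma mat_comp (f : a ⟶ b) (g : b ⟶ c) (x : X.pt) : mat (f ≫ g) x = mat f x * mat g x := rfl

instance : AddCommGroup (a ⟶ b) :=
  inferInstanceAs (AddCommGroup ((x : X.pt) → Matrix (Fin (dim a x)) (Fin (dim b x)) ℂ))

instance : Module ℂ (a ⟶ b) :=
  inferInstanceAs (Module ℂ ((x : X.pt) → Matrix (Fin (dim a x)) (Fin (dim b x)) ℂ))

@[simp] lemma mat_add (f g : a ⟶ b) (x : X.pt) : mat (f + g) x = mat f x + mat g x := rfl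

@[simp] lemma mat_smul (r : ℂ) (f : a ⟶ b) (x : X.pt) : mat (r • f) x = r • mat f x := rfl

instance : Preadditive (ModelObj.{w, v, u} X) where
  homGroup _ _ := inferInstance
  add_comp _ _ _ f f' g := hom_ext fun x => Matrix.add_mul (mat f x) (mat f' x) (mat g x)
  comp_add _ _ _ f g g' := hom_ext fun x => Matrix.mul_add (mat f x) (mat g x) (mat g' x)

instance : Linear ℂ (ModelObj.{w, v, u} X) where
  homModule a b := inferInstanceAs
    (Module ℂ ((x : X.pt) → Matrix (Fin (dim a x)) (Fin (dim b x)) ℂ))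
  smul_comp _ _ _ r f g := hom_ext fun x => Matrix.smul_mul r (mat f x) (mat g x)
  comp_smul _ _ _ f r g := hom_ext fun x => Matrix.mul_smul (mat f x) r (mat g x)

@[simp] lemma mat_sum {ι : Type*} (s : Finset ι) (f : ι → (a ⟶ b)) (x : X.pt) :
    mat (∑ i ∈ s, f i) x = ∑ i ∈ s, mat (f i) x :=
  map_sum ({ toFun := fun f => mat f x, map_zero' := rfl, map_add' := fun _ _ => rfl } :
    (a ⟶ b) →+ Matrix (Fin (dim a x)) (Fin (dim b x)) ℂ) f s

/-- The inner product of two families of matrices, `∑ x, k_x Tr (f_x^* g_x)`. -/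
def inner (f g : a ⟶ b) : ℂ :=
  ∑ x, (X.k x : ℂ) * ((mat f x).conjTranspose * mat g x).trace

lemma trace_conjTranspose_mul_self_re_nonneg {m n : ℕ} (A : Matrix (Fin m) (Fin n) ℂ) :
    0 ≤ (A.conjTranspose * A).trace.re := by
  rw [Matrix.trace, Complex.re_sum]
  refine Finset.sum_nonneg fun i _ => ?_
  rw [Matrix.diag_apply, Matrix.mul_apply, Complex.re_sum]
  refine Finset.sum_nonneg fun j _ => ?_
  rw [Matrix.conjTranspose_apply, ← starRingEnd_apply, mul_comm, Complex.mul_conj,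
    Complex.ofReal_re]
  exact Complex.normSq_nonneg _

open ComplexOrder in
lemma eq_zero_of_trace_eq_zero {m n : ℕ} {A : Matrix (Fin m) (Fin n) ℂ}
    (h : (A.conjTranspose * A).trace = 0) : A = 0 :=
  Matrix.trace_conjTranspose_mul_self_eq_zero_iff.1 h

lemma trace_conj_conjTranspose_mul {m n : ℕ} (A B : Matrix (Fin m) (Fin n) ℂ) :
    conj (A.conjTranspose * B).trace = (B.conjTranspose * A).trace := by
  rw [starRingEnd_apply, ← Matrix.trace_conjTranspose, Matrix.conjTranspose_mul,
    Matrix.conjTranspose_conjTranspose]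

/-- The inner product on the spaces of families of matrices. -/
@[reducible] def core (a b : ModelObj.{w, v, u} X) : InnerProductSpace.Core ℂ (a ⟶ b) where
  inner := inner
  conj_inner_symm f g := by
    simp only [inner, map_sum, map_mul, Complex.conj_ofReal, trace_conj_conjTranspose_mul]
  re_inner_nonneg f := by
    simp only [inner, map_sum]
    refine Finset.sum_nonneg fun x _ => ?_
    rw [RCLike.re_to_complex, Complex.re_ofReal_mul]
    exact mul_nonneg (X.k_pos x).le (trace_conjTranspose_mul_self_re_nonneg _)
  add_left f g h := by
    simp only [inner, mat_add, Matrix.conjTranspose_add, Matrix.add_mul, Matrix.trace_add, mul_add,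
      Finset.sum_add_distrib]
  smul_left f g r := by
    simp only [inner, mat_smul, Matrix.conjTranspose_smul, Matrix.smul_mul, Matrix.trace_smul,
      smul_eq_mul, Finset.mul_sum, starRingEnd_apply]
    exact Finset.sum_congr rfl fun x _ => by ring
  definite f hf := by
    have h0 : ∑ x, X.k x * ((mat f x).conjTranspose * mat f x).trace.re = 0 := by
      have := congrArg Complex.re hf
      simpa only [inner, Complex.re_sum, Complex.re_ofReal_mul, Complex.zero_re] using this
    refine hom_ext fun x => ?_
    have h1 := (Finset.sum_eq_zero_iff_of_nonneg fun x _ => mul_nonneg (X.k_pos x).le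
      (trace_conjTranspose_mul_self_re_nonneg (mat f x))).1 h0 x (Finset.mem_univ x)
    have h2 := (mul_eq_zero.1 h1).resolve_left (X.k_pos x).ne'
    have h3 := congrArg Complex.im (trace_conj_conjTranspose_mul (mat f x) (mat f x))
    rw [Complex.conj_im] at h3
    exact eq_zero_of_trace_eq_zero
      (Complex.ext h2 (by rw [Complex.zero_im]; linarith))

instance : HStarCategory (ModelObj.{w, v, u} X) where
  finite a b := inferInstanceAs
    (Module.Finite ℂ ((x : X.pt) → Matrix (Fin (dim a x)) (Fin (dim b x)) ℂ))
  core := core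
  dag f := homMk fun x => (mat f x).conjTranspose
  dag_dag f := hom_ext fun x => Matrix.conjTranspose_conjTranspose _
  dag_add f g := hom_ext fun x => Matrix.conjTranspose_add _ _
  dag_smul r f := hom_ext fun x => Matrix.conjTranspose_smul r (mat f x)
  dag_comp f g := hom_ext fun x => Matrix.conjTranspose_mul _ _
  inner_comp_left f g h := Finset.sum_congr rfl fun x _ => by
    simp only [mat_comp, mat_homMk, Matrix.conjTranspose_mul, Matrix.mul_assoc]
  inner_comp_right f g h := Finset.sum_congr rfl fun x _ => by
    simp only [mat_comp, mat_homMk, Matrix.conjTranspose_mul]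
    rw [Matrix.mul_assoc, Matrix.trace_mul_comm, Matrix.mul_assoc]

@[simp] lemma mat_dag (f : a ⟶ b) (x : X.pt) : mat (dag f) x = (mat f x).conjTranspose := rfl

lemma homIp_eq (f g : a ⟶ b) :
    homIp f g = ∑ x, (X.k x : ℂ) * ((mat f x).conjTranspose * mat g x).trace := rfl

lemma finrank_hom (a b : ModelObj.{w, v, u} X) :
    Module.finrank ℂ (a ⟶ b) = ∑ x, dim a x * dim b x := by
  refine (Module.finrank_pi_fintype ℂ
    (M := fun x => Matrix (Fin (dim a x)) (Fin (dim b x)) ℂ)).trans ?_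
  refine Finset.sum_congr rfl fun x _ => ?_
  rw [Module.finrank_matrix, Module.finrank_self, mul_one, Fintype.card_fin, Fintype.card_fin]

variable (X) in
lemma isIdempotentComplete : IsIdempotentComplete (ModelObj.{w, v, u} X) where
  idempotents_split a p hp := by
    choose r A B h1 h2 using fun x => exists_splitting (mat p x)
      (congrFun hp x)
    have hr : ∀ x, dim (of.{w, v, u} X r) x = r x := fun x => congrFun (dim_of r) x
    refine ⟨of X r, homMk fun x => castMatrix (hr x) * B x,
      homMk fun x => A x * castMatrix (hr x).symm, hom_ext fun x => ?_, hom_ext fun x => ?_⟩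
    · rw [mat_comp, mat_homMk, mat_homMk, mat_id, Matrix.mul_assoc, ← Matrix.mul_assoc (B x), h1,
        Matrix.one_mul, castMatrix_mul, castMatrix_rfl]
    · rw [mat_comp, mat_homMk, mat_homMk, Matrix.mul_assoc, ← Matrix.mul_assoc (castMatrix _),
        castMatrix_mul, castMatrix_rfl, Matrix.one_mul, h2]

variable (X) in
lemma hasFiniteBiproducts : Limits.HasFiniteBiproducts (ModelObj.{w, v, u} X) := by
  classical
  refine ⟨fun n => ⟨fun F => ?_⟩⟩
  let s : ModelObj.{w, v, u} X := of X fun x => ∑ j, dim (F j) x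
  let φ : ∀ x, Fin (dim s x) ≃ (j : Fin n) × Fin (dim (F j) x) := fun x =>
    (finCongr (congrFun (dim_of _) x)).trans finSigmaFinEquiv.symm
  -- Inclusions and projections are cut out of the identity matrix on the disjoint union of the
  -- index sets, so the biproduct identities become identities of its blocks.
  let one : ∀ x, Matrix ((j : Fin n) × Fin (dim (F j) x)) ((j : Fin n) × Fin (dim (F j) x)) ℂ :=
    fun x => 1
  let inj : ∀ j x, Fin (dim (F j) x) → (j : Fin n) × Fin (dim (F j) x) := fun j _ i => ⟨j, i⟩
  let bc : Limits.Bicone F :=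
    { pt := s
      π := fun j => homMk fun x => (one x).submatrix (φ x) (inj j x)
      ι := fun j => homMk fun x => (one x).submatrix (inj j x) (φ x)
      ι_π := fun j j' => hom_ext fun x => by
        rw [mat_comp, mat_homMk, mat_homMk, Matrix.submatrix_mul_equiv, Matrix.mul_one]
        split_ifs with h
        · subst h
          rw [eqToHom_refl, mat_id]
          exact Matrix.submatrix_one (inj j x) fun _ _ h => eq_of_heq (Sigma.mk.inj h).2
        · ext i i'
          exact Matrix.one_apply_ne fun h' => h (congrArg Sigma.fst h') }
  refine Limits.hasBiproduct_of_total bc (hom_ext fun x => ?_)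
  rw [mat_sum, mat_id]
  ext i i'
  rw [Matrix.sum_apply]
  simp only [bc, mat_comp, mat_homMk, Matrix.mul_apply, Matrix.submatrix_apply]
  -- Summing over the summands and then within each is one sum over the disjoint union, that is, an
  -- entry of `one x * one x`.
  refine (Fintype.sum_sigma' fun j l => one x (φ x i) ⟨j, l⟩ * one x ⟨j, l⟩ (φ x i')).symm.trans ?_
  have h : (one x * one x) (φ x i) (φ x i') = (1 : Matrix _ _ ℂ) i i' := by
    simp only [one, Matrix.mul_one, Matrix.one_apply, EmbeddingLike.apply_eq_iff_eq]
  exact h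

open scoped Classical in
/-- The simple object at a point. -/
def simple (x : X.pt) : ModelObj.{w, v, u} X := of X (Pi.single x 1)

@[simp] lemma dim_simple_self (x : X.pt) : dim (simple.{w, v, u} x) x = 1 := by
  classical
  rw [simple, dim_of, Pi.single_eq_same]

lemma dim_simple_ne {x y : X.pt} (h : y ≠ x) : dim (simple.{w, v, u} x) y = 0 := by
  classical
  rw [simple, dim_of]
  exact Pi.single_eq_of_ne h 1

lemma isSimple_simple (x : X.pt) : IsSimple (simple.{w, v, u} x) := by
  rw [IsSimple, finrank_hom, Finset.sum_eq_single x]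
  · rw [dim_simple_self]
  · intro y _ h
    rw [dim_simple_ne h, mul_zero]
  · exact fun h => absurd (Finset.mem_univ x) h

/-- Otherwise the nonzero identity at x would factor through a zero-dimensional space. -/
lemma simple_injective {x y : X.pt} (f : simple.{w, v, u} x ≅ simple.{w, v, u} y) : x = y := by
  by_contra h
  have h0 := dim_simple_ne.{w, v, u} h
  have h1 : mat f.hom x * mat f.inv x = 1 := congrFun f.hom_inv_id x
  have : IsEmpty (Fin (dim (simple.{w, v, u} y) x)) := by
    rw [h0]
    infer_instance
  let i : Fin (dim (simple.{w, v, u} x) x) := Fin.cast (dim_simple_self x).symm 0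
  have h2 := congrFun (congrFun h1 i) i
  rw [Matrix.mul_apply, Finset.univ_eq_empty, Finset.sum_empty, Matrix.one_apply_eq] at h2
  exact zero_ne_one h2

/-- The dimension of End(a) is the sum of the squares of the dimensions of `a`; if it is 1, exactly
one of them is 1 and the others vanish. Objects with equal dimensions are equal, so no isomorphism
needs to be built. -/
lemma exists_eq_simple (ha : IsSimple a) : ∃ x, a = simple x := by
  classical
  rw [IsSimple, finrank_hom] at ha
  obtain ⟨x, hx⟩ : ∃ x, dim a x ≠ 0 := by
    by_contra! h
    simp [h] at ha
  have h1 : ∀ y, y ≠ x → dim a y = 0 := by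
    intro y hy
    by_contra h
    have h2 := Finset.add_le_sum (f := fun x => dim a x * dim a x) (s := Finset.univ)
      (fun _ _ => Nat.zero_le _) (Finset.mem_univ x) (Finset.mem_univ y) hy.symm
    have h3 := Nat.mul_pos (Nat.pos_of_ne_zero hx) (Nat.pos_of_ne_zero hx)
    have h4 := Nat.mul_pos (Nat.pos_of_ne_zero h) (Nat.pos_of_ne_zero h)
    omega
  rw [Finset.sum_eq_single x (fun y _ hy => by rw [h1 y hy, mul_zero]) (by simp)] at ha
  refine ⟨x, ext (funext fun y => ?_)⟩
  by_cases h : y = x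
  · subst h
    rw [dim_simple_self]
    exact Nat.eq_one_of_mul_eq_one_left ha
  · rw [h1 y h, dim_simple_ne h]

end ModelObj

open ModelObj in
/-- The 2-Hilbert space of families of Hilbert spaces indexed by the points of a gerbe. -/
def modelTwoHilb : MarkedTwoHilb.{v, u} where
  carrier := ModelObj.{w, v, u} X
  hasFiniteBiproducts := hasFiniteBiproducts X
  isIdempotentComplete := isIdempotentComplete X
  idx := X.pt
  e := simple
  isSimple_e := isSimple_simple
  e_injective _ _ h := h.elim simple_injective
  exists_iso_e _ ha := (exists_eq_simple ha).imp fun _ h => ⟨eqToIso h⟩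

end Gerbe

end

end TwoRepGerbe

namespace TwoRepGerbe

noncomputable section

lemma castMatrix_mul_assoc {l m n r : ℕ} (h : l = m) (h' : m = n) (A : Matrix (Fin n) (Fin r) ℂ) :
    castMatrix h * (castMatrix h' * A) = castMatrix (h.trans h') * A := by
  rw [← Matrix.mul_assoc, castMatrix_mul]

namespace Gerbe

variable {G : Type w} [Group G] {X : Gerbe.{w, u} G}

/-! ### Phases of arrows relative to a choice of arrows -/

lemma exists_arrow (g : G) {x y : X.pt} (h : g • x = y) : ∃ r : x ⟶ y, X.deg r = g := by
  subst h
  exact X.deg_full g x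

/-- The ratio of an arrow and the chosen arrow of the same degree. -/
def ratio {g : G} {x y : X.pt} (r : x ⟶ y) (h : X.deg r = g) : Circle :=
  (exists_eq_comp_phase (Exists.choose (p := fun r : x ⟶ y => X.deg r = g) ⟨r, h⟩) r
    ((Exists.choose_spec (p := fun r : x ⟶ y => X.deg r = g) ⟨r, h⟩).trans h.symm)).choose

lemma ratio_comp_phase {g : G} {x y : X.pt} (r : x ⟶ y) (h : X.deg r = g) (ζ : Circle)
    (h' : X.deg (r ≫ X.phase ζ y) = g) : ratio (r ≫ X.phase ζ y) h' = ratio r h * ζ := by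
  have h1 : ∀ (r : x ⟶ y) (h : X.deg r = g),
      r = Exists.choose (p := fun r : x ⟶ y => X.deg r = g) ⟨r, h⟩ ≫ X.phase (ratio r h) y :=
    fun r h => (exists_eq_comp_phase (Exists.choose (p := fun r : x ⟶ y => X.deg r = g) ⟨r, h⟩) r
      ((Exists.choose_spec (p := fun r : x ⟶ y => X.deg r = g) ⟨r, h⟩).trans h.symm)).choose_spec
  refine comp_phase_injective _ ((h1 _ h').symm.trans ?_)
  rw [← comp_phase_phase]
  exact congrArg (· ≫ X.phase ζ y) (h1 r h)

/-- `m` is the phase by which the composite of the chosen arrows over g₁ and g₂ differs from the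
chosen arrow over g. Only the final point z is recorded, as the degrees determine the other points;
quantifying over x and y avoids transporting arrows along equalities of points. -/
lemma exists_mulPhase (g₂ g₁ g : G) (h : g₂ * g₁ = g) (z : X.pt) : ∃ m : Circle,
    ∀ {x y : X.pt} (r₁ : x ⟶ y) (r₂ : y ⟶ z) (h₁ : X.deg r₁ = g₁) (h₂ : X.deg r₂ = g₂)
      (h₁₂ : X.deg (r₁ ≫ r₂) = g), ratio r₂ h₂ * ratio r₁ h₁ * m = ratio (r₁ ≫ r₂) h₁₂ := by
  subst h
  -- The relation for one composable pair dictates `m`. Any other pair differs from it by phases,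
  -- which multiply both sides equally.
  obtain ⟨s₂, hs₂⟩ := exists_arrow (X := X) g₂ (x := g₂⁻¹ • z) (y := z) (smul_inv_smul _ _)
  obtain ⟨s₁, hs₁⟩ := exists_arrow (X := X) g₁ (x := g₁⁻¹ • g₂⁻¹ • z) (smul_inv_smul _ _)
  have hs : X.deg (s₁ ≫ s₂) = g₂ * g₁ := by rw [X.deg_comp, hs₁, hs₂]
  refine ⟨(ratio s₂ hs₂ * ratio s₁ hs₁)⁻¹ * ratio (s₁ ≫ s₂) hs, fun {x y} r₁ r₂ h₁ h₂ h₁₂ => ?_⟩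
  obtain rfl : g₂⁻¹ • z = y := by rw [← X.deg_smul r₂, h₂, inv_smul_smul]
  obtain rfl : g₁⁻¹ • g₂⁻¹ • z = x := by rw [← X.deg_smul r₁, h₁, inv_smul_smul]
  obtain ⟨ζ₁, rfl⟩ := exists_eq_comp_phase s₁ r₁ (hs₁.trans h₁.symm)
  obtain ⟨ζ₂, rfl⟩ := exists_eq_comp_phase s₂ r₂ (hs₂.trans h₂.symm)
  have h3 : (s₁ ≫ X.phase ζ₁ _) ≫ s₂ ≫ X.phase ζ₂ z = (s₁ ≫ s₂) ≫ X.phase (ζ₁ * ζ₂) z := by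
    rw [comp_phase_comp, comp_comp_phase, comp_phase_phase, mul_comm]
  have h4 : ratio ((s₁ ≫ X.phase ζ₁ _) ≫ s₂ ≫ X.phase ζ₂ z) h₁₂ =
      ratio (s₁ ≫ s₂) hs * (ζ₁ * ζ₂) := by
    rw [← ratio_comp_phase _ hs _ (h3 ▸ h₁₂)]
    congr 1
  rw [h4, ratio_comp_phase _ hs₁, ratio_comp_phase _ hs₂, mul_inv]
  calc _ = (ratio s₁ hs₁)⁻¹ * ratio s₁ hs₁ * ((ratio s₂ hs₂)⁻¹ * ratio s₂ hs₂) *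
      (ratio (s₁ ≫ s₂) hs * (ζ₁ * ζ₂)) := by
        simp only [mul_comm, mul_assoc, mul_left_comm]
    _ = _ := by rw [inv_mul_cancel, inv_mul_cancel, one_mul, one_mul]

/-- The cocycle of the chosen arrows. -/
def mulPhase (g₂ g₁ g : G) (h : g₂ * g₁ = g) (z : X.pt) : Circle :=
  (exists_mulPhase g₂ g₁ g h z).choose

lemma ratio_mul_mulPhase {g₂ g₁ g : G} (h : g₂ * g₁ = g) {x y z : X.pt} (r₁ : x ⟶ y) (r₂ : y ⟶ z)
    (h₁ : X.deg r₁ = g₁) (h₂ : X.deg r₂ = g₂) (h₁₂ : X.deg (r₁ ≫ r₂) = g) :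
    ratio r₂ h₂ * ratio r₁ h₁ * mulPhase g₂ g₁ g h z = ratio (r₁ ≫ r₂) h₁₂ :=
  (exists_mulPhase g₂ g₁ g h z).choose_spec r₁ r₂ h₁ h₂ h₁₂

lemma ratio_congr {g : G} {x y : X.pt} {r r' : x ⟶ y} (hr : r = r') (h : X.deg r = g)
    (h' : X.deg r' = g) : ratio r h = ratio r' h' := by
  subst hr
  rfl

/-- The phase of the identity. -/
def unitPhase (x : X.pt) : Circle := ratio (𝟙 x) (X.deg_id x)

/-- Apply the defining relation of `mulPhase` to an arrow followed by an identity, and cancel the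
phase of the arrow. -/
lemma unitPhase_mul_mulPhase (g : G) (y : X.pt) :
    unitPhase y * mulPhase 1 g g (one_mul g) y = 1 := by
  obtain ⟨r, hr⟩ := exists_arrow (X := X) g (x := g⁻¹ • y) (y := y) (smul_inv_smul _ _)
  have h := ratio_mul_mulPhase (one_mul g) r (𝟙 y) hr (X.deg_id y)
    (by rw [Category.comp_id, hr])
  rw [ratio_congr (Category.comp_id r) _ hr, mul_comm (ratio (𝟙 y) _), mul_assoc] at h
  exact mul_eq_left.1 h

lemma unitPhase_smul_mul_mulPhase (g : G) (y : X.pt) :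
    unitPhase (g⁻¹ • y) * mulPhase g 1 g (mul_one g) y = 1 := by
  obtain ⟨r, hr⟩ := exists_arrow (X := X) g (x := g⁻¹ • y) (y := y) (smul_inv_smul _ _)
  have h := ratio_mul_mulPhase (mul_one g) (𝟙 _) r (X.deg_id _) hr
    (by rw [Category.id_comp, hr])
  rw [ratio_congr (Category.id_comp r) _ hr, mul_assoc] at h
  exact mul_eq_left.1 h

/-- The cocycle identity comes from computing the phase of a triple composite with both bracketings.
The shift by g₃⁻¹ appears because the composite of the first two arrows ends at g₃⁻¹ • z. -/
lemma mulPhase_mul_mulPhase (g₃ g₂ g₁ g₃₂ g₂₁ g : G) (h₃₂ : g₃ * g₂ = g₃₂) (h₂₁ : g₂ * g₁ = g₂₁)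
    (h : g₃₂ * g₁ = g) (h' : g₃ * g₂₁ = g) (z : X.pt) :
    mulPhase g₃ g₂ g₃₂ h₃₂ z * mulPhase g₃₂ g₁ g h z =
      mulPhase g₂ g₁ g₂₁ h₂₁ (g₃⁻¹ • z) * mulPhase g₃ g₂₁ g h' z := by
  obtain ⟨r₃, h₃⟩ := exists_arrow (X := X) g₃ (x := g₃⁻¹ • z) (y := z) (smul_inv_smul _ _)
  obtain ⟨r₂, h₂⟩ := exists_arrow (X := X) g₂ (x := g₂⁻¹ • g₃⁻¹ • z) (smul_inv_smul _ _)
  obtain ⟨r₁, h₁⟩ := exists_arrow (X := X) g₁ (x := g₁⁻¹ • g₂⁻¹ • g₃⁻¹ • z) (smul_inv_smul _ _)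
  have d₃₂ : X.deg (r₂ ≫ r₃) = g₃₂ := by rw [X.deg_comp, h₃, h₂, h₃₂]
  have d₂₁ : X.deg (r₁ ≫ r₂) = g₂₁ := by rw [X.deg_comp, h₂, h₁, h₂₁]
  have d : X.deg (r₁ ≫ r₂ ≫ r₃) = g := by rw [X.deg_comp, d₃₂, h₁, h]
  have d' : X.deg ((r₁ ≫ r₂) ≫ r₃) = g := by rw [Category.assoc, d]
  have e₁ := ratio_mul_mulPhase h₃₂ r₂ r₃ h₂ h₃ d₃₂
  have e₂ := ratio_mul_mulPhase h r₁ (r₂ ≫ r₃) h₁ d₃₂ d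
  have e₃ := ratio_mul_mulPhase h₂₁ r₁ r₂ h₁ h₂ d₂₁
  have e₄ := ratio_mul_mulPhase h' (r₁ ≫ r₂) r₃ d₂₁ h₃ d'
  rw [← e₁] at e₂
  rw [← e₃, ratio_congr (Category.assoc _ _ _) d' d, ← e₂] at e₄
  refine mul_left_cancel (a := ratio r₃ h₃ * ratio r₂ h₂ * ratio r₁ h₁) ?_
  calc _ = _ := by
        rw [← mul_assoc, mul_right_comm _ (ratio r₁ h₁)]
    _ = _ := e₄.symm
    _ = _ := by simp only [mul_assoc]

namespace ModelObj

variable {a b c : ModelObj.{w, v, u} X}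

/-! ### Scalar morphisms -/

/-- The morphism between families of the same dimensions given by a family of phases. -/
def scalar (t : X.pt → Circle) (h : ∀ x, dim a x = dim b x) : a ⟶ b :=
  homMk fun x => (t x : ℂ) • castMatrix (h x)

@[simp] lemma mat_scalar (t : X.pt → Circle) (h : ∀ x, dim a x = dim b x) (x : X.pt) :
    mat (scalar t h) x = (t x : ℂ) • castMatrix (h x) := rfl

lemma scalar_comp (t t' : X.pt → Circle) (h : ∀ x, dim a x = dim b x)
    (h' : ∀ x, dim b x = dim c x) : scalar t h ≫ scalar t' h' =
      scalar (fun x => t x * t' x) (fun x => (h x).trans (h' x)) := hom_ext fun x => by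
  rw [mat_comp, mat_scalar, mat_scalar, mat_scalar, Matrix.smul_mul, Matrix.mul_smul, smul_smul,
    castMatrix_mul, Circle.coe_mul]

lemma scalar_eq_id {t : X.pt → Circle} (ht : ∀ x, t x = 1) (h : ∀ x, dim a x = dim a x) :
    scalar t h = 𝟙 a := hom_ext fun x => by
  rw [mat_scalar, ht, Circle.coe_one, one_smul, castMatrix_rfl, mat_id]

/-- Phases at points where the space is zero are irrelevant; for simple objects a single point
matters. -/
lemma scalar_congr {t t' : X.pt → Circle} (h : ∀ x, dim a x = dim b x)
    (ht : ∀ x, dim a x ≠ 0 → t x = t' x) : scalar t h = scalar t' h := hom_ext fun x => by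
  rw [mat_scalar, mat_scalar]
  by_cases hx : dim a x = 0
  · ext i
    exact absurd i.2 (by omega)
  · rw [ht x hx]

lemma smul_scalar (ζ : Circle) (t : X.pt → Circle) (h : ∀ x, dim a x = dim b x) :
    (ζ : ℂ) • scalar t h = scalar (fun x => t x * ζ) h := hom_ext fun x => by
  rw [mat_smul, mat_scalar, mat_scalar, smul_smul, Circle.coe_mul, mul_comm]

lemma dag_scalar (t : X.pt → Circle) (h : ∀ x, dim a x = dim b x) :
    dag (scalar t h) = scalar (fun x => (t x)⁻¹) (fun x => (h x).symm) := hom_ext fun x => by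
  rw [mat_dag, mat_scalar, mat_scalar, Matrix.conjTranspose_smul, castMatrix_conjTranspose,
    Circle.coe_inv_eq_conj, starRingEnd_apply]

lemma scalar_unitary (t : X.pt → Circle) (h : ∀ x, dim a x = dim b x) :
    IsUnitary (scalar t h) where
  comp_dag := by rw [dag_scalar, scalar_comp, scalar_eq_id fun x => mul_inv_cancel (t x)]
  dag_comp := by rw [dag_scalar, scalar_comp, scalar_eq_id fun x => inv_mul_cancel (t x)]

/-! ### The action of the group -/

/-- The action of the group on families of Hilbert spaces. -/
def actObj (g : G) (a : ModelObj.{w, v, u} X) : ModelObj.{w, v, u} X :=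
  of X fun y => dim a (g⁻¹ • y)

lemma dim_actObj (g : G) (a : ModelObj.{w, v, u} X) (y : X.pt) :
    dim (actObj g a) y = dim a (g⁻¹ • y) := congrFun (dim_of _) y

lemma dim_actObj_eq {g : G} {x y : X.pt} (h : g • x = y) (a : ModelObj.{w, v, u} X) :
    dim (actObj g a) y = dim a x := by
  rw [dim_actObj, ← h, inv_smul_smul]

/-- The action of the group on families of matrices. -/
def actMap (g : G) (f : a ⟶ b) : actObj g a ⟶ actObj g b :=
  homMk fun y => castMatrix (dim_actObj g a y) * mat f (g⁻¹ • y) *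
    castMatrix (dim_actObj g b y).symm

/-- With x and y free, the matrix can be evaluated at any description of the preimage of y, without
rewriting inside the dependent dimensions. -/
lemma mat_actMap {g : G} {x y : X.pt} (h : g • x = y) (f : a ⟶ b) :
    mat (actMap g f) y =
      castMatrix (dim_actObj_eq h a) * (mat f x * castMatrix (dim_actObj_eq h b).symm) := by
  obtain rfl : g⁻¹ • y = x := by rw [← h, inv_smul_smul]
  exact Matrix.mul_assoc _ _ _

variable (X) in
/-- The action of a group element as a functor. -/
def actFunctor (g : G) : ModelObj.{w, v, u} X ⥤ ModelObj.{w, v, u} X where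
  obj := actObj g
  map := actMap g
  map_id a := hom_ext fun y => by
    rw [mat_actMap (smul_inv_smul g y), mat_id, mat_id, Matrix.one_mul, castMatrix_mul,
      castMatrix_rfl]
  map_comp f f' := hom_ext fun y => by
    rw [mat_comp, mat_actMap (smul_inv_smul g y), mat_actMap (smul_inv_smul g y),
      mat_actMap (smul_inv_smul g y), mat_comp]
    simp only [Matrix.mul_assoc, castMatrix_mul_assoc, castMatrix_rfl, Matrix.one_mul]

lemma actMap_scalar (g : G) (t : X.pt → Circle) (h : ∀ x, dim a x = dim b x)
    (h' : ∀ x, dim (actObj g a) x = dim (actObj g b) x) :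
    actMap g (scalar t h) = scalar (fun y => t (g⁻¹ • y)) h' := hom_ext fun y => by
  rw [mat_actMap (smul_inv_smul g y), mat_scalar, mat_scalar, Matrix.smul_mul, Matrix.mul_smul,
    castMatrix_mul, castMatrix_mul]

lemma actFunctor_star (g : G) : IsStarFunctor (actFunctor.{w, v, u} X g) where
  map_add f f' := hom_ext fun y => by
    change mat (actMap g (f + f')) y = mat (actMap g f) y + mat (actMap g f') y
    rw [mat_actMap (smul_inv_smul g y), mat_actMap (smul_inv_smul g y),
      mat_actMap (smul_inv_smul g y), mat_add, Matrix.add_mul, Matrix.mul_add]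
  map_smul r f := hom_ext fun y => by
    change mat (actMap g (r • f)) y = r • mat (actMap g f) y
    rw [mat_actMap (smul_inv_smul g y), mat_actMap (smul_inv_smul g y), mat_smul, Matrix.smul_mul,
      Matrix.mul_smul]
  map_dag f := hom_ext fun y => by
    change mat (actMap g (dag f)) y = (mat (actMap g f) y).conjTranspose
    rw [mat_actMap (smul_inv_smul g y), mat_actMap (smul_inv_smul g y), mat_dag,
      Matrix.conjTranspose_mul, Matrix.conjTranspose_mul, castMatrix_conjTranspose,
      castMatrix_conjTranspose, Matrix.mul_assoc]

/-- Reindex the sum over points by g. The metric is invariant, and the comparison matrices cancel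
under the trace. -/
lemma homIp_actMap (g : G) (f f' : a ⟶ b) : homIp (actMap g f) (actMap g f') = homIp f f' := by
  rw [homIp_eq, homIp_eq, ← Equiv.sum_comp (MulAction.toPerm g)]
  refine Finset.sum_congr rfl fun x _ => ?_
  rw [MulAction.toPerm_apply, X.k_smul, mat_actMap rfl, mat_actMap rfl]
  simp only [Matrix.conjTranspose_mul, castMatrix_conjTranspose, Matrix.mul_assoc,
    castMatrix_mul_assoc, castMatrix_rfl, Matrix.one_mul]
  rw [Matrix.trace_mul_comm]
  simp only [Matrix.mul_assoc, castMatrix_mul, castMatrix_rfl, Matrix.mul_one]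

lemma actMap_surjective (g : G) (a b : ModelObj.{w, v, u} X) :
    Function.Surjective (actMap g : (a ⟶ b) → _) := by
  intro f
  refine ⟨homMk fun x => castMatrix (dim_actObj_eq (g := g) (x := x) rfl a).symm *
    (mat f (g • x) * castMatrix (dim_actObj_eq (g := g) (x := x) rfl b)), hom_ext fun y => ?_⟩
  obtain ⟨x, rfl⟩ := MulAction.surjective g y
  rw [mat_actMap rfl, mat_homMk]
  simp only [Matrix.mul_assoc, castMatrix_mul, castMatrix_mul_assoc, castMatrix_rfl,
    Matrix.one_mul, Matrix.mul_one]

lemma dim_unit (a : ModelObj.{w, v, u} X) (x : X.pt) : dim a x = dim (actObj 1 a) x :=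
  (dim_actObj_eq (one_smul G x) a).symm

lemma dim_mul {g₂ g₁ g : G} (h : g₂ * g₁ = g) (a : ModelObj.{w, v, u} X) (x : X.pt) :
    dim (actObj g₂ (actObj g₁ a)) x = dim (actObj g a) x := by
  rw [dim_actObj, dim_actObj, dim_actObj, ← h, mul_inv_rev, mul_smul]

/-- The components of the unit coherence isomorphism. -/
def unitHom (a : ModelObj.{w, v, u} X) : a ⟶ actObj 1 a := scalar unitPhase (dim_unit a)

/-- The components of the multiplication coherence isomorphisms. -/
def mulHom (g₂ g₁ g : G) (h : g₂ * g₁ = g) (a : ModelObj.{w, v, u} X) :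
    actObj g₂ (actObj g₁ a) ⟶ actObj g a := scalar (mulPhase g₂ g₁ g h) (dim_mul h a)

lemma unitHom_naturality (f : a ⟶ b) : f ≫ unitHom b = unitHom a ≫ actMap 1 f :=
  hom_ext fun x => by
    rw [mat_comp, mat_comp, mat_actMap (one_smul G x), unitHom, unitHom, mat_scalar, mat_scalar,
      Matrix.mul_smul, Matrix.smul_mul, castMatrix_mul_assoc, castMatrix_rfl, Matrix.one_mul]

lemma mulHom_naturality (g₂ g₁ g : G) (h : g₂ * g₁ = g) (f : a ⟶ b) :
    actMap g₂ (actMap g₁ f) ≫ mulHom g₂ g₁ g h b = mulHom g₂ g₁ g h a ≫ actMap g f :=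
  hom_ext fun z => by
    have h1 : g • g₁⁻¹ • g₂⁻¹ • z = z := by
      rw [← h, mul_smul, smul_inv_smul, smul_inv_smul]
    rw [mat_comp, mat_comp, mat_actMap (smul_inv_smul g₂ z), mat_actMap (smul_inv_smul g₁ _),
      mat_actMap h1, mulHom, mulHom, mat_scalar, mat_scalar, Matrix.mul_smul, Matrix.smul_mul]
    simp only [Matrix.mul_assoc, castMatrix_mul, castMatrix_mul_assoc]

lemma unitHom_comp_mulHom (g : G) (a : ModelObj.{w, v, u} X) :
    unitHom (actObj g a) ≫ mulHom 1 g g (one_mul g) a = 𝟙 (actObj g a) := by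
  rw [unitHom, mulHom, scalar_comp, scalar_eq_id (unitPhase_mul_mulPhase g)]

lemma actMap_unitHom_comp_mulHom (g : G) (a : ModelObj.{w, v, u} X) :
    actMap g (unitHom a) ≫ mulHom g 1 g (mul_one g) a = 𝟙 (actObj g a) := by
  rw [unitHom, actMap_scalar g unitPhase _ fun x => (dim_mul (mul_one g) a x).symm, mulHom,
    scalar_comp, scalar_eq_id (unitPhase_smul_mul_mulPhase g)]

/-- All the coherence morphisms are scalar, and scalar morphisms compose by multiplying phases.
Acting by g₃ evaluates the phases at g₃⁻¹ • x, so the condition is the cocycle identity. -/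
lemma mulHom_assoc (g₃ g₂ g₁ g₃₂ g₂₁ g : G) (h₃₂ : g₃ * g₂ = g₃₂) (h₂₁ : g₂ * g₁ = g₂₁)
    (h : g₃₂ * g₁ = g) (h' : g₃ * g₂₁ = g) (a : ModelObj.{w, v, u} X) :
    mulHom g₃ g₂ g₃₂ h₃₂ (actObj g₁ a) ≫ mulHom g₃₂ g₁ g h a =
      actMap g₃ (mulHom g₂ g₁ g₂₁ h₂₁ a) ≫ mulHom g₃ g₂₁ g h' a := by
  rw [mulHom, mulHom, mulHom, mulHom, actMap_scalar g₃ (mulPhase g₂ g₁ g₂₁ h₂₁) _ fun x => by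
    rw [dim_actObj, dim_actObj g₃ (actObj g₂₁ a), dim_mul h₂₁], scalar_comp, scalar_comp]
  exact scalar_congr _ fun x _ => mulPhase_mul_mulPhase g₃ g₂ g₁ g₃₂ g₂₁ g h₃₂ h₂₁ h h' x

end ModelObj

open ModelObj in
/-- The unitary 2-representation on families of Hilbert spaces indexed by the points of a gerbe. -/
def modelTwoRep (X : Gerbe.{w, u} G) : MarkedTwoRep.{w, v, u} G where
  toMarkedTwoHilb := modelTwoHilb X
  act := actFunctor X
  act_star := actFunctor_star
  act_isometry g _ _ := homIp_actMap g
  act_surjective := actMap_surjective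
  unit := NatIso.ofComponents
    (fun a => (scalar_unitary unitPhase (dim_unit (X := X) a)).iso) unitHom_naturality
  unit_unitary a := scalar_unitary unitPhase (dim_unit (X := X) a)
  mul g₂ g₁ g h := NatIso.ofComponents
    (fun a => (scalar_unitary (mulPhase g₂ g₁ g h) (dim_mul (X := X) h a)).iso)
    (mulHom_naturality g₂ g₁ g h)
  mul_unitary g₂ g₁ g h a := scalar_unitary (mulPhase g₂ g₁ g h) (dim_mul (X := X) h a)
  unit_mul g a := unitHom_comp_mulHom g a
  mul_unit g a := actMap_unitHom_comp_mulHom g a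
  mul_assoc g₃ g₂ g₁ g₃₂ g₂₁ g h₃₂ h₂₁ h h' a := mulHom_assoc g₃ g₂ g₁ g₃₂ g₂₁ g h₃₂ h₂₁ h h' a

end Gerbe

end

end TwoRepGerbe

namespace TwoRepGerbe

noncomputable section

/-! ## Equivalences of gerbes from strict isomorphisms of the underlying extensions -/

/-- A strict isomorphism of central extensions of action groupoids. -/
structure StrictEquiv {G : Type w} [Group G] (X Y : Gerbe.{w, u} G) where
  obj : X.pt ≃ Y.pt
  map : ∀ {x y : X.pt}, (x ⟶ y) → (obj x ⟶ obj y)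
  map_id : ∀ x : X.pt, map (𝟙 x) = 𝟙 (obj x)
  map_comp : ∀ {x y z : X.pt} (r : x ⟶ y) (s : y ⟶ z), map (r ≫ s) = map r ≫ map s
  deg_map : ∀ {x y : X.pt} (r : x ⟶ y), Y.deg (map r) = X.deg r
  map_phase : ∀ {x y : X.pt} (r : x ⟶ y) (ζ : Circle),
    map (r ≫ X.phase ζ y) = map r ≫ Y.phase ζ (obj y)

namespace StrictEquiv

variable {G : Type w} [Group G] {X Y M N : Gerbe.{w, u} G}

variable (X) in
/-- The identity. -/
def refl : StrictEquiv X X where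
  obj := Equiv.refl _
  map r := r
  map_id _ := rfl
  map_comp _ _ := rfl
  deg_map _ := rfl
  map_phase _ _ := rfl

/-- An arrow of the same degree exists between the preimages, since degrees determine endpoints. Its
image differs from `b` by a phase, which lifts. -/
lemma map_surjective (Φ : StrictEquiv X Y) {x y : X.pt} (b : Φ.obj x ⟶ Φ.obj y) :
    ∃ r : x ⟶ y, Φ.map r = b := by
  have h : Y.deg b • x = y := by
    obtain ⟨s, hs⟩ := X.deg_full (Y.deg b) x
    have h1 := Y.deg_smul (Φ.map s)
    rw [Φ.deg_map, hs] at h1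
    exact Φ.obj.injective (h1.symm.trans (Y.deg_smul b))
  obtain ⟨s, hs⟩ := Gerbe.exists_arrow _ h
  obtain ⟨ζ, rfl⟩ := Gerbe.exists_eq_comp_phase (Φ.map s) b (by rw [Φ.deg_map, hs])
  exact ⟨s ≫ X.phase ζ _, Φ.map_phase s ζ⟩

/-- The pullback of a morphism of gerbes along strict isomorphisms. -/
def pullback (Φ : StrictEquiv X M) (Ψ : StrictEquiv Y N) (K : Kernel M N) : Kernel X Y :=
  Kernel.ofAct (fun y x => K.fiber (Ψ.obj y) (Φ.obj x))
    (fun b a h => K.act (Ψ.map b) (Φ.map a) (by rw [Ψ.deg_map, Φ.deg_map, h]))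
    (fun y x h => (Kernel.act_congr K (Ψ.map_id y) (Φ.map_id x) _
      (by rw [Gerbe.deg_id, Gerbe.deg_id])).trans (K.act_id _ _ _))
    (fun b a h b' a' h' h'' => (Kernel.act_congr K (Ψ.map_comp b b') (Φ.map_comp a a') _
      (by rw [← Ψ.map_comp, ← Φ.map_comp, Ψ.deg_map, Φ.deg_map, h''])).trans
        (K.act_comp _ _ _ _ _ _ _))
    (fun b a h s t => K.ip_act _ _ _ s t)
    (fun {y y' x x'} b a h ζ h' => (Kernel.act_congr K (Ψ.map_phase b ζ) rfl _
      (by rw [← Ψ.map_phase, Ψ.deg_map, Φ.deg_map, h'])).trans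
        (K.act_comp_phase_left _ _ _ ζ _))
    (fun {y y' x x'} b a h ζ h' => (Kernel.act_congr K rfl (Φ.map_phase a ζ) _
      (by rw [← Φ.map_phase, Ψ.deg_map, Φ.deg_map, h'])).trans
        (K.act_comp_phase_right _ _ _ ζ _))

end StrictEquiv

/-! ### Inverting morphisms whose fibers are lines along a bijection -/

namespace Kernel

variable {G : Type w} [Group G] {X Y Z : Gerbe.{w, u} G}

lemma cmk_ne_zero {E : Kernel X Y} {F : Kernel Y Z} {z : Z.pt} {x : X.pt} (y : Y.pt)
    {f : F.fiber z y} {e : E.fiber y x} (hf : f ≠ 0) (he : e ≠ 0) :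
    (cmk y f e : (comp E F).fiber z x) ≠ 0 := by
  intro h
  have h1 : Hilb.ip (cmk y f e : (comp E F).fiber z x) (cmk y f e) =
      ((1 / Y.k y : ℝ) : ℂ) * (Hilb.ip f f * Hilb.ip e e) :=
    conv.ip_mk (k := Y.k) (hk := Y.k_pos) (V := fun y => F.fiber z y) (W := fun y => E.fiber y x)
      y f f e e
  rw [h, Hilb.ip_zero_left] at h1
  have hk : ((1 / Y.k y : ℝ) : ℂ) ≠ 0 := Complex.ofReal_ne_zero.2 (one_div_pos.2 (Y.k_pos y)).ne'
  rcases mul_eq_zero.1 ((mul_eq_zero.1 h1.symm).resolve_left hk) with h2 | h2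
  · exact hf (Hilb.eq_zero_of_ip_self h2)
  · exact he (Hilb.eq_zero_of_ip_self h2)

lemma comp_induction {E : Kernel X Y} {F : Kernel Y Z} {z : Z.pt} {x : X.pt}
    {p : (comp E F).fiber z x → Prop} (s : (comp E F).fiber z x) (h0 : p 0)
    (hadd : ∀ s t, p s → p t → p (s + t)) (hmk : ∀ y f e, p (cmk y f e)) : p s :=
  conv.induction (k := Y.k) (hk := Y.k_pos) (V := fun y => F.fiber z y)
    (W := fun y => E.fiber y x) s h0 hadd hmk

/-- Two morphisms in opposite directions whose fibers are lines along the graph of a bijection,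
spanned by invariant vectors, are inverse to each other. -/
lemma nonempty_iso_of_span {E : Kernel X Y} {F : Kernel Y X} {J : Type u} (q : J ≃ X.pt)
    (p : J ≃ Y.pt) (f : ∀ j, F.fiber (q j) (p j)) (e : ∀ j, E.fiber (p j) (q j))
    (hf : ∀ j, f j ≠ 0) (he : ∀ j, e j ≠ 0)
    (hf' : ∀ j (s : F.fiber (q j) (p j)), ∃ c : ℂ, s = c • f j)
    (he' : ∀ j (s : E.fiber (p j) (q j)), ∃ c : ℂ, s = c • e j)
    (hf₀ : ∀ j i, j ≠ i → ∀ s : F.fiber (q j) (p i), s = 0)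
    (he₀ : ∀ j i, j ≠ i → ∀ s : E.fiber (p j) (q i), s = 0)
    (hinv : ∀ {j j' : J} (a : q j ⟶ q j'), ∃ (b : p j ⟶ p j') (h : X.deg a = Y.deg b),
      F.act a b h (f j) = f j' ∧ E.act b a h.symm (e j) = e j') :
    Nonempty (idKernel X ≅ comp E F) := by
  -- The invariant diagonal vectors are the tensors f_j ⊗ e_j, transported along `q` since a point x
  -- is only propositionally of the form q j.
  let k : ∀ x, (comp E F).fiber x x :=
    Equiv.piCongrLeft (fun x => (comp E F).fiber x x) q fun j => cmk (p j) (f j) (e j)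
  have hk : ∀ j, k (q j) = cmk (p j) (f j) (e j) := fun j =>
    Equiv.piCongrLeft_apply_apply (fun x => (comp E F).fiber x x) q _ j
  have hinv' : ∀ {x x' : X.pt} (a : x ⟶ x'), (comp E F).act a a rfl (k x) = k x' := by
    intro x x' a
    obtain ⟨j, rfl⟩ := q.surjective x
    obtain ⟨j', rfl⟩ := q.surjective x'
    obtain ⟨b, h, h1, h2⟩ := hinv a
    rw [hk, hk, act_cmk E F a a rfl b h h.symm, h1, h2]
  refine ⟨isoOfBijective (ofUnit k hinv') (ofUnit_bijective k hinv' (fun x => ?_)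
    (fun y x hyx s => ?_) (fun x s => ?_))⟩
  · obtain ⟨j, rfl⟩ := q.surjective x
    rw [hk]
    exact cmk_ne_zero _ (hf j) (he j)
  · obtain ⟨j, rfl⟩ := q.surjective y
    obtain ⟨i, rfl⟩ := q.surjective x
    induction s using comp_induction with
    | h0 => rfl
    | hadd s t hs ht => rw [hs, ht, add_zero]
    | hmk y f e =>
      obtain ⟨l, rfl⟩ := p.surjective y
      -- The factor of `F` vanishes unless the intermediate index l is j, and then the factor of `E`
      -- vanishes because j and i differ.
      by_cases hjl : j = l
      · rw [he₀ l i (fun h => hyx (congrArg q (hjl.trans h))) e, map_zero]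
      · rw [hf₀ j l hjl f, map_zero, LinearMap.zero_apply]
  · obtain ⟨j, rfl⟩ := q.surjective x
    rw [hk]
    induction s using comp_induction with
    | h0 => exact ⟨0, (zero_smul ℂ _).symm⟩
    | hadd s t hs ht =>
      obtain ⟨c, rfl⟩ := hs
      obtain ⟨d, rfl⟩ := ht
      exact ⟨c + d, (add_smul c d _).symm⟩
    | hmk y s t =>
      obtain ⟨l, rfl⟩ := p.surjective y
      by_cases hjl : j = l
      · subst hjl
        obtain ⟨c, rfl⟩ := hf' j s
        obtain ⟨d, rfl⟩ := he' j t
        exact ⟨d * c, by rw [map_smul, LinearMap.map_smul₂, smul_smul]⟩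
      · exact ⟨0, by rw [hf₀ j l hjl s, map_zero, LinearMap.zero_apply, zero_smul]⟩

lemma idOne_ne_zero (x : X.pt) : idOne x ≠ 0 := fun h =>
  one_ne_zero ((idFiber.val_one X x).symm.trans ((congrArg (idFiber.val X) h).trans (map_zero _)))

lemma idKernel_eq_smul_idOne (x : X.pt) (s : (idKernel X).fiber x x) :
    ∃ c : ℂ, s = c • idOne x := ⟨idFiber.val X s, idFiber.eq_smul_one s⟩

end Kernel

namespace StrictEquiv

variable {G : Type w} [Group G] {X Y : Gerbe.{w, u} G}

open Kernel in
-- Pulling the identity bundle of Y back along Φ on either side gives bundles whose fibers are lines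
-- along the graph of Φ, spanned by vectors invariant under matching arrows. The metrics of X and Y
-- need not correspond, because invertible 2-morphisms are not required to be unitary.
lemma nonempty_equivalence (Φ : StrictEquiv X Y) : Nonempty (Bicategory.Equivalence Y X) := by
  let E : Kernel X Y := pullback Φ (refl Y) (idKernel Y)
  let F : Kernel Y X := pullback (refl Y) Φ (idKernel Y)
  let f : ∀ x, F.fiber x (Φ.obj x) := fun x => idOne (Φ.obj x)
  let e : ∀ x, E.fiber (Φ.obj x) x := fun x => idOne (Φ.obj x)
  have hne : ∀ {x y}, x ≠ y → Φ.obj x ≠ Φ.obj y := fun h => Φ.obj.injective.ne h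
  obtain ⟨i⟩ : Nonempty (idKernel X ≅ Kernel.comp E F) :=
    nonempty_iso_of_span (Equiv.refl _) Φ.obj f e (fun x => idOne_ne_zero _)
      (fun x => idOne_ne_zero _) (fun x => idKernel_eq_smul_idOne _)
      (fun x => idKernel_eq_smul_idOne _) (fun x y h => idFiber.eq_zero (hne h))
      (fun x y h => idFiber.eq_zero (hne h))
      (fun a => ⟨Φ.map a, (Φ.deg_map a).symm, act_idOne _ _, act_idOne _ _⟩)
  obtain ⟨j⟩ : Nonempty (idKernel Y ≅ Kernel.comp F E) :=
    nonempty_iso_of_span Φ.obj (Equiv.refl _) e f (fun x => idOne_ne_zero _)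
      (fun x => idOne_ne_zero _) (fun x => idKernel_eq_smul_idOne _)
      (fun x => idKernel_eq_smul_idOne _) (fun x y h => idFiber.eq_zero (hne h))
      (fun x y h => idFiber.eq_zero (hne h))
      (fun b => by
        obtain ⟨a, rfl⟩ := Φ.map_surjective b
        exact ⟨a, Φ.deg_map a, act_idOne _ _, act_idOne _ _⟩)
  -- The two isomorphisms are unrelated choices; the counit is corrected so that the triangle
  -- identity holds.
  exact ⟨Bicategory.Equivalence.mkOfAdjointifyCounit (f := F) (g := E) j i.symm⟩

end StrictEquiv

/-! ## The gerbe of the model 2-representation -/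

namespace Gerbe

variable {G : Type w} [Group G] {X : Gerbe.{w, u} G}

namespace ModelObj

lemma dim_simple_actObj {g : G} {x y : X.pt} (h : g • x = y) (z : X.pt) :
    dim (simple.{w, v, u} y) z = dim (actObj g (simple.{w, v, u} x)) z := by
  rw [dim_actObj]
  by_cases hz : z = y
  · rw [hz, dim_simple_self, ← h, inv_smul_smul, dim_simple_self]
  · rw [dim_simple_ne hz, dim_simple_ne]
    rintro rfl
    exact hz (by rw [← h, smul_inv_smul])

/-- The unitary `e_y ⟶ α_g (e_x)` of an arrow `x ⟶ y` of degree `g`. -/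
def arrowHom {g : G} {x y : X.pt} (r : x ⟶ y) (h : X.deg r = g) :
    simple.{w, v, u} y ⟶ actObj g (simple.{w, v, u} x) :=
  scalar (fun _ => ratio r h) (dim_simple_actObj (by rw [← h, X.deg_smul]))

lemma arrowHom_unitary {g : G} {x y : X.pt} (r : x ⟶ y) (h : X.deg r = g) :
    IsUnitary (arrowHom.{w, v, u} r h) := scalar_unitary _ _

lemma arrowHom_id (x : X.pt) : arrowHom.{w, v, u} (𝟙 x) (X.deg_id x) = unitHom (simple x) :=
  scalar_congr _ fun z hz => by
    obtain rfl : z = x := by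
      by_contra h
      exact hz (dim_simple_ne h)
    rfl

/-- The unitary of an arrow carries its phase relative to the chosen arrow. Composition in the gerbe
of the model inserts `mulPhase`, which is exactly the correction needed. -/
lemma arrowHom_comp {g₂ g₁ g : G} (h : g₂ * g₁ = g) {x y z : X.pt} (r : x ⟶ y) (s : y ⟶ z)
    (hr : X.deg r = g₁) (hs : X.deg s = g₂) (hrs : X.deg (r ≫ s) = g) :
    arrowHom.{w, v, u} (r ≫ s) hrs =
      arrowHom s hs ≫ actMap g₂ (arrowHom r hr) ≫ mulHom g₂ g₁ g h (simple x) := by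
  rw [arrowHom, arrowHom, arrowHom, mulHom, actMap_scalar g₂ _ _ fun w => by
    rw [dim_actObj, dim_actObj g₂ (actObj g₁ _), dim_simple_actObj (g := g₁) (x := x) (y := y)
      (by rw [← hr, X.deg_smul])],
    scalar_comp, scalar_comp]
  refine scalar_congr _ fun w hw => ?_
  obtain rfl : w = z := by
    by_contra h
    exact hw (dim_simple_ne h)
  rw [← ratio_mul_mulPhase h r s hr hs hrs, mul_assoc]

lemma arrowHom_comp_phase {g : G} {x y : X.pt} (r : x ⟶ y) (h : X.deg r = g) (ζ : Circle)
    (h' : X.deg (r ≫ X.phase ζ y) = g) :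
    arrowHom.{w, v, u} (r ≫ X.phase ζ y) h' = (ζ : ℂ) • arrowHom r h := by
  rw [arrowHom, arrowHom, smul_scalar]
  exact scalar_congr _ fun _ _ => ratio_comp_phase r h ζ h'

end ModelObj

open ModelObj

/-- The arrow of the gerbe of the model 2-representation given by an arrow of `X`. -/
def modelArrow {g : G} {x y : X.pt} (r : x ⟶ y) (h : X.deg r = g) :
    (modelTwoRep.{w, v, u} X).Arrow x y := ⟨g, arrowHom r h, arrowHom_unitary r h⟩

/-- The degree of an identity or a composite is only propositionally 1 or a product; this replaces
the recorded degree so that the underlying unitaries can be compared. -/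
lemma modelArrow_eq {g : G} {x y : X.pt} (r : x ⟶ y) (h : X.deg r = g) :
    modelArrow.{w, v, u} r rfl = modelArrow r h := by
  subst h
  rfl

lemma modelArrow_id (x : X.pt) :
    modelArrow.{w, v, u} (𝟙 x) rfl = MarkedTwoRep.Arrow.id (modelTwoRep X) x := by
  rw [modelArrow_eq (𝟙 x) (X.deg_id x)]
  exact MarkedTwoRep.Arrow.ext_u (α := modelTwoRep X) (arrowHom_id x)

lemma modelArrow_comp {x y z : X.pt} (r : x ⟶ y) (s : y ⟶ z) :
    modelArrow.{w, v, u} (r ≫ s) rfl =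
      MarkedTwoRep.Arrow.comp (modelArrow r rfl) (modelArrow s rfl) := by
  rw [modelArrow_eq (r ≫ s) (X.deg_comp r s)]
  exact MarkedTwoRep.Arrow.ext_u (α := modelTwoRep X) (arrowHom_comp rfl r s rfl rfl _)

lemma modelArrow_comp_phase {x y : X.pt} (r : x ⟶ y) (ζ : Circle) :
    modelArrow.{w, v, u} (r ≫ X.phase ζ y) rfl =
      MarkedTwoRep.Arrow.smul ζ (modelArrow r rfl) := by
  have h : X.deg (r ≫ X.phase ζ y) = X.deg r := by rw [X.deg_comp, X.deg_phase, one_mul]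
  rw [modelArrow_eq (r ≫ X.phase ζ y) h]
  exact MarkedTwoRep.Arrow.ext_u (α := modelTwoRep X) (arrowHom_comp_phase r rfl ζ h)

variable (X) in
/-- A gerbe is strictly isomorphic to the gerbe of its model 2-representation. -/
def modelEquiv : StrictEquiv X (modelTwoRep.{w, v, u} X).gerbe where
  obj := Equiv.refl X.pt
  map r := modelArrow r rfl
  map_id x := modelArrow_id x
  map_comp r s := modelArrow_comp r s
  deg_map _ := rfl
  map_phase r ζ := (modelArrow_comp_phase r ζ).trans
    (MarkedTwoRep.Arrow.comp_phase ζ (modelArrow r rfl)).symm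

end Gerbe

end

end TwoRepGerbe

/-! ### The equivalence of 2-categories -/

theorem mainTheorem6 {G : Type w} [Group G] [Finite G] :
    ∃ W : WeakTwoFunctorStructure (extraction.{w, v, u} G),
      -- the compositor `⟨ρ⟩ ∘ ⟨σ⟩ → ⟨ρ ∘ σ⟩` is `f ⊗ g ↦ ρ(g) ∘ f`
      (∀ {α β γ : MarkedTwoRep.{w, v, u} G} (σ : Intertwiner α β) (ρ : Intertwiner β γ)
        (κ : γ.idx) (μ : β.idx) (i : α.idx) (f : γ.e κ ⟶ ρ.functor.obj (β.e μ))
        (g : β.e μ ⟶ σ.functor.obj (α.e i)),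
        Kernel.app (W.mapComp σ ρ).inv κ i
            (Kernel.cmk (E := σ.kernel) (F := ρ.kernel) μ (Intertwiner.vec f)
              (Intertwiner.vec g)) =
          (Intertwiner.comp σ ρ).vec (f ≫ ρ.functor.map g)) ∧
      -- the unit isomorphism `id → ⟨id⟩` is `1 ↦ id`
      (∀ (α : MarkedTwoRep.{w, v, u} G) (i : α.idx),
        Kernel.app (W.mapId α).inv i i (Kernel.idOne (X := α.gerbe) i) =
          (Intertwiner.id α).vec (𝟙 (α.e i))) ∧
      IsEquivalenceOfTwoCategories W.toPseudofunctor ∧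
      -- on spaces of 2-morphisms it is a unitary linear map
      (∀ {α β : MarkedTwoRep.{w, v, u} G} (σ ρ : Intertwiner α β),
        ∃ L : (σ ⟶ ρ) ≃ₗ[ℂ] (σ.kernel ⟶ ρ.kernel),
          (∀ θ : σ ⟶ ρ, L θ = (extraction.{w, v, u} G).map₂ (a := α) (b := β) θ) ∧
          ∀ θ θ' : σ ⟶ ρ, Kernel.innerProduct (L θ) (L θ') = Intertwiner.innerProduct θ θ') := by
  refine ⟨extractionStructure G, fun σ ρ κ μ i f g => Intertwiner.compositor_app_cmk σ ρ f g,
    fun α i => Intertwiner.unitIso_hom_app_idOne α i,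
    ⟨fun X => ⟨X.modelTwoRep, X.modelEquiv.nonempty_equivalence⟩,
      fun α β => extraction_local_isEquivalence α β⟩,
    fun σ ρ => ⟨Intertwiner.kernelHomEquiv σ ρ, fun θ => rfl, fun θ θ' =>
      Intertwiner.innerProduct_kernelHom θ θ'⟩⟩
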